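/- Model of computation: a real RAM, that is, a fixed finite program acting on arrays of natural numbers (indices) and arrays of real numbers, where each exact operation $+,-,\times$ on indices, $+,-,\times,\div$ on reals, each conversion of an index to a real number, each load, store and comparison costs one unit of time; elementary functions such as $\exp$ and rounding to integers are not available. The memory outside the input cells may hold anything at the start. Let $\omega$ be a real number such that two real $n\times n$ matrices can be multiplied on a real RAM in time $O(n^{\omega})$ (for all $n\ge 1$). **Lemma (numerical solution of Physarum dynamics).** Let $n\ge 1$, let $A\in\mathbb{Z}^{m\times n}$ have rank $m$, and let $b\in\mathbb{Z}^m$, $c\in\mathbb{Z}_{>0}^n$. Let $x_0\in\mathbb{R}^n_{>0}$ satisfy $Ax_0=b$; in particular the linear program $\min\{c^{T}x : Ax=b,\ x\ge 0\}$ is feasible. Let $D$ be the maximum of $|\det A'|$ over the square submatrices $A'$ of $A$ (the empty submatrix, with determinant $1$, included), and let $\|c\|_1=\sum_j |c_j|$. Let $T\ge 0$ and $0<\varepsilon<1$, and let $x:[0,T]\to\mathbb{R}^n_{>0}$ be the solution of the Physarum dynamics $$\frac{dx}{dt}=WA^{T}\,(AWA^{T})^{-1}b-x,\qquad W=\operatorname{diag}(x_1/c_1,\dots,x_n/c_n),\qquad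 x(0)=x_0 .$$ Then, given $m,n,A,b,c,x_0,T,\varepsilon$ (but not $D$), one can compute $y\in\mathbb{R}^n$ such that $$(1-\varepsilon)\,x_i(T)\le y_i\le(1+\varepsilon)\,x_i(T)\qquad\text{for all } i$$ in time $$O\!\left(n^{\omega+3}D^{6}\|c\|_1^{3}\,\max\!\Big(T,\tfrac{1}{nD^{2}\|c\|_1}\Big)^{3}\log^{2}\!\Big(\frac{2nD\|c\|_1}{\varepsilon}\Big)\right).$$ A single program works for all inputs, and the constant in the $O(\cdot)$ depends on nothing but the program and $\omega$; when $T\ge \frac{1}{nD^2\|c\|_1}$ the factor $\max(\cdot)^3$ is $T^{3}$. -/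

import Mathlib

/-! ## The model of computation: a real RAM

Programs are finite texts in a structured imperative language.  A machine state consists of
index arrays (of natural numbers) and value arrays (of real numbers); a scalar variable is
cell `0` of an array.  The primitive operations are exact arithmetic, loads, stores and
comparisons, and each of them costs one time unit.  There is no rounding from reals to indices,
and there are no elementary functions. -/

namespace RealRAM

/-- Memory contents: the cell `i` of the index array `a` is `idx a i`,
the cell `i` of the value array `a` is `val a i`. -/
structure State where
  idx : ℕ → ℕ → ℕ
  val : ℕ → ℕ → ℝ

/-- Index expressions (the subtraction is truncated). -/
inductive IExpr : Type
  | const (k : ℕ)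
  | load (a : ℕ) (i : IExpr)
  | add (e f : IExpr)
  | sub (e f : IExpr)
  | mul (e f : IExpr)

/-- Real expressions (division by zero returns zero). -/
inductive RExpr : Type
  | const (q : ℚ)
  | ofIdx (e : IExpr)
  | load (a : ℕ) (i : IExpr)
  | add (e f : RExpr)
  | sub (e f : RExpr)
  | mul (e f : RExpr)
  | div (e f : RExpr)

/-- Tests. -/
inductive Test : Type
  | idxLt (e f : IExpr)
  | realLt (e f : RExpr)
  | neg (q : Test)

/-- Programs. -/
inductive Cmd : Type
  | skip
  | setIdx (a : ℕ) (i e : IExpr)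
  | setVal (a : ℕ) (i : IExpr) (e : RExpr)
  | seq (p q : Cmd)
  | ite (q : Test) (p₁ p₂ : Cmd)
  | loop (q : Test) (p : Cmd)

/-- The value of an index expression. -/
def IExpr.eval (σ : State) : IExpr → ℕ
  | .const k => k
  | .load a i => σ.idx a (i.eval σ)
  | .add e f => e.eval σ + f.eval σ
  | .sub e f => e.eval σ - f.eval σ
  | .mul e f => e.eval σ * f.eval σ

/-- The number of operations performed when an index expression is evaluated. -/
def IExpr.cost : IExpr → ℕ
  | .const _ => 1
  | .load _ i => i.cost + 1
  | .add e f => e.cost + f.cost + 1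
  | .sub e f => e.cost + f.cost + 1
  | .mul e f => e.cost + f.cost + 1

/-- The value of a real expression. -/
noncomputable def RExpr.eval (σ : State) : RExpr → ℝ
  | .const q => (q : ℝ)
  | .ofIdx e => (e.eval σ : ℝ)
  | .load a i => σ.val a (i.eval σ)
  | .add e f => e.eval σ + f.eval σ
  | .sub e f => e.eval σ - f.eval σ
  | .mul e f => e.eval σ * f.eval σ
  | .div e f => e.eval σ / f.eval σ

/-- The number of operations performed when a real expression is evaluated. -/
def RExpr.cost : RExpr → ℕ
  | .const _ => 1
  | .ofIdx e => e.cost + 1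
  | .load _ i => i.cost + 1
  | .add e f => e.cost + f.cost + 1
  | .sub e f => e.cost + f.cost + 1
  | .mul e f => e.cost + f.cost + 1
  | .div e f => e.cost + f.cost + 1

/-- The test `q` succeeds in the state `σ`. -/
def Test.Holds (σ : State) : Test → Prop
  | .idxLt e f => e.eval σ < f.eval σ
  | .realLt e f => e.eval σ < f.eval σ
  | .neg q => ¬ q.Holds σ

/-- The number of operations performed in a test. -/
def Test.cost : Test → ℕ
  | .idxLt e f => e.cost + f.cost + 1
  | .realLt e f => e.cost + f.cost + 1
  | .neg q => q.cost + 1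

/-- Store `k` in the cell `i` of the index array `a`. -/
def State.setIdx (σ : State) (a i k : ℕ) : State :=
  { σ with idx := Function.update σ.idx a (Function.update (σ.idx a) i k) }

/-- Store `v` in the cell `i` of the value array `a`. -/
noncomputable def State.setVal (σ : State) (a i : ℕ) (v : ℝ) : State :=
  { σ with val := Function.update σ.val a (Function.update (σ.val a) i v) }

/-- `Exec p σ σ' t`: the program `p`, started in the state `σ`, halts in the state `σ'`
after exactly `t` time units. -/
inductive Exec : Cmd → State → State → ℕ → Prop
  | skip (σ : State) : Exec .skip σ σ 1
  | setIdx (σ : State) (a : ℕ) (i e : IExpr) :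
      Exec (.setIdx a i e) σ (σ.setIdx a (i.eval σ) (e.eval σ)) (i.cost + e.cost + 1)
  | setVal (σ : State) (a : ℕ) (i : IExpr) (e : RExpr) :
      Exec (.setVal a i e) σ (σ.setVal a (i.eval σ) (e.eval σ)) (i.cost + e.cost + 1)
  | seq {p q : Cmd} {σ σ' σ'' : State} {t t' : ℕ} :
      Exec p σ σ' t → Exec q σ' σ'' t' → Exec (.seq p q) σ σ'' (t + t')
  | iteTrue {q : Test} {p₁ p₂ : Cmd} {σ σ' : State} {t : ℕ} :
      q.Holds σ → Exec p₁ σ σ' t → Exec (.ite q p₁ p₂) σ σ' (q.cost + t)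
  | iteFalse {q : Test} {p₁ p₂ : Cmd} {σ σ' : State} {t : ℕ} :
      ¬ q.Holds σ → Exec p₂ σ σ' t → Exec (.ite q p₁ p₂) σ σ' (q.cost + t)
  | loopTrue {q : Test} {p : Cmd} {σ σ' σ'' : State} {t t' : ℕ} :
      q.Holds σ → Exec p σ σ' t → Exec (.loop q p) σ' σ'' t' →
        Exec (.loop q p) σ σ'' (q.cost + t + t')
  | loopFalse {q : Test} {p : Cmd} {σ : State} :
      ¬ q.Holds σ → Exec (.loop q p) σ σ q.cost

/-- The value array `a` holds the vector `v` in its first `n` cells. -/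
def State.HoldsVector {n : ℕ} (σ : State) (a : ℕ) (v : Fin n → ℝ) : Prop :=
  ∀ i : Fin n, σ.val a i = v i

/-- The value array `a` holds the matrix `M` in row-major order. -/
def State.HoldsMatrix {m n : ℕ} (σ : State) (a : ℕ) (M : Matrix (Fin m) (Fin n) ℝ) : Prop :=
  ∀ (i : Fin m) (j : Fin n), σ.val a (i * n + j) = M i j

/-- Two real `n × n` matrices can be multiplied in time `O(n ^ ω)`: a single program does so for
all `n ≥ 1`.  It finds `n` in the index array `0` and the factors in the value arrays `0` and
`1`, and leaves the product in the value array `2`; the memory may hold anything else at the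
start. -/
def MatrixMultiplicationTime (ω : ℝ) : Prop :=
  ∃ (p : Cmd) (C : ℝ), ∀ (n : ℕ), 1 ≤ n → ∀ (M N : Matrix (Fin n) (Fin n) ℝ) (σ : State),
    σ.idx 0 0 = n → σ.HoldsMatrix 0 M → σ.HoldsMatrix 1 N →
      ∃ (σ' : State) (t : ℕ), Exec p σ σ' t ∧ (t : ℝ) ≤ C * (n : ℝ) ^ ω ∧
        σ'.HoldsMatrix 2 (M * N)

end RealRAM

/-! ## Physarum dynamics -/

namespace Physarum

/-- The maximum absolute value of a subdeterminant of an integer matrix, i.e. of the determinant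
of a square submatrix (the determinant of the empty submatrix is `1`). -/
noncomputable def maxSubdet {m n : ℕ} (A : Matrix (Fin m) (Fin n) ℤ) : ℕ :=
  (Finset.range (min m n + 1)).sup fun k =>
    (Finset.univ : Finset ((Fin k ↪ Fin m) × (Fin k ↪ Fin n))).sup fun s =>
      (A.submatrix s.1 s.2).det.natAbs

/-- The `ℓ¹` norm of an integer vector. -/
noncomputable def norm1 {n : ℕ} (c : Fin n → ℤ) : ℝ := ∑ j, |(c j : ℝ)|

/-- The matrix `A` with its entries regarded as real numbers. -/
def realMatrix {m n : ℕ} (A : Matrix (Fin m) (Fin n) ℤ) : Matrix (Fin m) (Fin n) ℝ :=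
  A.map fun a => (a : ℝ)

/-- The vector field `W Aᵀ (A W Aᵀ)⁻¹ b - x` with `W = diag (xⱼ / cⱼ)`, defined for `x > 0`. -/
noncomputable def field {m n : ℕ} (A : Matrix (Fin m) (Fin n) ℤ) (b : Fin m → ℤ)
    (c : Fin n → ℤ) (x : Fin n → ℝ) : Fin n → ℝ :=
  let A' := realMatrix A
  let W : Matrix (Fin n) (Fin n) ℝ := Matrix.diagonal fun j => x j / (c j : ℝ)
  (W * A'.transpose * (A' * W * A'.transpose)⁻¹).mulVec (fun i => (b i : ℝ)) - x

/-- `x` solves the Physarum dynamics on `[0, T]` with the initial point `x₀`; the domain of the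
vector field is the open positive orthant. -/
def IsSolution {m n : ℕ} (A : Matrix (Fin m) (Fin n) ℤ) (b : Fin m → ℤ) (c : Fin n → ℤ)
    (x₀ : Fin n → ℝ) (T : ℝ) (x : ℝ → Fin n → ℝ) : Prop :=
  x 0 = x₀ ∧ ∀ t ∈ Set.Icc 0 T, (∀ j, 0 < x t j) ∧
    HasDerivWithinAt x (field A b c (x t)) (Set.Icc 0 T) t

/-- The input of the computation as it is laid out in memory: the dimensions `m`, `n` in the
index arrays `0`, `1`, and `A`, `b`, `c`, `x₀`, `T`, `ε` in the value arrays `0, …, 5`. -/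
def HoldsInput {m n : ℕ} (σ : RealRAM.State) (A : Matrix (Fin m) (Fin n) ℤ) (b : Fin m → ℤ)
    (c : Fin n → ℤ) (x₀ : Fin n → ℝ) (T ε : ℝ) : Prop :=
  σ.idx 0 0 = m ∧ σ.idx 1 0 = n ∧
    σ.HoldsMatrix 0 (realMatrix A) ∧
    σ.HoldsVector 1 (fun i => (b i : ℝ)) ∧
    σ.HoldsVector 2 (fun j => (c j : ℝ)) ∧
    σ.HoldsVector 3 x₀ ∧
    σ.val 4 0 = T ∧ σ.val 5 0 = ε

end Physarum

/-! The trajectory is followed by a Taylor method of high order, in coordinates relative to the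
current approximation `y`. Let `w = y / c`, let `R = Aᵀ (A W Aᵀ)⁻¹ A` be the response matrix and `P
= R W` the weighted projection at `y`. With `z = x / y`, `γ = 1 / c` and the potential differences
`p = Aᵀ (A W_x Aᵀ)⁻¹ b`, where `W_x` belongs to `x`, the dynamics read `z' = z (γ p - 1)`. Since `A
x = A y = b`, also `p = q₀ - P ((z - 1) p)` with `q₀ = R y`. This system is quadratic, so the power
series of `z` and `p` follow from a simple recurrence that needs only `P` and `q₀`.

Everything is controlled by two numbers: `α`, the larger of `1` and the sup-norm operator norm of
`P`, and `β`, the larger of `1` and the norm of `q₀`. By the Cauchy–Binet formula each entry of `P`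
is a quotient of weighted sums of products of maximal minors; as the minors are integers of size at
most `D`, the entry is at most `D` in absolute value (`abs_projection_le`). Hence `α ≤ n D` and `β ≤
D ‖c‖₁`, wherever the point is. If `100 h α β ≤ 1`, the coefficients for a step of length `h` are
summable against `2 ^ k` (`IsTaylor.weighted_bounds`), so truncation at degree `K` costs about `2 ^
(-K)`. A Grönwall argument compares solution and polynomial (`IsTaylor.step`).

Along a run of `G` steps the relative error at most doubles per step, up to one truncation error,
and so does `α` (`amplification_mul_le`). The degree `K = 2 G + κ` with `4 α₀ ≤ ε 2 ^ κ`, where `α₀`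
is `α` at `x₀`, therefore keeps every step inside the region of validity and ends with accuracy `ε`
(`Tracks.step`, `Tracks.bounds`). The polynomial preserves `A y = b` exactly, which the fixed point
equation for `p` needs.

Since `D` is not given, `G` is found by doubling: `α` and `β` are measured before each step, and a
step that is too long aborts the run. An aborted run has `G < 100 T n D² ‖c‖₁`, so the costs of all
runs form a geometric sum. The matrix `R` comes from block inversion of a positive definite matrix
padded to a power of two, in time `O(n ^ ω log n)`; the recurrence costs `O(n² (K + 1)²)`, and `n² ≤
n ^ ω` because a product has `n²` cells to be written. With `S = max (T n D² ‖c‖₁) 1` and `L` the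
logarithm in the claim, the total is `O(n ^ ω S³ L²)`, which is the claimed bound. -/

set_option linter.unusedSimpArgs false

namespace RealRAM

/-! ### Total correctness with time bounds -/

/-- Started in `σ`, the program `p` halts within `T` time units in a state that satisfies `Q`. -/
def Runs (p : Cmd) (σ : State) (T : ℕ) (Q : State → Prop) : Prop :=
  ∃ (σ' : State) (t : ℕ), Exec p σ σ' t ∧ t ≤ T ∧ Q σ'

/-- The two states agree outside the index arrays in `I` and the value arrays in `V`. -/
structure Frame (I V : Set ℕ) (σ σ' : State) : Prop where
  idx : ∀ a, a ∉ I → σ'.idx a = σ.idx a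
  val : ∀ a, a ∉ V → σ'.val a = σ.val a

theorem Frame.refl (I V : Set ℕ) (σ : State) : Frame I V σ σ := ⟨fun _ _ => rfl, fun _ _ => rfl⟩

theorem Frame.trans {I V : Set ℕ} {σ σ' σ'' : State} (h : Frame I V σ σ') (h' : Frame I V σ' σ'') :
    Frame I V σ σ'' :=
  ⟨fun a ha => (h'.idx a ha).trans (h.idx a ha), fun a ha => (h'.val a ha).trans (h.val a ha)⟩

theorem Frame.mono {I V I' V' : Set ℕ} {σ σ' : State} (h : Frame I V σ σ') (hI : I ⊆ I')
    (hV : V ⊆ V') : Frame I' V' σ σ' :=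
  ⟨fun a ha => h.idx a fun h' => ha (hI h'), fun a ha => h.val a fun h' => ha (hV h')⟩

@[simp] theorem State.setIdx_val (σ : State) (a i k : ℕ) : (σ.setIdx a i k).val = σ.val := rfl

@[simp] theorem State.setVal_idx (σ : State) (a i : ℕ) (v : ℝ) : (σ.setVal a i v).idx = σ.idx := rfl

@[simp] theorem State.setIdx_idx_self (σ : State) (a i k : ℕ) : (σ.setIdx a i k).idx a i = k := by
  simp [State.setIdx]

@[simp] theorem State.setVal_val_self (σ : State) (a i : ℕ) (v : ℝ) :
    (σ.setVal a i v).val a i = v := by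
  simp [State.setVal]

theorem State.setIdx_idx_of_ne (σ : State) {a b : ℕ} (i k : ℕ) (h : b ≠ a) :
    (σ.setIdx a i k).idx b = σ.idx b := by
  simp [State.setIdx, h]

theorem State.setVal_val_of_ne (σ : State) {a b : ℕ} (i : ℕ) (v : ℝ) (h : b ≠ a) :
    (σ.setVal a i v).val b = σ.val b := by
  simp [State.setVal, h]

theorem State.setIdx_idx_cell (σ : State) (a : ℕ) {i j : ℕ} (k : ℕ) (h : j ≠ i) :
    (σ.setIdx a i k).idx a j = σ.idx a j := by
  simp [State.setIdx, h]

theorem State.setVal_val_cell (σ : State) (a : ℕ) {i j : ℕ} (v : ℝ) (h : j ≠ i) :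
    (σ.setVal a i v).val a j = σ.val a j := by
  simp [State.setVal, h]

theorem Frame.setIdx {I V : Set ℕ} {σ σ' : State} (h : Frame I V σ σ') {a : ℕ} (ha : a ∈ I)
    (i k : ℕ) : Frame I V σ (σ'.setIdx a i k) :=
  ⟨fun b hb => by
    rw [State.setIdx_idx_of_ne _ _ _ (by rintro rfl; exact hb ha)]; exact h.idx b hb, h.val⟩

theorem Frame.setVal {I V : Set ℕ} {σ σ' : State} (h : Frame I V σ σ') {a : ℕ} (ha : a ∈ V)
    (i : ℕ) (v : ℝ) : Frame I V σ (σ'.setVal a i v) :=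
  ⟨h.idx, fun b hb => by
    rw [State.setVal_val_of_ne _ _ _ (by rintro rfl; exact hb ha)]; exact h.val b hb⟩

theorem Runs.mono {p : Cmd} {σ : State} {T T' : ℕ} {Q Q' : State → Prop} (h : Runs p σ T Q)
    (hT : T ≤ T') (hQ : ∀ σ', Q σ' → Q' σ') : Runs p σ T' Q' := by
  obtain ⟨σ', t, he, ht, hq⟩ := h
  exact ⟨σ', t, he, ht.trans hT, hQ _ hq⟩

theorem Runs.skip {σ : State} {T : ℕ} {Q : State → Prop} (hT : 1 ≤ T) (h : Q σ) :
    Runs .skip σ T Q := ⟨σ, 1, .skip σ, hT, h⟩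

theorem Runs.seq {p q : Cmd} {σ : State} {T T' : ℕ} {Q : State → Prop}
    (h : Runs p σ T fun σ' => Runs q σ' T' Q) : Runs (.seq p q) σ (T + T') Q := by
  obtain ⟨σ', t, he, ht, σ'', t', he', ht', hq⟩ := h
  exact ⟨σ'', t + t', .seq he he', Nat.add_le_add ht ht', hq⟩

theorem Runs.seq' {p q : Cmd} {σ : State} {T T' : ℕ} {R Q : State → Prop}
    (h : Runs p σ T R) (h' : ∀ σ', R σ' → Runs q σ' T' Q) : Runs (.seq p q) σ (T + T') Q :=
  Runs.seq (h.mono le_rfl h')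

theorem Runs.setIdx {σ : State} {a : ℕ} {i e : IExpr} {T : ℕ} {Q : State → Prop}
    (hT : i.cost + e.cost + 1 ≤ T) (h : Q (σ.setIdx a (i.eval σ) (e.eval σ))) :
    Runs (.setIdx a i e) σ T Q := ⟨_, _, .setIdx σ a i e, hT, h⟩

theorem Runs.setVal {σ : State} {a : ℕ} {i : IExpr} {e : RExpr} {T : ℕ} {Q : State → Prop}
    (hT : i.cost + e.cost + 1 ≤ T) (h : Q (σ.setVal a (i.eval σ) (e.eval σ))) :
    Runs (.setVal a i e) σ T Q := ⟨_, _, .setVal σ a i e, hT, h⟩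

theorem Runs.ite {q : Test} {p₁ p₂ : Cmd} {σ : State} {T : ℕ} {Q : State → Prop}
    (h₁ : q.Holds σ → Runs p₁ σ T Q) (h₂ : ¬ q.Holds σ → Runs p₂ σ T Q) :
    Runs (.ite q p₁ p₂) σ (q.cost + T) Q := by
  by_cases hq : q.Holds σ
  · obtain ⟨σ', t, he, ht, hQ⟩ := h₁ hq
    exact ⟨σ', q.cost + t, .iteTrue hq he, by omega, hQ⟩
  · obtain ⟨σ', t, he, ht, hQ⟩ := h₂ hq
    exact ⟨σ', q.cost + t, .iteFalse hq he, by omega, hQ⟩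

theorem Runs.loop_step {q : Test} {p : Cmd} {σ : State} {T T' : ℕ} {Q : State → Prop}
    (hq : q.Holds σ) (h : Runs p σ T fun σ' => Runs (.loop q p) σ' T' Q) :
    Runs (.loop q p) σ (q.cost + T + T') Q := by
  obtain ⟨σ', t, he, ht, σ'', t', he', ht', hQ⟩ := h
  exact ⟨σ'', q.cost + t + t', .loopTrue hq he he', by omega, hQ⟩

theorem Runs.loop_done {q : Test} {p : Cmd} {σ : State} {Q : State → Prop}
    (hq : ¬ q.Holds σ) (h : Q σ) : Runs (.loop q p) σ q.cost Q :=
  ⟨σ, q.cost, .loopFalse hq, le_rfl, h⟩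

/-! ### Loops -/

/-- The cell `0` of the index array `a`. -/
abbrev IExpr.var (a : ℕ) : IExpr := .load a (.const 0)

/-- Run `body` with the cell `0` of the index array `v` equal to `0, …, e - 1`. -/
def forLoop (v : ℕ) (e : IExpr) (body : Cmd) : Cmd :=
  .seq (.setIdx v (.const 0) (.const 0))
    (.loop (.idxLt (.var v) e)
      (.seq body (.setIdx v (.const 0) (.add (.var v) (.const 1)))))

/-- The invariant describes the state in which the loop variable already has its new value. The body
may overwrite anything the invariant tolerates, but must leave the loop variable as it found it. The
overhead of `e.cost + 9` per turn is the test together with the increment. -/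
theorem Runs.forLoop {v : ℕ} {e : IExpr} {body : Cmd} {σ : State} (I : ℕ → State → Prop)
    {n T : ℕ} (h0 : I 0 (σ.setIdx v 0 0))
    (hI : ∀ k ≤ n, ∀ σ', I k σ' → σ'.idx v 0 = k ∧ e.eval σ' = n)
    (hb : ∀ k < n, ∀ σ', I k σ' →
      Runs body σ' T fun σ'' => σ''.idx v 0 = k ∧ I (k + 1) (σ''.setIdx v 0 (k + 1))) :
    Runs (RealRAM.forLoop v e body) σ (n * (T + e.cost + 9) + e.cost + 9) (I n) := by
  have key : ∀ d k, k + d = n → ∀ σ', I k σ' →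
      Runs (.loop (.idxLt (.var v) e)
        (.seq body (.setIdx v (.const 0) (.add (.var v) (.const 1))))) σ'
        (d * (T + e.cost + 9) + e.cost + 3) (I n) := by
    intro d
    induction d with
    | zero =>
      intro k hk σ' h
      obtain rfl : k = n := by omega
      have h2 := hI k le_rfl σ' h
      refine (Runs.loop_done (Q := I k) ?_ h).mono (by simp [Test.cost, IExpr.cost]; omega)
        (fun _ h => h)
      simp [Test.Holds, IExpr.eval, h2]
    | succ d ih =>
      intro k hk σ' h
      have h2 := hI k (by omega) σ' h
      refine (Runs.loop_step (T := T + 6) (T' := d * (T + e.cost + 9) + e.cost + 3) (Q := I n)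
        ?_ ?_).mono ?_ (fun _ h => h)
      · simp only [Test.Holds, IExpr.eval, h2]; omega
      · refine Runs.seq' (hb k (by omega) σ' h) ?_
        rintro σ'' ⟨h3, h4⟩
        refine Runs.setIdx (by simp [IExpr.cost]) ?_
        simp only [IExpr.eval, h3]
        exact ih (k + 1) (by omega) _ h4
      · simp only [Test.cost, IExpr.cost]
        ring_nf; omega
  have h3 : Runs (RealRAM.forLoop v e body) σ (3 + (n * (T + e.cost + 9) + e.cost + 3)) (I n) :=
    Runs.seq (Runs.setIdx (by simp [IExpr.cost]) (key n 0 (by omega) _ h0))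
  exact h3.mono (by omega) (fun _ h => h)

/-- One assignment to a cell of the value array `d` for each value of the loop variable. -/
theorem Runs.fill {v d : ℕ} {e : IExpr} {cell : Cmd} {σ : State} {n T : ℕ} (pos : ℕ → ℕ)
    (F : ℕ → ℝ) (hinj : ∀ i < n, ∀ j < n, pos i = pos j → i = j)
    (he : ∀ σ', Frame {v} {d} σ σ' → e.eval σ' = n)
    (hcell : ∀ j < n, ∀ σ', Frame {v} {d} σ σ' → σ'.idx v 0 = j →
      (∀ x, (∀ i < j, x ≠ pos i) → σ'.val d x = σ.val d x) →
      Runs cell σ' T fun σ'' => σ'' = σ'.setVal d (pos j) (F j)) :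
    Runs (RealRAM.forLoop v e cell) σ (n * (T + e.cost + 9) + e.cost + 9) fun σ' =>
      Frame {v} {d} σ σ' ∧ (∀ j < n, σ'.val d (pos j) = F j) ∧
        ∀ x, (∀ i < n, x ≠ pos i) → σ'.val d x = σ.val d x := by
  refine (Runs.forLoop (fun k σ' => σ'.idx v 0 = k ∧ (Frame {v} {d} σ σ' ∧
      (∀ j < k, σ'.val d (pos j) = F j) ∧
        ∀ x, (∀ i < k, x ≠ pos i) → σ'.val d x = σ.val d x)) ?_ ?_ ?_).mono le_rfl
        (fun _ h => h.2)
  · refine ⟨by simp, (Frame.refl _ _ _).setIdx (by simp) _ _, by simp, by simp⟩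
  · rintro k - σ' ⟨h1, h2, -⟩
    exact ⟨h1, he _ h2⟩
  · rintro k hk σ' ⟨h1, h2, h3, h4⟩
    refine (hcell k hk σ' h2 h1 h4).mono le_rfl ?_
    rintro _ rfl
    refine ⟨by simpa using h1, by simp, (h2.setVal (by simp) _ _).setIdx (by simp) _ _, ?_, ?_⟩
    · intro j hj
      by_cases hjk : j = k
      · subst hjk; simp
      · have : pos j ≠ pos k := fun h => hjk (hinj _ (by omega) _ (by omega) h)
        simpa [State.setVal_val_cell _ _ _ this] using h3 j (by omega)
    · intro x hx
      have : x ≠ pos k := hx k (by omega)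
      simpa [State.setVal_val_cell _ _ _ this] using h4 x fun i hi => hx i (by omega)

/-- Nested loops that assign to each cell of a block of the value array `d`. -/
theorem Runs.fill₂ {v w d : ℕ} {e f : IExpr} {cell : Cmd} {σ : State} {r n T : ℕ} (hvw : v ≠ w)
    (pos : ℕ → ℕ → ℕ) (F : ℕ → ℕ → ℝ)
    (hinj : ∀ i < r, ∀ j < n, ∀ i' < r, ∀ j' < n, pos i j = pos i' j' → i = i' ∧ j = j')
    (he : ∀ σ', Frame {v, w} {d} σ σ' → e.eval σ' = r)
    (hf : ∀ σ', Frame {v, w} {d} σ σ' → f.eval σ' = n)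
    (hcell : ∀ i < r, ∀ j < n, ∀ σ', Frame {v, w} {d} σ σ' → σ'.idx v 0 = i → σ'.idx w 0 = j →
      σ'.val d (pos i j) = σ.val d (pos i j) →
      (∀ x, (∀ i < r, ∀ j < n, x ≠ pos i j) → σ'.val d x = σ.val d x) →
      Runs cell σ' T fun σ'' => σ'' = σ'.setVal d (pos i j) (F i j)) :
    Runs (RealRAM.forLoop v e (RealRAM.forLoop w f cell)) σ
      (r * ((n * (T + f.cost + 9) + f.cost + 9) + e.cost + 9) + e.cost + 9) fun σ' =>
      Frame {v, w} {d} σ σ' ∧ (∀ i < r, ∀ j < n, σ'.val d (pos i j) = F i j) ∧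
        ∀ x, (∀ i < r, ∀ j < n, x ≠ pos i j) → σ'.val d x = σ.val d x := by
  refine (Runs.forLoop (fun k σ' => σ'.idx v 0 = k ∧ (Frame {v, w} {d} σ σ' ∧
      (∀ i < k, ∀ j < n, σ'.val d (pos i j) = F i j) ∧
        ∀ x, (∀ i < k, ∀ j < n, x ≠ pos i j) → σ'.val d x = σ.val d x)) ?_ ?_ ?_).mono le_rfl
        (fun _ h => h.2)
  · refine ⟨by simp, (Frame.refl _ _ _).setIdx (by simp) _ _, by simp, by simp⟩
  · rintro k - σ' ⟨h1, h2, -⟩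
    exact ⟨h1, he _ h2⟩
  · rintro k hk σ' ⟨h1, h2, h3, h4⟩
    have hmono : ∀ τ, Frame {w} {d} σ' τ → Frame {v, w} {d} σ τ := fun τ hτ =>
      h2.trans (hτ.mono (by simp) le_rfl)
    refine (Runs.fill (d := d) (T := T) (n := n) (pos k) (F k) ?_ ?_ ?_).mono le_rfl ?_
    · intro i hi j hj h
      exact (hinj k hk i hi k hk j hj h).2
    · exact fun τ hτ => hf τ (hmono τ hτ)
    · intro j hj τ hτ hjτ hτd
      refine hcell k hk j hj τ (hmono τ hτ) ?_ hjτ ?_ ?_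
      · rw [hτ.idx v (by simpa using hvw), h1]
      · rw [hτd, h4]
        · intro i hi j' hj' h
          have := hinj k hk j hj i (by omega) j' hj' h
          omega
        · intro i hi h
          have := hinj k hk j hj k hk i (by omega) h
          omega
      · intro x hx
        rw [hτd x fun i hi => hx k hk i (by omega), h4 x fun i hi => hx i (by omega)]
    · rintro τ ⟨hτ, hτF, hτx⟩
      refine ⟨by rw [hτ.idx v (by simpa using hvw), h1], by simp,
        (hmono τ hτ).setIdx (by simp) _ _, ?_, ?_⟩
      · intro i hi j hj
        by_cases hik : i = k
        · subst hik; simpa using hτF j hj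
        · rw [State.setIdx_val, hτx, h3 i (by omega) j hj]
          intro j' hj' h
          exact hik (hinj i (by omega) j hj k hk j' hj' h).1
      · intro x hx
        rw [State.setIdx_val, hτx x fun j hj => hx k (by omega) j hj,
          h4 x fun i hi => hx i (by omega)]

/-- Nested loops that add up terms in the cells `pos j` of the value array `d`. -/
theorem Runs.accumulate {v w d : ℕ} {e f : IExpr} {cell : Cmd} {σ : State} {r n T : ℕ}
    (hvw : v ≠ w) (pos : ℕ → ℕ) (F : ℕ → ℕ → ℝ)
    (hinj : ∀ i < n, ∀ j < n, pos i = pos j → i = j)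
    (he : ∀ σ', Frame {v, w} {d} σ σ' → e.eval σ' = r)
    (hf : ∀ σ', Frame {v, w} {d} σ σ' → f.eval σ' = n)
    (hcell : ∀ i < r, ∀ j < n, ∀ σ', Frame {v, w} {d} σ σ' → σ'.idx v 0 = i → σ'.idx w 0 = j →
      (∀ x, (∀ j < n, x ≠ pos j) → σ'.val d x = σ.val d x) →
      Runs cell σ' T fun σ'' => σ'' = σ'.setVal d (pos j) (σ'.val d (pos j) + F i j)) :
    Runs (RealRAM.forLoop v e (RealRAM.forLoop w f cell)) σ
      (r * ((n * (T + f.cost + 9) + f.cost + 9) + e.cost + 9) + e.cost + 9) fun σ' =>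
      Frame {v, w} {d} σ σ' ∧
        (∀ j < n, σ'.val d (pos j) = σ.val d (pos j) + ∑ i ∈ Finset.range r, F i j) ∧
        ∀ x, (∀ j < n, x ≠ pos j) → σ'.val d x = σ.val d x := by
  refine (Runs.forLoop (fun k σ' => σ'.idx v 0 = k ∧ (Frame {v, w} {d} σ σ' ∧
      (∀ j < n, σ'.val d (pos j) = σ.val d (pos j) + ∑ i ∈ Finset.range k, F i j) ∧
        ∀ x, (∀ j < n, x ≠ pos j) → σ'.val d x = σ.val d x)) ?_ ?_ ?_).mono le_rfl
        (fun _ h => h.2)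
  · refine ⟨by simp, (Frame.refl _ _ _).setIdx (by simp) _ _, by simp, by simp⟩
  · rintro k - σ' ⟨h1, h2, -⟩
    exact ⟨h1, he _ h2⟩
  · rintro k hk σ' ⟨h1, h2, h3, h4⟩
    have hmono : ∀ τ, Frame {w} {d} σ' τ → Frame {v, w} {d} σ τ := fun τ hτ =>
      h2.trans (hτ.mono (by simp) le_rfl)
    refine (Runs.fill (d := d) (T := T) (n := n) pos (fun j => σ'.val d (pos j) + F k j)
      hinj ?_ ?_).mono le_rfl ?_
    · exact fun τ hτ => hf τ (hmono τ hτ)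
    · intro j hj τ hτ hjτ hτd
      have h5 : τ.val d (pos j) = σ'.val d (pos j) := hτd _ fun i hi h => by
        have := hinj j hj i (by omega) h
        omega
      rw [← h5]
      refine hcell k hk j hj τ (hmono τ hτ) ?_ hjτ ?_
      · rw [hτ.idx v (by simpa using hvw), h1]
      · intro x hx
        rw [hτd x fun i hi => hx i (by omega), h4 x hx]
    · rintro τ ⟨hτ, hτF, hτx⟩
      refine ⟨by rw [hτ.idx v (by simpa using hvw), h1], by simp,
        (hmono τ hτ).setIdx (by simp) _ _, ?_, ?_⟩
      · intro j hj
        rw [State.setIdx_val, hτF j hj, h3 j hj, Finset.sum_range_succ]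
        ring
      · intro x hx
        rw [State.setIdx_val, hτx x hx, h4 x hx]

/-- Row and column are the quotient and remainder of the address modulo the row length, provided the
block does not stick out of its rows. -/
theorem block_pos_inj {stride r₀ c₀ n : ℕ} (hc : c₀ + n ≤ stride) {i j i' j' : ℕ} (hj : j < n)
    (hj' : j' < n) (h : (r₀ + i) * stride + (c₀ + j) = (r₀ + i') * stride + (c₀ + j')) :
    i = i' ∧ j = j' := by
  have hs : 0 < stride := by omega
  have h1 : c₀ + j < stride := by omega
  have h2 : c₀ + j' < stride := by omega
  have h3 := congrArg (· / stride) h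
  simp only [Nat.add_comm _ (c₀ + _), Nat.add_mul_div_right _ _ hs, Nat.div_eq_of_lt h1,
    Nat.div_eq_of_lt h2] at h3
  have h4 : i = i' := by omega
  subst h4
  exact ⟨rfl, by omega⟩

/-! ### Frames of programs and a lower bound for matrix multiplication -/

/-- A bound for the names of the arrays to which a program writes. -/
def Cmd.bound : Cmd → ℕ
  | .skip => 0
  | .setIdx a _ _ => a + 1
  | .setVal a _ _ => a + 1
  | .seq p q => max p.bound q.bound
  | .ite _ p q => max p.bound q.bound
  | .loop _ p => p.bound

theorem Exec.frame {p : Cmd} {σ σ' : State} {t : ℕ} (h : Exec p σ σ' t) {B : ℕ}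
    (hB : p.bound ≤ B) : Frame {a | a < B} {a | a < B} σ σ' := by
  induction h with
  | skip σ => exact Frame.refl _ _ _
  | setIdx σ a i e => exact (Frame.refl _ _ _).setIdx (by simp [Cmd.bound] at hB ⊢; omega) _ _
  | setVal σ a i e => exact (Frame.refl _ _ _).setVal (by simp [Cmd.bound] at hB ⊢; omega) _ _
  | seq _ _ ih ih' =>
    simp [Cmd.bound] at hB
    exact (ih hB.1).trans (ih' hB.2)
  | iteTrue _ _ ih => simp [Cmd.bound] at hB; exact ih hB.1
  | iteFalse _ _ ih => simp [Cmd.bound] at hB; exact ih hB.2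
  | loopTrue _ _ _ ih ih' => exact (ih hB).trans (ih' hB)
  | loopFalse _ => exact Frame.refl _ _ _

/-- Each real store costs at least one time unit and changes one cell; this is the source of the
lower bound for matrix multiplication. -/
theorem Exec.changed_cells {p : Cmd} {σ σ' : State} {t : ℕ} (h : Exec p σ σ' t) :
    ∃ s : Finset (ℕ × ℕ), s.card ≤ t ∧ ∀ a i, (a, i) ∉ s → σ'.val a i = σ.val a i := by
  induction h with
  | skip σ => exact ⟨∅, by simp, fun _ _ _ => rfl⟩
  | setIdx σ a i e => exact ⟨∅, by simp, fun _ _ _ => rfl⟩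
  | setVal σ a i e =>
    refine ⟨{(a, i.eval σ)}, by simp, fun b j h => ?_⟩
    by_cases hb : b = a
    · subst hb
      exact State.setVal_val_cell _ _ _ fun hj => h (by simp [hj])
    · rw [State.setVal_val_of_ne _ _ _ hb]
  | seq _ _ ih ih' =>
    obtain ⟨s, hs, h⟩ := ih
    obtain ⟨s', hs', h'⟩ := ih'
    refine ⟨s ∪ s', (Finset.card_union_le _ _).trans (by omega), fun a i hai => ?_⟩
    simp only [Finset.mem_union, not_or] at hai
    rw [h' a i hai.2, h a i hai.1]
  | iteTrue _ _ ih =>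
    obtain ⟨s, hs, h⟩ := ih
    exact ⟨s, by omega, h⟩
  | iteFalse _ _ ih =>
    obtain ⟨s, hs, h⟩ := ih
    exact ⟨s, by omega, h⟩
  | loopTrue _ _ _ ih ih' =>
    obtain ⟨s, hs, h⟩ := ih
    obtain ⟨s', hs', h'⟩ := ih'
    refine ⟨s ∪ s', (Finset.card_union_le _ _).trans (by omega), fun a i hai => ?_⟩
    simp only [Finset.mem_union, not_or] at hai
    rw [h' a i hai.2, h a i hai.1]
  | loopFalse _ => exact ⟨∅, by simp, fun _ _ _ => rfl⟩

/-- The program `p` multiplies `n × n` matrices in `f n` time units. -/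
def Multiplies (p : Cmd) (f : ℕ → ℕ) : Prop :=
  ∀ (n : ℕ), 1 ≤ n → ∀ (M N : Matrix (Fin n) (Fin n) ℝ) (σ : State),
    σ.idx 0 0 = n → σ.HoldsMatrix 0 M → σ.HoldsMatrix 1 N →
      Runs p σ (f n) fun σ' => σ'.HoldsMatrix 2 (M * N)

theorem Multiplies.sq_le {p : Cmd} {f : ℕ → ℕ} (h : Multiplies p f) {n : ℕ} (hn : 1 ≤ n) :
    n ^ 2 ≤ f n := by
  -- An output array full of ones and two zero factors force the program to overwrite all `n²`
  -- output cells.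
  obtain ⟨σ', t, he, ht, hσ'⟩ := h n hn 0 0 ⟨fun _ _ => n, fun a _ => if a = 2 then 1 else 0⟩ rfl
    (fun i j => by simp) (fun i j => by simp)
  obtain ⟨s, hs, hc⟩ := he.changed_cells
  have hsub : (Finset.univ : Finset (Fin n × Fin n)).card ≤ s.card := by
    refine Finset.card_le_card_of_injOn (fun q => (2, (q.1 : ℕ) * n + q.2)) ?_ ?_
    · rintro ⟨i, j⟩ -
      by_contra hns
      have h1 := hc 2 _ hns
      rw [hσ' i j] at h1
      simp at h1
    · rintro ⟨i, j⟩ - ⟨i', j'⟩ - hij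
      simp only [Prod.mk.injEq, true_and] at hij
      have := block_pos_inj (stride := n) (r₀ := 0) (c₀ := 0) (n := n) (by simp) j.2 j'.2
        (i := i) (i' := i') (by simpa using hij)
      exact Prod.ext (Fin.ext this.1) (Fin.ext this.2)
  rw [Finset.card_univ, Fintype.card_prod, Fintype.card_fin] at hsub
  calc n ^ 2 = n * n := sq n
    _ ≤ f n := by omega

theorem MatrixMultiplicationTime.multiplies {ω : ℝ} (h : MatrixMultiplicationTime ω) :
    ∃ (p : Cmd) (C : ℝ), 1 ≤ C ∧ Multiplies p fun n => ⌊C * (n : ℝ) ^ ω⌋₊ := by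
  obtain ⟨p, C, h⟩ := h
  refine ⟨p, max C 1, le_max_right _ _, fun n hn M N σ h0 h1 h2 => ?_⟩
  obtain ⟨σ', t, he, ht, hσ'⟩ := h n hn M N σ h0 h1 h2
  refine ⟨σ', t, he, Nat.le_floor (ht.trans ?_), hσ'⟩
  gcongr
  exact le_max_left _ _

/-- The exponent comes without a lower bound; this one lets all work that is quadratic in `n` be
charged to `n ^ ω`. -/
theorem Multiplies.two_le {p : Cmd} {ω C : ℝ} (h : Multiplies p fun n => ⌊C * (n : ℝ) ^ ω⌋₊)
    (hC : 1 ≤ C) : 2 ≤ ω := by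
  by_contra! hω
  have h1 : Filter.Tendsto (fun n : ℕ => (n : ℝ) ^ (2 - ω)) Filter.atTop Filter.atTop :=
    (tendsto_rpow_atTop (by linarith)).comp tendsto_natCast_atTop_atTop
  obtain ⟨n, hn1, hn⟩ := ((Filter.eventually_ge_atTop 1).and (h1.eventually_gt_atTop C)).exists
  have hn0 : (0 : ℝ) < n := by exact_mod_cast hn1
  have h2 : ((n ^ 2 : ℕ) : ℝ) ≤ C * (n : ℝ) ^ ω :=
    (Nat.le_floor_iff (by positivity)).1 (h.sq_le hn1)
  rw [Real.rpow_sub hn0, lt_div_iff₀ (by positivity)] at hn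
  push_cast at h2
  norm_num at hn
  linarith

end RealRAM

namespace RealRAM

/-! ### Calls of the matrix multiplication program -/

/-- All arrays that the index expression reads are named `b` or higher. -/
def IExpr.Above (b : ℕ) : IExpr → Prop
  | .const _ => True
  | .load a i => b ≤ a ∧ i.Above b
  | .add e f => e.Above b ∧ f.Above b
  | .sub e f => e.Above b ∧ f.Above b
  | .mul e f => e.Above b ∧ f.Above b

theorem IExpr.eval_frame {σ σ' : State} {b : ℕ} {V : Set ℕ} (h : Frame (Set.Iio b) V σ σ') :
    ∀ {e : IExpr}, e.Above b → e.eval σ' = e.eval σ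
  | .const _, _ => rfl
  | .load a i, he => by
    simp only [IExpr.eval]
    rw [IExpr.eval_frame h he.2, h.idx a (by simpa using he.1)]
  | .add e f, he => by simp only [IExpr.eval, IExpr.eval_frame h he.1, IExpr.eval_frame h he.2]
  | .sub e f, he => by simp only [IExpr.eval, IExpr.eval_frame h he.1, IExpr.eval_frame h he.2]
  | .mul e f, he => by simp only [IExpr.eval, IExpr.eval_frame h he.1, IExpr.eval_frame h he.2]

/-- The address of the cell `(r + i, c + j)` of a matrix with rows of length `s`, where `i` and `j`
are the loop variables `B` and `B + 1`. -/
def cellExpr (B : ℕ) (r c s : IExpr) : IExpr :=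
  .add (.mul (.add r (.var B)) s) (.add c (.var (B + 1)))

/-- Nested loops over the index variables `B`, `B + 1`, both below the value of `s`. -/
def squareLoop (B : ℕ) (s : IExpr) (cell : Cmd) : Cmd := forLoop B s (forLoop (B + 1) s cell)

/-- Multiply the matrices with the entries `e₁` and `e₂`, and assign `e₃` to the cells `pe` of
the value array `d`. -/
def mulStore (p : Cmd) (B v : ℕ) (e₁ e₂ : RExpr) (d : ℕ) (pe : IExpr) (e₃ : RExpr) : Cmd :=
  .seq (.setIdx 0 (.const 0) (.var v))
    (.seq (squareLoop B (.var v) (.setVal 0 (cellExpr B (.const 0) (.const 0) (.var v)) e₁))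
      (.seq (squareLoop B (.var v) (.setVal 1 (cellExpr B (.const 0) (.const 0) (.var v)) e₂))
        (.seq p (squareLoop B (.var v) (.setVal d pe e₃)))))

/-- The square block of size `s` with the upper left corner `(r, c)` of a matrix that is stored
with rows of length `w`. -/
def State.block (σ : State) (a w r c s : ℕ) : Matrix (Fin s) (Fin s) ℝ :=
  fun i j => σ.val a ((r + i) * w + (c + j))

theorem Runs.squareLoop {B v d : ℕ} {pe : IExpr} {e : RExpr} {σ : State} {s : ℕ}
    (hv : B + 2 ≤ v) (hs : σ.idx v 0 = s) (hs1 : 1 ≤ s) (pos : ℕ → ℕ → ℕ)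
    (F : Matrix (Fin s) (Fin s) ℝ)
    (hinj : ∀ i < s, ∀ j < s, ∀ i' < s, ∀ j' < s, pos i j = pos i' j' → i = i' ∧ j = j')
    (hcost : pe.cost + e.cost ≤ 100)
    (hpe : ∀ i < s, ∀ j < s, ∀ σ', Frame (Set.Iio (B + 2)) {d} σ σ' → σ'.idx B 0 = i →
      σ'.idx (B + 1) 0 = j → pe.eval σ' = pos i j)
    (he : ∀ i j : Fin s, ∀ σ', Frame (Set.Iio (B + 2)) {d} σ σ' → σ'.idx B 0 = i →
      σ'.idx (B + 1) 0 = j → σ'.val d (pos i j) = σ.val d (pos i j) → e.eval σ' = F i j) :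
    Runs (RealRAM.squareLoop B (.var v) (.setVal d pe e)) σ (146 * s ^ 2) fun σ' =>
      Frame {B, B + 1} {d} σ σ' ∧ (∀ i j : Fin s, σ'.val d (pos i j) = F i j) ∧
        ∀ x, (∀ i < s, ∀ j < s, x ≠ pos i j) → σ'.val d x = σ.val d x := by
  have hfr : ∀ σ', Frame {B, B + 1} {d} σ σ' → Frame (Set.Iio (B + 2)) {d} σ σ' := fun σ' h =>
    h.mono (by intro a; simp; omega) le_rfl
  have hvs : ∀ σ', Frame {B, B + 1} {d} σ σ' → (IExpr.var v).eval σ' = s := fun σ' h => by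
    simp only [IExpr.eval]
    rw [h.idx v (by simp; omega), hs]
  refine (Runs.fill₂ (d := d) (T := 101) (r := s) (n := s) (by omega) pos
    (fun i j => if h : i < s ∧ j < s then F ⟨i, h.1⟩ ⟨j, h.2⟩ else 0) hinj hvs hvs ?_).mono ?_ ?_
  · intro i hi j hj σ' hσ h1 h2 h3 _
    refine Runs.setVal (by omega) ?_
    rw [hpe i hi j hj σ' (hfr _ hσ) h1 h2, he ⟨i, hi⟩ ⟨j, hj⟩ σ' (hfr _ hσ) h1 h2 h3]
    simp [hi, hj]
  · simp only [IExpr.cost]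
    nlinarith
  · rintro σ' ⟨h1, h2, h3⟩
    refine ⟨h1, fun i j => ?_, h3⟩
    rw [h2 i i.2 j j.2]
    simp

/-- The multiplication program is a black box that may spoil every array below `B`, so operands are
copied in and the result is copied out. These three passes are quadratic in `s`, hence dominated by
`f s`. The old entry of `d` is still available when `e₃` is evaluated, which permits updates in
place. -/
theorem Runs.mulStore {p : Cmd} {f : ℕ → ℕ} {B : ℕ} (hp : Multiplies p f) (hpB : p.bound ≤ B)
    (hB : 7 ≤ B) {v d : ℕ} {e₁ e₂ e₃ : RExpr} {pe : IExpr} {σ : State} {s : ℕ}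
    (hv : B + 2 ≤ v) (hs : σ.idx v 0 = s) (hs1 : 1 ≤ s) (hd : B ≤ d)
    (M N G : Matrix (Fin s) (Fin s) ℝ) (pos : ℕ → ℕ → ℕ)
    (hinj : ∀ i < s, ∀ j < s, ∀ i' < s, ∀ j' < s, pos i j = pos i' j' → i = i' ∧ j = j')
    (hc₁ : e₁.cost ≤ 80) (hc₂ : e₂.cost ≤ 80) (hc₃ : pe.cost + e₃.cost ≤ 100)
    (h₁ : ∀ i j : Fin s, ∀ σ', Frame (Set.Iio (B + 2)) (Set.Iio B) σ σ' → σ'.idx B 0 = i →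
      σ'.idx (B + 1) 0 = j → e₁.eval σ' = M i j)
    (h₂ : ∀ i j : Fin s, ∀ σ', Frame (Set.Iio (B + 2)) (Set.Iio B) σ σ' → σ'.idx B 0 = i →
      σ'.idx (B + 1) 0 = j → e₂.eval σ' = N i j)
    (hpe : ∀ i < s, ∀ j < s, ∀ σ', Frame (Set.Iio (B + 2)) (insert d (Set.Iio B)) σ σ' →
      σ'.idx B 0 = i → σ'.idx (B + 1) 0 = j → pe.eval σ' = pos i j)
    (h₃ : ∀ i j : Fin s, ∀ σ', Frame (Set.Iio (B + 2)) (insert d (Set.Iio B)) σ σ' →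
      σ'.idx B 0 = i → σ'.idx (B + 1) 0 = j → σ'.val 2 (i * s + j) = (M * N) i j →
      σ'.val d (pos i j) = σ.val d (pos i j) → e₃.eval σ' = G i j) :
    Runs (RealRAM.mulStore p B v e₁ e₂ d pe e₃) σ (500 * f s) fun σ' =>
      Frame (Set.Iio (B + 2)) (insert d (Set.Iio B)) σ σ' ∧
        (∀ i j : Fin s, σ'.val d (pos i j) = G i j) ∧
        ∀ x, (∀ i < s, ∀ j < s, x ≠ pos i j) → σ'.val d x = σ.val d x := by
  have hvs : ∀ {V : Set ℕ} {τ}, Frame (Set.Iio (B + 2)) V σ τ → τ.idx v 0 = s := fun h => by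
    rw [h.idx v (by simpa using hv), hs]
  have hpos : ∀ i < s, ∀ j < s, ∀ (τ τ' : State) (V : Set ℕ), τ.idx v 0 = s →
      Frame (Set.Iio (B + 2)) V τ τ' → τ'.idx B 0 = i → τ'.idx (B + 1) 0 = j →
      (cellExpr B (.const 0) (.const 0) (.var v)).eval τ' = i * s + j := by
    intro i _ j _ τ τ' V h1 h2 h3 h4
    simp [cellExpr, IExpr.eval, h3, h4, h2.idx v (by simpa using hv), h1]
  have hinj0 : ∀ i < s, ∀ j < s, ∀ i' < s, ∀ j' < s, i * s + j = i' * s + j' → i = i' ∧ j = j' := by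
    intro i _ j hj i' _ j' hj' h
    exact block_pos_inj (stride := s) (r₀ := 0) (c₀ := 0) (n := s) (by omega) hj hj' (by simpa using h)
  have hlow : ∀ a : ℕ, a < 7 → ({a} : Set ℕ) ⊆ Set.Iio B := by intro a ha x; simp; omega
  have hcc : (cellExpr B (.const 0) (.const 0) (.var v)).cost = 12 := rfl
  refine (Runs.seq' (T := 4) (T' := 146 * s ^ 2 + (146 * s ^ 2 + (f s + 146 * s ^ 2)))
    (R := fun τ => Frame (Set.Iio (B + 2)) (Set.Iio B) σ τ ∧ τ.idx 0 0 = s) ?_ ?_).mono ?_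
    (fun _ h => h)
  · refine Runs.setIdx (by simp [IExpr.cost]) ⟨(Frame.refl _ _ _).setIdx (by simp) _ _, ?_⟩
    simp [IExpr.eval, hs]
  have hBB : ({B, B + 1} : Set ℕ) ⊆ Set.Iio (B + 2) := by intro a; simp; omega
  rintro σ₁ ⟨hσ₁, hσ₁0⟩
  refine Runs.seq' (Runs.squareLoop hv (hvs hσ₁) hs1 (fun i j => i * s + j) M hinj0 (by omega)
    (fun i hi j hj τ hτ => hpos i hi j hj _ _ _ (hvs hσ₁) hτ)
    (fun i j τ hτ hi hj _ => h₁ i j τ (hσ₁.trans (hτ.mono le_rfl (hlow 0 (by omega)))) hi hj)) ?_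
  rintro σ₂ ⟨hσ₂, hσ₂M, -⟩
  have hσ₂' := hσ₁.trans (hσ₂.mono hBB (hlow 0 (by omega)))
  refine Runs.seq' (Runs.squareLoop hv (hvs hσ₂') hs1 (fun i j => i * s + j) N hinj0 (by omega)
    (fun i hi j hj τ hτ => hpos i hi j hj _ _ _ (hvs hσ₂') hτ)
    (fun i j τ hτ hi hj _ => h₂ i j τ (hσ₂'.trans (hτ.mono le_rfl (hlow 1 (by omega)))) hi hj)) ?_
  rintro σ₃ ⟨hσ₃, hσ₃N, -⟩
  have hσ₃' := hσ₂'.trans (hσ₃.mono hBB (hlow 1 (by omega)))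
  have h0 : σ₃.idx 0 0 = s := by
    rw [hσ₃.idx 0 (by simp; omega), hσ₂.idx 0 (by simp; omega), hσ₁0]
  have hM : σ₃.HoldsMatrix 0 M := fun i j => by
    rw [hσ₃.val 0 (by simp)]
    exact hσ₂M i j
  obtain ⟨σ₄, t, he, ht, hP⟩ := hp s hs1 M N σ₃ h0 hM hσ₃N
  have hσ₄ := hσ₃'.trans ((he.frame hpB).mono (fun a (ha : a < B) => by simp; omega) le_rfl)
  refine Runs.seq ⟨σ₄, t, he, ht, ?_⟩
  have hd2 : ∀ {τ}, Frame (Set.Iio (B + 2)) {d} σ₄ τ →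
      Frame (Set.Iio (B + 2)) (insert d (Set.Iio B)) σ τ := fun hτ =>
    (hσ₄.mono le_rfl (Set.subset_insert _ _)).trans (hτ.mono le_rfl (by simp))
  have hdd : σ₄.val d = σ.val d := hσ₄.val d (by simpa using hd)
  refine (Runs.squareLoop hv (hvs hσ₄) hs1 pos G hinj hc₃
    (fun i hi j hj τ hτ => hpe i hi j hj τ (hd2 hτ))
    (fun i j τ hτ hi hj hij => h₃ i j τ (hd2 hτ) hi hj ?_ ?_)).mono le_rfl ?_
  · rw [hτ.val 2 (by simp; omega)]
    exact hP i j
  · rw [hij, hdd]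
  · rintro τ ⟨hτ, hτG, hτx⟩
    refine ⟨hd2 (hτ.mono hBB le_rfl), hτG, fun x hx => ?_⟩
    rw [hτx x hx, hdd]
  · have := hp.sq_le hs1
    nlinarith

/-- The linear combination `α * d + β * (M * N)` of blocks, stored in place of the block `d`. -/
def mulBlocks (p : Cmd) (B v : ℕ) (a₁ : ℕ) (r₁ c₁ w₁ : IExpr) (a₂ : ℕ) (r₂ c₂ w₂ : IExpr)
    (d : ℕ) (r c w : IExpr) (α β : ℚ) : Cmd :=
  mulStore p B v (.load a₁ (cellExpr B r₁ c₁ w₁)) (.load a₂ (cellExpr B r₂ c₂ w₂)) d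
    (cellExpr B r c w) (.add (.mul (.const α) (.load d (cellExpr B r c w)))
      (.mul (.const β) (.load 2 (cellExpr B (.const 0) (.const 0) (.var v)))))

theorem cellExpr_eval {B : ℕ} {r c w : IExpr} {V : Set ℕ} {σ σ' : State} {i j : ℕ}
    (h : Frame (Set.Iio (B + 2)) V σ σ') (hr : r.Above (B + 2)) (hc : c.Above (B + 2))
    (hw : w.Above (B + 2)) (hi : σ'.idx B 0 = i) (hj : σ'.idx (B + 1) 0 = j) :
    (cellExpr B r c w).eval σ' = (r.eval σ + i) * w.eval σ + (c.eval σ + j) := by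
  simp [cellExpr, IExpr.eval, hi, hj, IExpr.eval_frame h hr, IExpr.eval_frame h hc,
    IExpr.eval_frame h hw]

theorem Runs.mulBlocks {p : Cmd} {f : ℕ → ℕ} {B : ℕ} (hp : Multiplies p f) (hpB : p.bound ≤ B)
    (hB : 7 ≤ B) {v a₁ a₂ d : ℕ} {r₁ c₁ w₁ r₂ c₂ w₂ r c w : IExpr} {α β : ℚ} {σ : State}
    {s R₁ C₁ W₁ R₂ C₂ W₂ R C W : ℕ} (hv : B + 2 ≤ v) (hs : σ.idx v 0 = s) (hs1 : 1 ≤ s)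
    (hd : B ≤ d) (ha₁ : B ≤ a₁) (ha₂ : B ≤ a₂) (hW : C + s ≤ W)
    (hcost : ∀ e ∈ [r₁, c₁, w₁, r₂, c₂, w₂, r, c, w], e.cost ≤ 5)
    (habove : ∀ e ∈ [r₁, c₁, w₁, r₂, c₂, w₂, r, c, w], e.Above (B + 2))
    (heval : [r₁, c₁, w₁, r₂, c₂, w₂, r, c, w].map (IExpr.eval σ) =
      [R₁, C₁, W₁, R₂, C₂, W₂, R, C, W]) :
    Runs (RealRAM.mulBlocks p B v a₁ r₁ c₁ w₁ a₂ r₂ c₂ w₂ d r c w α β) σ (500 * f s) fun σ' =>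
      Frame (Set.Iio (B + 2)) (insert d (Set.Iio B)) σ σ' ∧
        σ'.block d W R C s =
          (α : ℝ) • σ.block d W R C s + (β : ℝ) • (σ.block a₁ W₁ R₁ C₁ s * σ.block a₂ W₂ R₂ C₂ s) ∧
        ∀ x, (∀ i < s, ∀ j < s, x ≠ (R + i) * W + (C + j)) → σ'.val d x = σ.val d x := by
  simp only [List.forall_mem_cons, List.map_cons, List.cons.injEq] at hcost habove heval
  obtain ⟨k1, k2, k3, k4, k5, k6, k7, k8, k9, -⟩ := hcost
  obtain ⟨b1, b2, b3, b4, b5, b6, b7, b8, b9, -⟩ := habove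
  obtain ⟨rfl, rfl, rfl, rfl, rfl, rfl, rfl, rfl, rfl, -⟩ := heval
  have hpos : ∀ (i j : ℕ) (τ : State) (V : Set ℕ), Frame (Set.Iio (B + 2)) V σ τ →
      τ.idx B 0 = i → τ.idx (B + 1) 0 = j →
      (cellExpr B r c w).eval τ = (r.eval σ + i) * w.eval σ + (c.eval σ + j) :=
    fun i j τ V hτ hi hj => cellExpr_eval hτ b7 b8 b9 hi hj
  refine (Runs.mulStore hp hpB hB hv hs hs1 hd 
    (σ.block a₁ (w₁.eval σ) (r₁.eval σ) (c₁.eval σ) s)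
    (σ.block a₂ (w₂.eval σ) (r₂.eval σ) (c₂.eval σ) s)
    ((α : ℝ) • σ.block d (w.eval σ) (r.eval σ) (c.eval σ) s +
      (β : ℝ) • (σ.block a₁ (w₁.eval σ) (r₁.eval σ) (c₁.eval σ) s *
        σ.block a₂ (w₂.eval σ) (r₂.eval σ) (c₂.eval σ) s))
    (fun i j => (r.eval σ + i) * w.eval σ + (c.eval σ + j)) ?_ ?_ ?_ ?_ ?_ ?_ ?_ ?_).mono le_rfl ?_
  · intro i _ j hj i' _ j' hj' h
    exact block_pos_inj hW hj hj' h
  · simp only [RExpr.cost, cellExpr, IExpr.cost]; omega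
  · simp only [RExpr.cost, cellExpr, IExpr.cost]; omega
  · simp only [RExpr.cost, cellExpr, IExpr.cost]; omega
  · intro i j τ hτ hi hj
    simp only [RExpr.eval, cellExpr_eval hτ b1 b2 b3 hi hj]
    rw [hτ.val a₁ (by simpa using ha₁)]
    rfl
  · intro i j τ hτ hi hj
    simp only [RExpr.eval, cellExpr_eval hτ b4 b5 b6 hi hj]
    rw [hτ.val a₂ (by simpa using ha₂)]
    rfl
  · exact fun i _ j _ τ hτ hi hj => hpos i j τ _ hτ hi hj
  · intro i j τ hτ hi hj h2 hdτ
    simp only [RExpr.eval, hpos i j τ _ hτ hi hj, hdτ]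
    rw [cellExpr_eval (r := .const 0) (c := .const 0) (w := .var v) hτ trivial trivial
      ⟨hv, trivial⟩ hi hj]
    simp only [IExpr.eval, hs, zero_add, h2]
    rfl
  · rintro τ ⟨h1, h2, h3⟩
    exact ⟨h1, Matrix.ext h2, h3⟩

end RealRAM

/-! ### Schur complements of positive definite block matrices -/

open Matrix in
-- Both matrices to which the recursion descends are again positive definite, so no pivoting is
-- needed. The complement is positive semidefinite by the block criterion, and its determinant is
-- nonzero because it is a factor of that of the whole matrix.
theorem Matrix.PosDef.schur_complement {s : ℕ} {A B C D : Matrix (Fin s) (Fin s) ℝ}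
    (h : (fromBlocks A B C D).PosDef) :
    A.PosDef ∧ (D - C * A⁻¹ * B).PosDef ∧
      (fromBlocks A B C D)⁻¹ =
        fromBlocks (A⁻¹ + A⁻¹ * B * (D - C * A⁻¹ * B)⁻¹ * (C * A⁻¹))
          (-(A⁻¹ * B * (D - C * A⁻¹ * B)⁻¹)) (-((D - C * A⁻¹ * B)⁻¹ * (C * A⁻¹)))
          (D - C * A⁻¹ * B)⁻¹ := by
  have hA : A.PosDef := by
    have := h.submatrix (e := Sum.inl) Sum.inl_injective
    simpa [fromBlocks, submatrix] using! this
  have hC : C = Bᴴ := by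
    have := h.1
    rw [isHermitian_fromBlocks_iff] at this
    exact this.2.1.symm
  have : Invertible A := hA.isUnit.invertible
  have hdet := det_fromBlocks₁₁ A B C D
  rw [invOf_eq_nonsing_inv] at hdet
  have hS : (D - C * A⁻¹ * B).PosDef := by
    have h1 : (D - C * A⁻¹ * B).PosSemidef := by
      have h2 := h.posSemidef
      rw [hC, PosDef.fromBlocks₁₁ _ _ hA] at h2
      rwa [hC]
    refine (h1.posDef_iff_isUnit).2 ?_
    rw [isUnit_iff_isUnit_det, isUnit_iff_ne_zero]
    intro h0
    have := h.det_pos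
    rw [hdet, h0] at this
    simp at this
  refine ⟨hA, hS, ?_⟩
  have : Invertible (D - C * ⅟A * B) := by
    rw [invOf_eq_nonsing_inv]; exact hS.isUnit.invertible
  have : Invertible (fromBlocks A B C D) := h.isUnit.invertible
  rw [← invOf_eq_nonsing_inv, invOf_fromBlocks₁₁_eq]
  simp only [invOf_eq_nonsing_inv, Matrix.mul_assoc]

/-! ### Square blocks of stored matrices -/

namespace RealRAM

/-- The matrices with rows of length `W` in the value array `d` agree outside a block. -/
def SameOutside (d W R C s : ℕ) (σ σ' : State) : Prop :=
  ∀ r c, c < W → (r < R ∨ R + s ≤ r ∨ c < C ∨ C + s ≤ c) →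
    σ'.val d (r * W + c) = σ.val d (r * W + c)

theorem SameOutside.of_cells {d W R C s : ℕ} {σ σ' : State}
    (h : ∀ x, (∀ i < s, ∀ j < s, x ≠ (R + i) * W + (C + j)) → σ'.val d x = σ.val d x)
    (hC : C + s ≤ W) : SameOutside d W R C s σ σ' := by
  intro r c hc hrc
  refine h _ fun i hi j hj he => ?_
  have := block_pos_inj (stride := W) (r₀ := 0) (c₀ := 0) (n := W) (by omega) (i := r) (j := c)
    (i' := R + i) (j' := C + j) hc (by omega) (by simpa using he)
  omega

theorem SameOutside.trans {d W R C s : ℕ} {σ σ' σ'' : State} (h : SameOutside d W R C s σ σ')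
    (h' : SameOutside d W R C s σ' σ'') : SameOutside d W R C s σ σ'' :=
  fun r c hc hrc => (h' r c hc hrc).trans (h r c hc hrc)

theorem SameOutside.mono {d W R C s R' C' s' : ℕ} {σ σ' : State} (h : SameOutside d W R C s σ σ')
    (hR : R' ≤ R) (hR' : R + s ≤ R' + s') (hC : C' ≤ C) (hC' : C + s ≤ C' + s') :
    SameOutside d W R' C' s' σ σ' :=
  fun r c hc hrc => h r c hc (by omega)

theorem SameOutside.of_eq {d W R C s : ℕ} {σ σ' : State} (h : σ'.val d = σ.val d) :
    SameOutside d W R C s σ σ' := fun r c _ _ => by rw [h]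

theorem SameOutside.block_eq {d W R C s R' C' s' : ℕ} {σ σ' : State}
    (h : SameOutside d W R C s σ σ') (hC : C' + s' ≤ W)
    (hd : R' + s' ≤ R ∨ R + s ≤ R' ∨ C' + s' ≤ C ∨ C + s ≤ C') :
    σ'.block d W R' C' s' = σ.block d W R' C' s' := by
  ext i j
  exact h _ _ (by omega) (by omega)

theorem State.block_congr {σ σ' : State} {a : ℕ} (h : σ'.val a = σ.val a) (W R C s : ℕ) :
    σ'.block a W R C s = σ.block a W R C s := by
  ext i j
  simp only [State.block, h]

theorem State.block_fromBlocks (σ : State) (a W R C s : ℕ) :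
    (σ.block a W R C (s + s)).submatrix finSumFinEquiv finSumFinEquiv =
      Matrix.fromBlocks (σ.block a W R C s) (σ.block a W R (C + s) s)
        (σ.block a W (R + s) C s) (σ.block a W (R + s) (C + s) s) := by
  ext i j
  rcases i with i | i <;> rcases j with j | j <;>
    simp [State.block, Nat.add_assoc, Nat.add_comm s]

theorem State.setIdx_idx (σ : State) (a i k b j : ℕ) :
    (σ.setIdx a i k).idx b j = if b = a ∧ j = i then k else σ.idx b j := by
  by_cases h : b = a
  · subst h
    by_cases h' : j = i
    · subst h'; simp
    · simp [State.setIdx_idx_cell _ _ _ h', h']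
  · simp [State.setIdx_idx_of_ne _ _ _ h, h]

/-! ### Inversion of positive definite matrices by block recursion

The recursion is unrolled into a loop.  The index variables are `B + 2` for the size of the blocks,
`B + 3` for the level, `B + 4` for the position, `B + 5` for the direction and `B + 6` for the
loop guard; the index array `B + 7` tells for each level which half is being processed.  The
number of rows, the powers of two and the number of levels are in `B + 22`, `B + 23`, `B + 24`,
and the matrix is in the value array `B + 3`. -/

/-- Subtract `C A⁻¹ B` from the lower right block, when `A⁻¹` is in the upper left block. -/
def schurCmd (p : Cmd) (B : ℕ) : Cmd :=
  .seq (mulBlocks p B (B + 2) (B + 3) (.var (B + 4)) (.var (B + 4)) (.var (B + 22))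
      (B + 3) (.var (B + 4)) (.add (.var (B + 4)) (.var (B + 2))) (.var (B + 22))
      B (.const 0) (.const 0) (.var (B + 2)) 0 1)
    (mulBlocks p B (B + 2)
      (B + 3) (.add (.var (B + 4)) (.var (B + 2))) (.var (B + 4)) (.var (B + 22))
      B (.const 0) (.const 0) (.var (B + 2))
      (B + 3) (.add (.var (B + 4)) (.var (B + 2))) (.add (.var (B + 4)) (.var (B + 2)))
      (.var (B + 22)) 1 (-1))

/-- The inverse of a matrix from the inverses of the upper left block and its Schur complement. -/
def combineCmd (p : Cmd) (B : ℕ) : Cmd :=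
  .seq (mulBlocks p B (B + 2) (B + 3) (.var (B + 4)) (.var (B + 4)) (.var (B + 22))
      (B + 3) (.var (B + 4)) (.add (.var (B + 4)) (.var (B + 2))) (.var (B + 22))
      B (.const 0) (.const 0) (.var (B + 2)) 0 1)
    (.seq (mulBlocks p B (B + 2)
      (B + 3) (.add (.var (B + 4)) (.var (B + 2))) (.var (B + 4)) (.var (B + 22))
      (B + 3) (.var (B + 4)) (.var (B + 4)) (.var (B + 22))
      (B + 1) (.const 0) (.const 0) (.var (B + 2)) 0 1)
    (.seq (mulBlocks p B (B + 2) B (.const 0) (.const 0) (.var (B + 2))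
      (B + 3) (.add (.var (B + 4)) (.var (B + 2))) (.add (.var (B + 4)) (.var (B + 2)))
      (.var (B + 22))
      (B + 3) (.var (B + 4)) (.add (.var (B + 4)) (.var (B + 2))) (.var (B + 22)) 0 (-1))
    (.seq (mulBlocks p B (B + 2)
      (B + 3) (.add (.var (B + 4)) (.var (B + 2))) (.add (.var (B + 4)) (.var (B + 2)))
      (.var (B + 22)) (B + 1) (.const 0) (.const 0) (.var (B + 2))
      (B + 3) (.add (.var (B + 4)) (.var (B + 2))) (.var (B + 4)) (.var (B + 22)) 0 (-1))
    (mulBlocks p B (B + 2)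
      (B + 3) (.var (B + 4)) (.add (.var (B + 4)) (.var (B + 2))) (.var (B + 22))
      (B + 1) (.const 0) (.const 0) (.var (B + 2))
      (B + 3) (.var (B + 4)) (.var (B + 4)) (.var (B + 22)) 1 (-1)))))

theorem Runs.schurCmd {p : Cmd} {f : ℕ → ℕ} {B : ℕ} (hp : Multiplies p f) (hpB : p.bound ≤ B)
    (hB : 7 ≤ B) {σ : State} {s l N : ℕ} (hs : σ.idx (B + 2) 0 = s) (hl : σ.idx (B + 4) 0 = l)
    (hN : σ.idx (B + 22) 0 = N) (hs1 : 1 ≤ s) (hsN : l + s + s ≤ N) :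
    Runs (RealRAM.schurCmd p B) σ (1000 * f s) fun σ' =>
      Frame (Set.Iio (B + 2)) (Set.Iio (B + 4)) σ σ' ∧
      SameOutside (B + 3) N (l + s) (l + s) s σ σ' ∧
      σ'.block (B + 3) N (l + s) (l + s) s = σ.block (B + 3) N (l + s) (l + s) s -
        σ.block (B + 3) N (l + s) l s *
          (σ.block (B + 3) N l l s * σ.block (B + 3) N l (l + s) s) := by
  have hmul : ∀ τ, Frame (Set.Iio (B + 2)) (Set.Iio (B + 4)) σ τ →
      τ.idx (B + 2) 0 = s ∧ τ.idx (B + 4) 0 = l ∧ τ.idx (B + 22) 0 = N := fun τ h => by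
    rw [h.idx _ (by simp), h.idx (B + 4) (by simp), h.idx (B + 22) (by simp)]
    exact ⟨hs, hl, hN⟩
  have hf : ∀ d : ℕ, d < B + 4 → insert d (Set.Iio B) ⊆ Set.Iio (B + 4) := by
    intro d hd x; simp; omega
  refine (Runs.seq' (T := 500 * f s) (T' := 500 * f s) (Runs.mulBlocks hp hpB hB (v := B + 2)
    (R₁ := l) (C₁ := l) (W₁ := N) (R₂ := l) (C₂ := l + s) (W₂ := N) (R := 0) (C := 0) (W := s)
    (s := s) (by omega) hs hs1 (by omega) (by omega) (by omega) (by omega) (by simp [IExpr.cost])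
    (by simp [IExpr.Above]) (by simp [IExpr.eval, hs, hl, hN])) ?_).mono (by omega) (fun _ h => h)
  rintro σ₁ ⟨h1, h2, -⟩
  have hf1 := h1.mono le_rfl (hf B (by omega))
  obtain ⟨hs', hl', hN'⟩ := hmul _ hf1
  have hM : σ₁.val (B + 3) = σ.val (B + 3) := h1.val _ (by simp)
  refine (Runs.mulBlocks hp hpB hB (v := B + 2)
    (R₁ := l + s) (C₁ := l) (W₁ := N) (R₂ := 0) (C₂ := 0) (W₂ := s) (R := l + s) (C := l + s)
    (W := N) (s := s) (by omega) hs' hs1 (by omega) (by omega) (by omega) (by omega)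
    (by simp [IExpr.cost]) (by simp [IExpr.Above])
    (by simp [IExpr.eval, hs', hl', hN'])).mono le_rfl ?_
  rintro σ₂ ⟨h3, h4, h5⟩
  refine ⟨hf1.trans (h3.mono le_rfl (hf _ (by omega))),
    (SameOutside.of_eq hM).trans (SameOutside.of_cells h5 (by omega)), ?_⟩
  rw [h4, h2]
  simp only [State.block_congr hM]
  simp [sub_eq_add_neg]

/-- The order of the five products matters. `A' B'` and `C' A'` go to scratch arrays while the
off-diagonal blocks are intact; then those blocks are overwritten; the upper left block comes last,
since its correction is minus the new upper right block times `C' A'`. -/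
theorem Runs.combineCmd {p : Cmd} {f : ℕ → ℕ} {B : ℕ} (hp : Multiplies p f) (hpB : p.bound ≤ B)
    (hB : 7 ≤ B) {σ : State} {s l N : ℕ} (hs : σ.idx (B + 2) 0 = s) (hl : σ.idx (B + 4) 0 = l)
    (hN : σ.idx (B + 22) 0 = N) (hs1 : 1 ≤ s) (hsN : l + s + s ≤ N)
    {A' B' C' D' : Matrix (Fin s) (Fin s) ℝ} (hA : σ.block (B + 3) N l l s = A')
    (hB' : σ.block (B + 3) N l (l + s) s = B') (hC : σ.block (B + 3) N (l + s) l s = C')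
    (hD : σ.block (B + 3) N (l + s) (l + s) s = D') :
    Runs (RealRAM.combineCmd p B) σ (2500 * f s) fun σ' =>
      Frame (Set.Iio (B + 2)) (Set.Iio (B + 4)) σ σ' ∧
      SameOutside (B + 3) N l l (s + s) σ σ' ∧
      σ'.block (B + 3) N l l s = A' + A' * B' * D' * (C' * A') ∧
      σ'.block (B + 3) N l (l + s) s = -(A' * B' * D') ∧
      σ'.block (B + 3) N (l + s) l s = -(D' * (C' * A')) ∧
      σ'.block (B + 3) N (l + s) (l + s) s = D' := by
  have hmul : ∀ τ, Frame (Set.Iio (B + 2)) (Set.Iio (B + 4)) σ τ →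
      τ.idx (B + 2) 0 = s ∧ τ.idx (B + 4) 0 = l ∧ τ.idx (B + 22) 0 = N := fun τ h => by
    rw [h.idx _ (by simp), h.idx (B + 4) (by simp), h.idx (B + 22) (by simp)]
    exact ⟨hs, hl, hN⟩
  have hf : ∀ d : ℕ, d < B + 4 → insert d (Set.Iio B) ⊆ Set.Iio (B + 4) := by
    intro d hd x; simp; omega
  refine (Runs.seq' (T := 500 * f s) (T' := 500 * f s + (500 * f s + (500 * f s + 500 * f s)))
    (Runs.mulBlocks hp hpB hB (v := B + 2)
    (R₁ := l) (C₁ := l) (W₁ := N) (R₂ := l) (C₂ := l + s) (W₂ := N) (R := 0) (C := 0) (W := s)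
    (s := s) (by omega) hs hs1 (by omega) (by omega) (by omega) (by omega) (by simp [IExpr.cost])
    (by simp [IExpr.Above]) (by simp [IExpr.eval, hs, hl, hN])) ?_).mono (by omega) (fun _ h => h)
  rintro σ₁ ⟨h1, hX1, -⟩
  have hf1 := h1.mono le_rfl (hf B (by omega))
  obtain ⟨hs', hl', hN'⟩ := hmul _ hf1
  have hM : σ₁.val (B + 3) = σ.val (B + 3) := h1.val _ (by simp)
  have hX : σ₁.block B s 0 0 s = A' * B' := by rw [hX1, hA, hB']; simp
  rw [← State.block_congr hM] at hA hB' hC hD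
  refine Runs.seq' (Runs.mulBlocks hp hpB hB (v := B + 2)
    (R₁ := l + s) (C₁ := l) (W₁ := N) (R₂ := l) (C₂ := l) (W₂ := N) (R := 0) (C := 0)
    (W := s) (s := s) (by omega) hs' hs1 (by omega) (by omega) (by omega) (by omega)
    (by simp [IExpr.cost]) (by simp [IExpr.Above])
    (by simp [IExpr.eval, hs', hl', hN'])) ?_
  rintro σ₂ ⟨h2, hY1, -⟩
  have hf2 := hf1.trans (h2.mono le_rfl (hf _ (by omega)))
  clear hs' hl' hN'
  obtain ⟨hs', hl', hN'⟩ := hmul _ hf2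
  have hM2 : σ₂.val (B + 3) = σ₁.val (B + 3) := h2.val _ (by simp)
  have hY : σ₂.block (B + 1) s 0 0 s = C' * A' := by rw [hY1, hA, hC]; simp
  rw [← State.block_congr (h2.val B (by simp))] at hX
  rw [← State.block_congr hM2] at hA hB' hC hD
  refine Runs.seq' (Runs.mulBlocks hp hpB hB (v := B + 2)
    (R₁ := 0) (C₁ := 0) (W₁ := s) (R₂ := l + s) (C₂ := l + s) (W₂ := N) (R := l) (C := l + s)
    (W := N) (s := s) (by omega) hs' hs1 (by omega) (by omega) (by omega) (by omega)
    (by simp [IExpr.cost]) (by simp [IExpr.Above])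
    (by simp [IExpr.eval, hs', hl', hN'])) ?_
  rintro σ₃ ⟨h3, hB3, ho3⟩
  have hf3 := hf2.trans (h3.mono le_rfl (hf _ (by omega)))
  clear hs' hl' hN'
  obtain ⟨hs', hl', hN'⟩ := hmul _ hf3
  replace ho3 := SameOutside.of_cells ho3 (by omega)
  rw [hX, hD] at hB3
  rw [← State.block_congr (h3.val (B + 1) (by simp))] at hY
  rw [← ho3.block_eq (by omega) (by omega)] at hA hC hD
  refine Runs.seq' (Runs.mulBlocks hp hpB hB (v := B + 2)
    (R₁ := l + s) (C₁ := l + s) (W₁ := N) (R₂ := 0) (C₂ := 0) (W₂ := s) (R := l + s) (C := l)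
    (W := N) (s := s) (by omega) hs' hs1 (by omega) (by omega) (by omega) (by omega)
    (by simp [IExpr.cost]) (by simp [IExpr.Above])
    (by simp [IExpr.eval, hs', hl', hN'])) ?_
  rintro σ₄ ⟨h4, hC4, ho4⟩
  have hf4 := hf3.trans (h4.mono le_rfl (hf _ (by omega)))
  clear hs' hl' hN'
  obtain ⟨hs', hl', hN'⟩ := hmul _ hf4
  replace ho4 := SameOutside.of_cells ho4 (by omega)
  rw [hY, hD] at hC4
  rw [← State.block_congr (h4.val (B + 1) (by simp))] at hY
  rw [← ho4.block_eq (by omega) (by omega)] at hA hD hB3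
  refine (Runs.mulBlocks hp hpB hB (v := B + 2)
    (R₁ := l) (C₁ := l + s) (W₁ := N) (R₂ := 0) (C₂ := 0) (W₂ := s) (R := l) (C := l)
    (W := N) (s := s) (by omega) hs' hs1 (by omega) (by omega) (by omega) (by omega)
    (by simp [IExpr.cost]) (by simp [IExpr.Above])
    (by simp [IExpr.eval, hs', hl', hN'])).mono le_rfl ?_
  rintro σ₅ ⟨h5, hA5, ho5⟩
  replace ho5 := SameOutside.of_cells ho5 (by omega)
  rw [hY, hA, hB3] at hA5
  rw [← ho5.block_eq (by omega) (by omega)] at hD hB3 hC4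
  refine ⟨hf4.trans (h5.mono le_rfl (hf _ (by omega))), ?_, ?_, ?_, ?_, hD⟩
  · have ho : SameOutside (B + 3) N l l (s + s) σ σ₂ := SameOutside.of_eq (hM2.trans hM)
    exact ((ho.trans (ho3.mono (by omega) (by omega) (by omega) (by omega))).trans
      (ho4.mono (by omega) (by omega) (by omega) (by omega))).trans
      (ho5.mono (by omega) (by omega) (by omega) (by omega))
  · rw [hA5]; simp [Matrix.mul_assoc]
  · rw [hB3]; simp
  · rw [hC4]; simp

end RealRAM

/-! ### The block recursion as a single loop -/

namespace RealRAM

/-- One step of the block recursion. -/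
def inverseStep (p : Cmd) (B : ℕ) : Cmd :=
  .ite (.idxLt (.var (B + 5)) (.const 1))
    (.ite (.idxLt (.var (B + 3)) (.const 1))
      (.seq (.setVal (B + 3) (.add (.mul (.var (B + 4)) (.var (B + 22))) (.var (B + 4)))
          (.div (.const 1)
            (.load (B + 3) (.add (.mul (.var (B + 4)) (.var (B + 22))) (.var (B + 4))))))
        (.setIdx (B + 5) (.const 0) (.const 1)))
      (.seq (.setIdx (B + 3) (.const 0) (.sub (.var (B + 3)) (.const 1)))
        (.setIdx (B + 7) (.var (B + 3)) (.const 0))))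
    (.ite (.idxLt (.var (B + 3)) (.var (B + 24)))
      (.seq (.setIdx (B + 2) (.const 0) (.load (B + 23) (.var (B + 3))))
        (.ite (.idxLt (.load (B + 7) (.var (B + 3))) (.const 1))
          (.seq (schurCmd p B)
            (.seq (.setIdx (B + 4) (.const 0) (.add (.var (B + 4)) (.var (B + 2))))
              (.seq (.setIdx (B + 7) (.var (B + 3)) (.const 1))
                (.setIdx (B + 5) (.const 0) (.const 0)))))
          (.seq (.setIdx (B + 4) (.const 0) (.sub (.var (B + 4)) (.var (B + 2))))
            (.seq (combineCmd p B)
              (.setIdx (B + 3) (.const 0) (.add (.var (B + 3)) (.const 1)))))))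
      (.setIdx (B + 6) (.const 0) (.const 0)))

/-- Invert the matrix in the value array `B + 3`. -/
def inverseCmd (p : Cmd) (B : ℕ) : Cmd :=
  .seq (.setIdx (B + 3) (.const 0) (.var (B + 24)))
    (.seq (.setIdx (B + 4) (.const 0) (.const 0))
      (.seq (.setIdx (B + 5) (.const 0) (.const 0))
        (.seq (.setIdx (B + 6) (.const 0) (.const 1))
          (.loop (.idxLt (.const 0) (.var (B + 6))) (inverseStep p B)))))

/-- The size of the matrices and the powers of two are stored for the block recursion. -/
structure PowersStored (B top : ℕ) (σ : State) : Prop where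
  size : σ.idx (B + 22) 0 = 2 ^ top
  pow : ∀ j ≤ top, σ.idx (B + 23) j = 2 ^ j
  top : σ.idx (B + 24) 0 = top

theorem PowersStored.frame {B top b : ℕ} {V : Set ℕ} {σ σ' : State} (h : PowersStored B top σ)
    (hσ : Frame (Set.Iio b) V σ σ') (hb : b ≤ B + 22) : PowersStored B top σ' := by
  refine ⟨?_, fun j hj => ?_, ?_⟩
  · rw [hσ.idx _ (by simp; omega), h.size]
  · rw [hσ.idx _ (by simp; omega), h.pow j hj]
  · rw [hσ.idx _ (by simp; omega), h.top]

/-- The position of the block recursion: the level, the corner, the direction. -/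
structure RecursionAt (B lev l dir : ℕ) (σ : State) : Prop where
  lev : σ.idx (B + 3) 0 = lev
  pos : σ.idx (B + 4) 0 = l
  dir : σ.idx (B + 5) 0 = dir
  run : σ.idx (B + 6) 0 = 1

/-- The time for inverting a block at a level of the recursion. -/
def inverseTime (f : ℕ → ℕ) : ℕ → ℕ
  | 0 => 100
  | k + 1 => 2 * inverseTime f k + 5000 * f (2 ^ k)

/-- The statement is in continuation form: `T` and `Q` describe what the loop does once the block is
inverted. This allows induction on the level although the program has no call stack. The stack is
replaced by level, corner, direction and one flag per level. Inverting a block at level `k` writes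
only flags below `k`, so on the way up the flag at level `k` still tells which half has just been
inverted. -/
theorem inverse_recursion {p : Cmd} {f : ℕ → ℕ} {B top : ℕ} (hp : Multiplies p f)
    (hpB : p.bound ≤ B) (hB : 7 ≤ B) (k : ℕ) :
    ∀ (σ : State) (l : ℕ), PowersStored B top σ → k ≤ top → l + 2 ^ k ≤ 2 ^ top →
    RecursionAt B k l 0 σ → (σ.block (B + 3) (2 ^ top) l l (2 ^ k)).PosDef →
    ∀ (T : ℕ) (Q : State → Prop),
    (∀ σ', Frame (Set.Iio (B + 8)) (Set.Iio (B + 4)) σ σ' → RecursionAt B k l 1 σ' →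
      (∀ j, k ≤ j → σ'.idx (B + 7) j = σ.idx (B + 7) j) →
      SameOutside (B + 3) (2 ^ top) l l (2 ^ k) σ σ' →
      σ'.block (B + 3) (2 ^ top) l l (2 ^ k) = (σ.block (B + 3) (2 ^ top) l l (2 ^ k))⁻¹ →
      Runs (.loop (.idxLt (.const 0) (.var (B + 6))) (inverseStep p B)) σ' T Q) →
    Runs (.loop (.idxLt (.const 0) (.var (B + 6))) (inverseStep p B)) σ (inverseTime f k + T) Q := by
  induction k with
  | zero =>
    intro σ l hσ _ hl hr hM T Q hQ
    have hstep : Runs (inverseStep p B) σ 60 fun σ' =>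
        σ' = (σ.setVal (B + 3) (l * 2 ^ top + l) (1 / σ.val (B + 3) (l * 2 ^ top + l))).setIdx
          (B + 5) 0 1 := by
      refine (Runs.ite (T := 50) (fun _ => (Runs.ite (T := 40) (fun _ => (Runs.seq (T := 30) (T' := 5)
        (Runs.setVal (by simp [IExpr.cost, RExpr.cost]) (Runs.setIdx (by simp [IExpr.cost]) ?_))).mono
        (by norm_num) (fun _ h => h)) (fun h => (h ?_).elim)).mono
        (by simp [Test.cost, IExpr.cost]) (fun _ h => h))
        (fun h => (h ?_).elim)).mono (by simp [Test.cost, IExpr.cost]) (fun _ h => h)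
      · simp [IExpr.eval, RExpr.eval, hr.pos, hσ.size]
      · simp [Test.Holds, IExpr.eval, hr.lev]
      · simp [Test.Holds, IExpr.eval, hr.dir]
    refine (Runs.loop_step (T := 60) (T' := T) (Q := Q) (by simp [Test.Holds, IExpr.eval, hr.run])
      (hstep.mono le_rfl ?_)).mono (by simp [Test.cost, IExpr.cost, inverseTime])
      (fun _ h => h)
    rintro _ rfl
    refine hQ _ (((Frame.refl _ _ _).setVal (by simp) _ _).setIdx (by simp) _ _)
      ⟨?_, ?_, ?_, ?_⟩ ?_ ?_ ?_
    · simp [State.setIdx_idx, hr.lev]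
    · simp [State.setIdx_idx, hr.pos]
    · simp [State.setIdx_idx]
    · simp [State.setIdx_idx, hr.run]
    · simp [State.setIdx_idx]
    · refine SameOutside.of_cells (fun x hx => ?_) (by simpa using hl)
      rw [State.setIdx_val, State.setVal_val_cell]
      simpa using hx 0 (by simp) 0 (by simp)
    · have h1 : ∀ X : Matrix (Fin (2 ^ 0)) (Fin (2 ^ 0)) ℝ, X⁻¹ = fun i j => 1 / X i j := by
        intro X
        have : Unique (Fin (2 ^ 0)) := inferInstanceAs (Unique (Fin 1))
        ext i j
        rw [Subsingleton.elim i j, Matrix.inv_subsingleton]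
        simp
      rw [h1]
      ext i j
      have hi : (i : ℕ) = 0 := by omega
      have hj : (j : ℕ) = 0 := by omega
      simp [State.block, hi, hj]
  | succ k ih =>
    intro σ l hσ hk hl hr hM T Q hQ
    set s := 2 ^ k with hs
    have hs1 : 1 ≤ s := Nat.one_le_two_pow
    have hss : 2 ^ (k + 1) = s + s := by rw [pow_succ]; omega
    rw [hss] at hl hM hQ
    have hfs : 1 ≤ f s := (Nat.one_le_pow _ _ hs1).trans (hp.sq_le hs1)
    set N := 2 ^ top with hN
    have hblocks : ∀ τ : State, (τ.block (B + 3) N l l (s + s)).submatrix finSumFinEquiv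
      finSumFinEquiv = Matrix.fromBlocks (τ.block (B + 3) N l l s) (τ.block (B + 3) N l (l + s) s)
        (τ.block (B + 3) N (l + s) l s) (τ.block (B + 3) N (l + s) (l + s) s) :=
      fun τ => τ.block_fromBlocks _ _ _ _ _
    have hMb := hM.submatrix (e := (finSumFinEquiv : Fin s ⊕ Fin s ≃ Fin (s + s)))
      finSumFinEquiv.injective
    rw [hblocks] at hMb
    obtain ⟨hA, hS, hinv⟩ := hMb.schur_complement
    have hrun : ∀ {τ : State} {lev l dir : ℕ}, RecursionAt B lev l dir τ →
        (Test.idxLt (.const 0) (.var (B + 6))).Holds τ := fun h => by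
      simp [Test.Holds, IExpr.eval, h.run]
    have hcost : (Test.idxLt (.const 0) (.var (B + 6))).cost = 4 := rfl
    -- down to the first half
    have step₁ : Runs (inverseStep p B) σ 60 fun σ' =>
        σ' = (σ.setIdx (B + 3) 0 k).setIdx (B + 7) k 0 := by
      refine (Runs.ite (T := 50) (fun _ => (Runs.ite (T := 40) (fun h => ?_)
        (fun _ => (Runs.seq (T := 30) (T' := 5)
        (Runs.setIdx (by simp [IExpr.cost]) (Runs.setIdx (by simp [IExpr.cost]) ?_))).mono
        (by norm_num) (fun _ h => h))).mono
        (by simp [Test.cost, IExpr.cost]) (fun _ h => h))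
        (fun h => (h ?_).elim)).mono (by simp [Test.cost, IExpr.cost]) (fun _ h => h)
      · simp [Test.Holds, IExpr.eval, hr.lev] at h
      · simp [IExpr.eval, hr.lev]
      · simp [Test.Holds, IExpr.eval, hr.dir]
    -- The remaining time is split into its phases: first half, Schur complement, second half,
    -- combination, continuation.
    refine (Runs.loop_step (T := 60) (T' := inverseTime f k + (4 + (1000 * f s + 60) +
      (inverseTime f k + (4 + (2500 * f s + 60) + T)))) (Q := Q) (hrun hr)
      (step₁.mono le_rfl ?_)).mono (by rw [hcost, inverseTime, ← hs]; omega) (fun _ h => h)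
    rintro σ₁ hσ₁
    have hF₁ : Frame (Set.Iio (B + 8)) (Set.Iio (B + 4)) σ σ₁ := by
      rw [hσ₁]
      exact ((Frame.refl _ _ _).setIdx (by simp) _ _).setIdx (by simp) _ _
    have hv₁ : σ₁.val = σ.val := by rw [hσ₁]; rfl
    have hr₁ : RecursionAt B k l 0 σ₁ := by
      rw [hσ₁]
      exact ⟨by simp [State.setIdx_idx], by simp [State.setIdx_idx, hr.pos],
        by simp [State.setIdx_idx, hr.dir], by simp [State.setIdx_idx, hr.run]⟩
    have hside₁ : ∀ j, σ₁.idx (B + 7) j = if j = k then 0 else σ.idx (B + 7) j := by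
      intro j; rw [hσ₁]; simp [State.setIdx_idx]
    clear hσ₁
    have hb₁ : ∀ r c m, σ₁.block (B + 3) N r c m = σ.block (B + 3) N r c m := fun r c m =>
      State.block_congr (by rw [hv₁]) _ _ _ _
    refine ih σ₁ l (hσ.frame hF₁ (by omega)) (by omega) (by omega) hr₁ (by rw [hb₁]; exact hA) _ _ ?_
    intro σ₂ hF₂ hr₂ hside₂ ho₂ hinv₂
    rw [hb₁] at hinv₂
    have hσ₂ := (hσ.frame hF₁ (by omega)).frame hF₂ (by omega)
    -- the Schur complement
    have step₂ : Runs (inverseStep p B) σ₂ (1000 * f s + 60) fun σ' =>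
        Frame (Set.Iio (B + 8)) (Set.Iio (B + 4)) σ₂ σ' ∧ RecursionAt B k (l + s) 0 σ' ∧
        (∀ j, σ'.idx (B + 7) j = if j = k then 1 else σ₂.idx (B + 7) j) ∧
        SameOutside (B + 3) N (l + s) (l + s) s σ₂ σ' ∧
        σ'.block (B + 3) N (l + s) (l + s) s = σ₂.block (B + 3) N (l + s) (l + s) s -
          σ₂.block (B + 3) N (l + s) l s *
          (σ₂.block (B + 3) N l l s * σ₂.block (B + 3) N l (l + s) s) := by
      refine (Runs.ite (T := 1000 * f s + 54) (fun h => ?_) (fun _ => (Runs.ite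
        (T := 1000 * f s + 48) (fun _ => ?_) (fun h => (h ?_).elim)).mono
        (by simp [Test.cost, IExpr.cost]; omega) (fun _ h => h))).mono
        (by simp [Test.cost, IExpr.cost]; omega) (fun _ h => h)
      · simp [Test.Holds, IExpr.eval, hr₂.dir] at h
      · refine (Runs.seq (T := 10) (T' := 1000 * f s + 38) (Runs.setIdx (by simp [IExpr.cost])
          ((Runs.ite (T := 1000 * f s + 30) (fun _ => ?_) (fun h => (h ?_).elim)).mono
            (by simp [Test.cost, IExpr.cost]; omega) (fun _ h => h)))).mono
            (by omega) (fun _ h => h)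
        · set τ := σ₂.setIdx (B + 2) ((IExpr.const 0).eval σ₂)
            ((IExpr.load (B + 23) (IExpr.var (B + 3))).eval σ₂) with hτ
          have hτF : Frame (Set.Iio (B + 8)) (Set.Iio (B + 4)) σ₂ τ :=
            (Frame.refl _ _ _).setIdx (by simp) _ _
          refine (Runs.seq' (T' := 30) (Runs.schurCmd hp hpB hB (σ := τ) (s := s) (l := l) (N := N) ?_ ?_ ?_
            hs1 (by omega)) ?_).mono (by omega) (fun _ h => h)
          · simp [hτ, State.setIdx_idx, IExpr.eval, hr₂.lev, hσ₂.pow k (by omega), hs]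
          · simp [hτ, State.setIdx_idx, hr₂.pos]
          · simp [hτ, State.setIdx_idx, hσ₂.size, hN]
          · rintro σ₃ ⟨g1, g2, g3⟩
            have e2 : σ₃.idx (B + 2) 0 = s := by
              rw [g1.idx _ (by simp)]
              simp [hτ, State.setIdx_idx, IExpr.eval, hr₂.lev, hσ₂.pow k (by omega), hs]
            have e3 : σ₃.idx (B + 3) 0 = k := by
              rw [g1.idx _ (by simp)]; simp [hτ, State.setIdx_idx, hr₂.lev]
            have e4 : σ₃.idx (B + 4) 0 = l := by
              rw [g1.idx _ (by simp)]; simp [hτ, State.setIdx_idx, hr₂.pos]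
            have e6 : σ₃.idx (B + 6) 0 = 1 := by
              rw [g1.idx _ (by simp)]; simp [hτ, State.setIdx_idx, hr₂.run]
            have e7 : σ₃.idx (B + 7) = σ₂.idx (B + 7) := by
              rw [g1.idx _ (by simp)]; exact State.setIdx_idx_of_ne _ _ _ (by simp)
            refine (Runs.seq (T := 10) (T' := 20) (Runs.setIdx (by simp [IExpr.cost])
              (Runs.seq (T := 10) (T' := 10) (Runs.setIdx (by simp [IExpr.cost])
              (Runs.setIdx (by simp [IExpr.cost]) ?_)))))
            refine ⟨((((hτF.trans (g1.mono (by intro a; simp; omega) le_rfl)).setIdx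
              (by simp) _ _).setIdx (by simp) _ _).setIdx (by simp) _ _), ⟨?_, ?_, ?_, ?_⟩, ?_,
              g2, g3⟩
            · simp [State.setIdx_idx, e3]
            · simp [State.setIdx_idx, IExpr.eval, e4, e2]
            · simp [State.setIdx_idx, IExpr.eval]
            · simp [State.setIdx_idx, e6]
            · simp [State.setIdx_idx, IExpr.eval, e3, e7]
        · simp [Test.Holds, IExpr.eval, State.setIdx_idx, hr₂.lev, hside₂, hside₁]
      · simp only [Test.Holds, IExpr.eval, hr₂.lev, hσ₂.top]; omega
    refine (Runs.loop_step (Q := Q) (hrun hr₂) (step₂.mono le_rfl ?_)).mono (by rw [hcost])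
      (fun _ h => h)
    rintro σ₃ ⟨hF₃, hr₃, hside₃, ho₃, hS₃⟩
    have hσ₃ := hσ₂.frame hF₃ (by omega)
    rw [hinv₂, ho₂.block_eq (by omega) (by omega), ho₂.block_eq (by omega) (by omega),
      ho₂.block_eq (by omega) (by omega), hb₁, hb₁, hb₁, ← Matrix.mul_assoc] at hS₃
    refine ih σ₃ (l + s) hσ₃ (by omega) (by omega) hr₃ (by rw [hS₃]; exact hS) _ _ ?_
    intro σ₄ hF₄ hr₄ hside₄ ho₄ hinv₄
    have hσ₄ := hσ₃.frame hF₄ (by omega)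
    rw [hS₃] at hinv₄
    -- combine
    have step₃ : Runs (inverseStep p B) σ₄ (2500 * f s + 60) fun σ' =>
        Frame (Set.Iio (B + 8)) (Set.Iio (B + 4)) σ₄ σ' ∧ RecursionAt B (k + 1) l 1 σ' ∧
        (σ'.idx (B + 7) = σ₄.idx (B + 7)) ∧
        SameOutside (B + 3) N l l (s + s) σ₄ σ' ∧
        (σ'.block (B + 3) N l l (s + s)).submatrix finSumFinEquiv finSumFinEquiv =
          (Matrix.fromBlocks (σ.block (B + 3) N l l s) (σ.block (B + 3) N l (l + s) s)
        (σ.block (B + 3) N (l + s) l s) (σ.block (B + 3) N (l + s) (l + s) s))⁻¹ := by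
      refine (Runs.ite (T := 2500 * f s + 54) (fun h => ?_) (fun _ => (Runs.ite
        (T := 2500 * f s + 48) (fun _ => ?_) (fun h => (h ?_).elim)).mono
        (by simp [Test.cost, IExpr.cost]; omega) (fun _ h => h))).mono
        (by simp [Test.cost, IExpr.cost]; omega) (fun _ h => h)
      · simp [Test.Holds, IExpr.eval, hr₄.dir] at h
      · refine (Runs.seq (T := 10) (T' := 2500 * f s + 38) (Runs.setIdx (by simp [IExpr.cost])
          ((Runs.ite (T := 2500 * f s + 30) (fun h => ?_) (fun _ => ?_)).mono
            (by simp [Test.cost, IExpr.cost]; omega) (fun _ h => h)))).mono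
            (by omega) (fun _ h => h)
        · simp [Test.Holds, IExpr.eval, State.setIdx_idx, hr₄.lev, hside₄, hside₃] at h
        refine (Runs.seq (T := 10) (T' := 2500 * f s + 20) (Runs.setIdx (by simp [IExpr.cost])
          ?_)).mono (by omega) (fun _ h => h)
        set τ := (σ₄.setIdx (B + 2) ((IExpr.const 0).eval σ₄)
            ((IExpr.load (B + 23) (IExpr.var (B + 3))).eval σ₄)) with hτ
        have f2 : τ.idx (B + 2) 0 = s := by
          simp [hτ, State.setIdx_idx, IExpr.eval, hr₄.lev, hσ₄.pow k (by omega), hs]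
        have f4 : τ.idx (B + 4) 0 = l + s := by simp [hτ, State.setIdx_idx, hr₄.pos]
        have hτF : Frame (Set.Iio (B + 8)) (Set.Iio (B + 4)) σ₄ τ :=
            (Frame.refl _ _ _).setIdx (by simp) _ _
        set τ' := τ.setIdx (B + 4) ((IExpr.const 0).eval τ)
          (((IExpr.var (B + 4)).sub (IExpr.var (B + 2))).eval τ) with hτ'
        have hτF' : Frame (Set.Iio (B + 8)) (Set.Iio (B + 4)) σ₄ τ' :=
            hτF.setIdx (by simp) _ _
        have e2 : τ'.idx (B + 2) 0 = s := by simp [hτ', State.setIdx_idx, f2]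
        have e3 : τ'.idx (B + 3) 0 = k := by simp [hτ', hτ, State.setIdx_idx, hr₄.lev]
        have e4 : τ'.idx (B + 4) 0 = l := by simp [hτ', State.setIdx_idx, IExpr.eval, f2, f4]
        have e5 : τ'.idx (B + 5) 0 = 1 := by simp [hτ', hτ, State.setIdx_idx, hr₄.dir]
        have e6 : τ'.idx (B + 6) 0 = 1 := by simp [hτ', hτ, State.setIdx_idx, hr₄.run]
        have e7 : τ'.idx (B + 7) = σ₄.idx (B + 7) := by
          ext j; simp [hτ', hτ, State.setIdx_idx]
        have e22 : τ'.idx (B + 22) 0 = N := by simp [hτ', hτ, State.setIdx_idx, hσ₄.size, hN]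
        have ev : τ'.val = σ₄.val := rfl
        have eb : ∀ r c m, τ'.block (B + 3) N r c m = σ₄.block (B + 3) N r c m := fun r c m =>
          State.block_congr (by rw [ev]) _ _ _ _
        refine (Runs.seq' (T' := 10) (Runs.combineCmd hp hpB hB (σ := τ') (s := s) (l := l) (N := N)
          (A' := (σ.block (B + 3) N l l s)⁻¹) (B' := σ.block (B + 3) N l (l + s) s)
          (C' := σ.block (B + 3) N (l + s) l s) e2 e4 e22 hs1 (by omega) ?_ ?_ ?_ (by rw [eb, hinv₄]))
            ?_).mono (by omega) (fun _ h => h)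
        · rw [eb, ho₄.block_eq (by omega) (by omega), ho₃.block_eq (by omega) (by omega), hinv₂]
        · rw [eb, ho₄.block_eq (by omega) (by omega), ho₃.block_eq (by omega) (by omega),
            ho₂.block_eq (by omega) (by omega), hb₁]
        · rw [eb, ho₄.block_eq (by omega) (by omega), ho₃.block_eq (by omega) (by omega),
            ho₂.block_eq (by omega) (by omega), hb₁]
        · rintro σ₅ ⟨g1, g2, g3, g4, g5, g6⟩
          refine Runs.setIdx (by simp [IExpr.cost]) ⟨((hτF'.trans (g1.mono
            (by intro a; simp; omega) le_rfl)).setIdx (by simp) _ _), ⟨?_, ?_, ?_, ?_⟩, ?_, g2, ?_⟩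
          · simp [State.setIdx_idx, IExpr.eval, g1.idx (B + 3) (by simp), e3]
          · simp [State.setIdx_idx, g1.idx (B + 4) (by simp), e4]
          · simp [State.setIdx_idx, g1.idx (B + 5) (by simp), e5]
          · simp [State.setIdx_idx, g1.idx (B + 6) (by simp), e6]
          · rw [State.setIdx_idx_of_ne _ _ _ (by simp), g1.idx (B + 7) (by simp), e7]
          · rw [hblocks, hinv, ← g3, ← g4, ← g5, ← g6]
            rfl
      · simp only [Test.Holds, IExpr.eval, hr₄.lev, hσ₄.top]; omega
    refine (Runs.loop_step (Q := Q) (hrun hr₄) (step₃.mono le_rfl ?_)).mono (by rw [hcost])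
      (fun _ h => h)
    rintro σ₅ ⟨hF₅, hr₅, hside₅, ho₅, hinv₅⟩
    refine hQ σ₅ ((((hF₁.trans hF₂).trans hF₃).trans hF₄).trans hF₅) hr₅ ?_ ?_ ?_
    · intro j hj
      have : j ≠ k := by omega
      rw [hside₅, hside₄ j (by omega), hside₃, if_neg this, hside₂ j (by omega), hside₁, if_neg this]
    · have ho₁ : SameOutside (B + 3) N l l (s + s) σ σ₁ := SameOutside.of_eq (by rw [hv₁])
      exact (((ho₁.trans (ho₂.mono (by omega) (by omega) (by omega) (by omega))).trans
        (ho₃.mono (by omega) (by omega) (by omega) (by omega))).trans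
        (ho₄.mono (by omega) (by omega) (by omega) (by omega))).trans ho₅
    · rw [← hblocks, Matrix.inv_submatrix_equiv] at hinv₅
      ext i j
      obtain ⟨i, rfl⟩ := finSumFinEquiv.surjective i
      obtain ⟨j, rfl⟩ := finSumFinEquiv.surjective j
      exact congrFun (congrFun hinv₅ i) j

theorem Runs.inverseCmd {p : Cmd} {f : ℕ → ℕ} {B top : ℕ} (hp : Multiplies p f)
    (hpB : p.bound ≤ B) (hB : 7 ≤ B) {σ : State} (hσ : PowersStored B top σ)
    (hM : (σ.block (B + 3) (2 ^ top) 0 0 (2 ^ top)).PosDef) :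
    Runs (RealRAM.inverseCmd p B) σ (inverseTime f top + 100) fun σ' =>
      Frame (Set.Iio (B + 8)) (Set.Iio (B + 4)) σ σ' ∧
      σ'.block (B + 3) (2 ^ top) 0 0 (2 ^ top) = (σ.block (B + 3) (2 ^ top) 0 0 (2 ^ top))⁻¹ := by
  refine (Runs.seq (T := 10) (T' := 10 + (10 + (10 + (inverseTime f top + 60))))
    (Runs.setIdx (by simp [IExpr.cost])
    (Runs.seq (Runs.setIdx (by simp [IExpr.cost]) (Runs.seq (Runs.setIdx (by simp [IExpr.cost])
    (Runs.seq (Runs.setIdx (by simp [IExpr.cost]) ?_)))))))).mono (by omega) (fun _ h => h)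
  set τ := ((((σ.setIdx (B + 3) _ _).setIdx (B + 4) _ _).setIdx (B + 5) _ _).setIdx (B + 6) _ _)
    with hτ
  have hF : Frame (Set.Iio (B + 8)) (Set.Iio (B + 4)) σ τ :=
    ((((Frame.refl _ _ _).setIdx (by simp) _ _).setIdx (by simp) _ _).setIdx
      (by simp) _ _).setIdx (by simp) _ _
  have hr : RecursionAt B top 0 0 τ :=
    ⟨by simp [hτ, State.setIdx_idx, IExpr.eval, hσ.top],
      by simp [hτ, State.setIdx_idx, IExpr.eval],
      by simp [hτ, State.setIdx_idx, IExpr.eval], by simp [hτ, State.setIdx_idx, IExpr.eval]⟩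
  refine inverse_recursion hp hpB hB top τ 0 (hσ.frame hF (by omega)) le_rfl (by simp) hr hM _ _ ?_
  intro σ' hF' hr' _ _ hinv
  have htop : σ'.idx (B + 24) 0 = top := ((hσ.frame hF (by omega)).frame hF' (by omega)).top
  -- Going upwards at the top level, one more step merely clears the loop guard.
  refine (Runs.loop_step (T := 40) (T' := 4) (by simp [Test.Holds, IExpr.eval, hr'.run])
    ((Runs.ite (T := 30) (fun h => ?_) (fun _ => (Runs.ite (T := 20) (fun h => ?_) (fun _ =>
      Runs.setIdx (by simp [IExpr.cost]) ?_)).mono (by simp [Test.cost, IExpr.cost])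
      (fun _ h => h))).mono (by simp [Test.cost, IExpr.cost]) (fun _ h => h))).mono
    (by simp [Test.cost, IExpr.cost]) (fun _ h => h)
  · simp [Test.Holds, IExpr.eval, hr'.dir] at h
  · simp [Test.Holds, IExpr.eval, hr'.lev, htop] at h
  · refine (Runs.loop_done (by simp [Test.Holds, IExpr.eval, State.setIdx_idx]) ⟨(hF.trans hF').setIdx
      (by simp) _ _, ?_⟩).mono (by simp [Test.cost, IExpr.cost]) (fun _ h => h)
    exact hinv

end RealRAM

/-! ### The Cauchy–Binet formula -/

open Matrix in
-- Cauchy–Binet, summed over all maps instead of subsets: maps that are not injective contribute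
-- zero, and each subset is counted once per ordering, hence the factor `m!`. This form needs no
-- choice of orderings.
theorem Matrix.factorial_mul_det_mul {R : Type*} [CommRing R] {m n : ℕ}
    (A : Matrix (Fin m) (Fin n) R) (B : Matrix (Fin n) (Fin m) R) :
    (m.factorial : R) * (A * B).det =
      ∑ g : Fin m → Fin n, (A.submatrix id g).det * (B.submatrix g id).det := by
  have h1 : (A * B).det = ∑ g : Fin m → Fin n, (∏ i, A i (g i)) * (B.submatrix g id).det := by
    have : A * B = fun i => ∑ j, A i j • B j := by
      ext i k
      simp [Matrix.mul_apply]
    rw [this]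
    change detRowAlternating _ = _
    rw [← AlternatingMap.coe_multilinearMap, MultilinearMap.map_sum]
    refine Finset.sum_congr rfl fun g _ => ?_
    rw [MultilinearMap.map_smul_univ]
    rfl
  -- Multilinearity in the rows produced products of entries of `A` instead of minors. Reindexing
  -- `g` by a permutation changes the minor of `B` by a sign, and the average over all permutations
  -- assembles the minor of `A`.
  have h2 : ∀ σ : Equiv.Perm (Fin m), (A * B).det =
      ∑ g : Fin m → Fin n, (Equiv.Perm.sign σ : R) * (∏ i, A (σ i) (g i)) *
        (B.submatrix g id).det := by
    intro σ
    rw [h1, ← (Equiv.arrowCongr σ (Equiv.refl (Fin n))).sum_comp]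
    refine Finset.sum_congr rfl fun g _ => ?_
    have h3 : (B.submatrix ((Equiv.arrowCongr σ (Equiv.refl (Fin n))) g) id).det =
        (Equiv.Perm.sign σ : R) * (B.submatrix g id).det := by
      have := det_permute σ⁻¹ (B.submatrix g id)
      rw [Equiv.Perm.sign_inv] at this
      rw [← this]
      rfl
    rw [h3, ← Equiv.prod_comp σ]
    simp
    ring
  calc (m.factorial : R) * (A * B).det = ∑ _σ : Equiv.Perm (Fin m), (A * B).det := by
        simp [Fintype.card_perm]
    _ = ∑ σ : Equiv.Perm (Fin m), ∑ g : Fin m → Fin n, (Equiv.Perm.sign σ : R) *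
          (∏ i, A (σ i) (g i)) * (B.submatrix g id).det := Finset.sum_congr rfl fun σ _ => h2 σ
    _ = _ := by
        rw [Finset.sum_comm]
        refine Finset.sum_congr rfl fun g _ => ?_
        rw [det_apply' (A.submatrix id g), Finset.sum_mul]
        rfl

namespace Physarum

open Matrix

/-! ### Weighted projections -/

section

variable {m n : ℕ}

theorem abs_det_submatrix_le (A : Matrix (Fin m) (Fin n) ℤ) (g : Fin m → Fin n) :
    |((realMatrix A).submatrix id g).det| ≤ maxSubdet A := by
  have hcast : ((realMatrix A).submatrix id g).det = (((A.submatrix id g).det : ℤ) : ℝ) := by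
    rw [Int.cast_det]; rfl
  rw [hcast, ← Int.cast_abs, ← Int.natCast_natAbs]
  norm_cast
  by_cases hg : Function.Injective g
  · have hmn : m ≤ n := by simpa using Fintype.card_le_of_injective g hg
    refine le_trans ?_ (Finset.le_sup (f := fun k =>
      (Finset.univ : Finset ((Fin k ↪ Fin m) × (Fin k ↪ Fin n))).sup fun s =>
      (A.submatrix s.1 s.2).det.natAbs) (b := m) (by simp; omega))
    exact Finset.le_sup (f := fun s : (Fin m ↪ Fin m) × (Fin m ↪ Fin n) =>
      (A.submatrix s.1 s.2).det.natAbs) (b := (⟨id, Function.injective_id⟩, ⟨g, hg⟩))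
      (Finset.mem_univ _)
  · simp only [Function.Injective, not_forall] at hg
    obtain ⟨i, j, hij, hne⟩ := hg
    rw [det_zero_of_column_eq hne (by intro k; simp [hij])]
    simp

theorem one_le_maxSubdet (A : Matrix (Fin m) (Fin n) ℤ) : 1 ≤ maxSubdet A := by
  refine le_trans ?_ (Finset.le_sup (f := fun k =>
      (Finset.univ : Finset ((Fin k ↪ Fin m) × (Fin k ↪ Fin n))).sup fun s =>
      (A.submatrix s.1 s.2).det.natAbs) (b := 0) (by simp))
  refine le_trans ?_ (Finset.le_sup (f := fun s : (Fin 0 ↪ Fin m) × (Fin 0 ↪ Fin n) =>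
      (A.submatrix s.1 s.2).det.natAbs) (b := (Function.Embedding.ofIsEmpty,
        Function.Embedding.ofIsEmpty)) (Finset.mem_univ _))
  simp

/-- The weighted Laplacian `A W Aᵀ`. -/
noncomputable def laplacian (A : Matrix (Fin m) (Fin n) ℝ) (w : Fin n → ℝ) :
    Matrix (Fin m) (Fin m) ℝ := A * diagonal w * Aᵀ

/-- The matrix `Aᵀ (A W Aᵀ)⁻¹ A`. -/
noncomputable def response (A : Matrix (Fin m) (Fin n) ℝ) (w : Fin n → ℝ) :
    Matrix (Fin n) (Fin n) ℝ := Aᵀ * (laplacian A w)⁻¹ * A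

/-- The projection `Aᵀ (A W Aᵀ)⁻¹ A W`. -/
noncomputable def projection (A : Matrix (Fin m) (Fin n) ℝ) (w : Fin n → ℝ) :
    Matrix (Fin n) (Fin n) ℝ := response A w * diagonal w

theorem vecMul_injective_of_rank {A : Matrix (Fin m) (Fin n) ℝ} (hA : A.rank = m) :
    Function.Injective Aᵀ.mulVec := by
  rw [mulVec_injective_iff]
  have h := A.rank_eq_finrank_span_row
  rw [linearIndependent_iff_card_eq_finrank_span]
  rw [hA] at h
  rw [Fintype.card_fin]
  exact h

theorem laplacian_posDef {A : Matrix (Fin m) (Fin n) ℝ} (hA : A.rank = m) {w : Fin n → ℝ}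
    (hw : ∀ j, 0 < w j) : (laplacian A w).PosDef := by
  have h : (diagonal w).PosDef := (posDef_diagonal_iff).2 hw
  have := h.conjTranspose_mul_mul_same (B := Aᵀ) (vecMul_injective_of_rank hA)
  simpa [laplacian, conjTranspose_eq_transpose_of_trivial] using this

theorem mul_diagonal_mul_response {A : Matrix (Fin m) (Fin n) ℝ} (hA : A.rank = m) {w : Fin n → ℝ}
    (hw : ∀ j, 0 < w j) : A * diagonal w * response A w = A := by
  have h := (isUnit_iff_isUnit_det _).1 (laplacian_posDef hA hw).isUnit
  calc A * diagonal w * response A w = laplacian A w * (laplacian A w)⁻¹ * A := by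
        simp only [response, laplacian, Matrix.mul_assoc]
    _ = A := by rw [mul_nonsing_inv _ h, Matrix.one_mul]

/-- The weighted projections for all weights have the same range, the row space of `A`. This
identity and its transpose are the only facts used to compare the projections at two points. -/
theorem response_mul_diagonal_mul_response {A : Matrix (Fin m) (Fin n) ℝ} (hA : A.rank = m)
    (w : Fin n → ℝ) {w' : Fin n → ℝ} (hw' : ∀ j, 0 < w' j) :
    response A w * diagonal w' * response A w' = response A w := by
  calc response A w * diagonal w' * response A w' =
        Aᵀ * (laplacian A w)⁻¹ * (A * diagonal w' * response A w') := by
        simp only [response, Matrix.mul_assoc]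
    _ = response A w := by rw [mul_diagonal_mul_response hA hw', response]

theorem response_transpose (A : Matrix (Fin m) (Fin n) ℝ) (w : Fin n → ℝ) :
    (response A w)ᵀ = response A w := by
  have : (laplacian A w)ᵀ = laplacian A w := by simp [laplacian, Matrix.mul_assoc]
  simp [response, Matrix.mul_assoc, transpose_nonsing_inv, this]

theorem response_mul_diagonal_mul_response' {A : Matrix (Fin m) (Fin n) ℝ} (hA : A.rank = m)
    {w : Fin n → ℝ} (hw : ∀ j, 0 < w j) (w' : Fin n → ℝ) :
    response A w * diagonal w * response A w' = response A w' := by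
  have := congrArg transpose (response_mul_diagonal_mul_response hA w' hw)
  simpa [response_transpose, Matrix.mul_assoc] using this

theorem factorial_mul_det_laplacian (A : Matrix (Fin m) (Fin n) ℝ) (w : Fin n → ℝ) :
    (m.factorial : ℝ) * (laplacian A w).det =
      ∑ g : Fin m → Fin n, (∏ i, w (g i)) * (A.submatrix id g).det ^ 2 := by
  rw [laplacian, Matrix.mul_assoc, factorial_mul_det_mul]
  refine Finset.sum_congr rfl fun g _ => ?_
  have : (diagonal w * Aᵀ).submatrix g id = diagonal (fun i => w (g i)) * (A.submatrix id g)ᵀ := by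
    ext i j; simp [diagonal_mul]
  rw [this, det_mul, det_diagonal, det_transpose]
  ring

/-- Replacing column `k` of the right factor of `A W Aᵀ` by the sum of columns `k` and `j` is a rank
one update, which multiplies the determinant by one plus the entry `(j, k)` of the projection.
Expanding both determinants by Cauchy–Binet and subtracting writes the entry as a sum over pairs of
minors, each pair differing in one column. -/
theorem factorial_mul_det_mul_projection {A : Matrix (Fin m) (Fin n) ℝ} (hA : A.rank = m)
    {w : Fin n → ℝ} (hw : ∀ j, 0 < w j) {D : ℝ}
    (hD : ∀ g : Fin m → Fin n, |(A.submatrix id g).det| ≤ D) (j k : Fin n) :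
    |(m.factorial : ℝ) * (laplacian A w).det * projection A w j k| ≤
      ∑ g : Fin m → Fin n, (∏ i, w (g i)) * (|(A.submatrix id g).det| * D) := by
  have hL := (isUnit_iff_isUnit_det _).1 (laplacian_posDef hA hw).isUnit
  -- the rank one update of the Laplacian
  have h1 : (A * (diagonal w * (A.updateCol k (fun i => A i k + A i j))ᵀ)).det =
      (laplacian A w).det * (1 + projection A w j k) := by
    have h2 : A * (diagonal w * (A.updateCol k (fun i => A i k + A i j))ᵀ) =
        laplacian A w + replicateCol Unit (fun i => w k * A i k) *
          replicateRow Unit (fun i => A i j) := by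
      ext i i'
      simp only [laplacian, Matrix.mul_assoc, Matrix.add_apply, Matrix.mul_apply (M := A),
        diagonal_mul, transpose_apply, updateCol_apply]
      rw [← sub_eq_iff_eq_add', ← Finset.sum_sub_distrib, Finset.sum_eq_single k]
      · simp [Matrix.mul_apply]; ring
      · intro l _ hl; simp [hl]
      · simp
    rw [h2, det_add_replicateCol_mul_replicateRow hL]
    congr 1
    rw [det_unique]
    simp only [projection, response, Matrix.add_apply, one_apply_eq, mul_diagonal]
    congr 1
    simp only [Matrix.mul_apply, replicateRow_apply, replicateCol_apply, transpose_apply,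
      Finset.sum_mul]
    refine Finset.sum_congr rfl fun i _ => Finset.sum_congr rfl fun i' _ => by ring
  have h3 : (m.factorial : ℝ) * (laplacian A w).det * projection A w j k =
      ∑ g : Fin m → Fin n, (∏ i, w (g i)) * ((A.submatrix id g).det *
        (((A.updateCol k (fun i => A i k + A i j)).submatrix id g).det -
          (A.submatrix id g).det)) := by
    have h4 := factorial_mul_det_mul A (diagonal w * (A.updateCol k (fun i => A i k + A i j))ᵀ)
    rw [h1] at h4
    have h5 : (m.factorial : ℝ) * (laplacian A w).det * projection A w j k =
      (m.factorial : ℝ) * ((laplacian A w).det * (1 + projection A w j k)) -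
      (m.factorial : ℝ) * (laplacian A w).det := by ring
    rw [h5, h4, factorial_mul_det_laplacian, ← Finset.sum_sub_distrib]
    refine Finset.sum_congr rfl fun g _ => ?_
    have h6 : (diagonal w * (A.updateCol k (fun i => A i k + A i j))ᵀ).submatrix g id =
        diagonal (fun i => w (g i)) *
          ((A.updateCol k (fun i => A i k + A i j)).submatrix id g)ᵀ := by
      ext i j; simp [diagonal_mul]
    rw [h6, det_mul, det_diagonal, det_transpose]
    ring
  rw [h3]
  refine (Finset.abs_sum_le_sum_abs _ _).trans (Finset.sum_le_sum fun g _ => ?_)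
  have hwg : 0 ≤ ∏ i, w (g i) := Finset.prod_nonneg fun i _ => (hw _).le
  rw [abs_mul, abs_of_nonneg hwg, abs_mul]
  refine mul_le_mul_of_nonneg_left ?_ hwg
  -- If `g` hits `k`, linearity in that column leaves the minor with column `j` in place of `k`; if
  -- it misses `k`, the two minors agree; if it repeats an index, the first minor vanishes.
  by_cases hg : Function.Injective g
  · refine mul_le_mul_of_nonneg_left ?_ (abs_nonneg _)
    by_cases hk : ∃ i, g i = k
    · obtain ⟨i₀, hi₀⟩ := hk
      have h7 : (A.updateCol k (fun i => A i k + A i j)).submatrix id g =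
          (A.submatrix id g).updateCol i₀ ((fun i => A i k) + fun i => A i j) := by
        ext i i'
        by_cases h : i' = i₀
        · subst h; simp [updateCol_apply, hi₀]
        · have : g i' ≠ k := fun h' => h (hg (h'.trans hi₀.symm))
          simp [updateCol_apply, h, this]
      have h8 : (A.submatrix id g).updateCol i₀ (fun i => A i k) = A.submatrix id g := by
        ext i i'
        by_cases h : i' = i₀
        · subst h; simp [updateCol_apply, hi₀]
        · simp [updateCol_apply, h]
      have h9 : (A.submatrix id g).updateCol i₀ (fun i => A i j) =
          A.submatrix id (Function.update g i₀ j) := by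
        ext i i'
        by_cases h : i' = i₀
        · subst h; simp [updateCol_apply]
        · simp [updateCol_apply, h]
      rw [h7, det_updateCol_add, h8, h9, add_sub_cancel_left]
      exact hD _
    · push Not at hk
      have h7 : (A.updateCol k (fun i => A i k + A i j)).submatrix id g = A.submatrix id g := by
        ext i i'
        simp [updateCol_apply, hk i']
      rw [h7, sub_self, abs_zero]
      exact (abs_nonneg _).trans (hD g)
  · simp only [Function.Injective, not_forall] at hg
    obtain ⟨i, j, hij, hne⟩ := hg
    rw [det_zero_of_column_eq (M := A.submatrix id g) hne (by intro k; simp [hij])]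
    simp

/-- The entries of the weighted projections are bounded by the largest subdeterminant. -/
theorem abs_projection_le {A : Matrix (Fin m) (Fin n) ℤ} (hA : (realMatrix A).rank = m)
    {w : Fin n → ℝ} (hw : ∀ j, 0 < w j) (j k : Fin n) :
    |projection (realMatrix A) w j k| ≤ maxSubdet A := by
  have h := factorial_mul_det_mul_projection hA hw (abs_det_submatrix_le A) j k
  have hdet := (laplacian_posDef hA hw).det_pos
  have hpos : 0 < (m.factorial : ℝ) * (laplacian (realMatrix A) w).det := by positivity
  rw [abs_mul, abs_of_pos hpos] at h
  -- Integrality enters here: an integer satisfies `|d| ≤ d²`, so the sum of absolute minors is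
  -- bounded by the Cauchy–Binet sum for the Laplacian itself, and the weights cancel.
  have h2 : ∑ g : Fin m → Fin n, (∏ i, w (g i)) *
      (|((realMatrix A).submatrix id g).det| * (maxSubdet A : ℝ)) ≤
      (m.factorial : ℝ) * (laplacian (realMatrix A) w).det * maxSubdet A := by
    rw [factorial_mul_det_laplacian, Finset.sum_mul]
    refine Finset.sum_le_sum fun g _ => ?_
    rw [mul_assoc]
    refine mul_le_mul_of_nonneg_left ?_ (Finset.prod_nonneg fun i _ => (hw _).le)
    refine mul_le_mul_of_nonneg_right ?_ (Nat.cast_nonneg _)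
    have hcast : ((realMatrix A).submatrix id g).det = (((A.submatrix id g).det : ℤ) : ℝ) := by
      rw [Int.cast_det]; rfl
    rw [hcast, ← sq_abs, ← Int.cast_abs]
    norm_cast
    nlinarith [abs_nonneg (A.submatrix id g).det, Int.le_self_sq |(A.submatrix id g).det|]
  have h3 := h.trans h2
  exact le_of_mul_le_mul_left h3 hpos

end

end Physarum

namespace Physarum

/-! ### The truncated power series in relative coordinates -/

section

variable {n : ℕ}

/-- The nontrivial part of the Cauchy product of two sequences, in degree `k`. -/
noncomputable def convolution (x q : ℕ → Fin n → ℝ) (k : ℕ) : Fin n → ℝ :=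
  ∑ i ∈ Finset.range k, x (i + 1) * q (k - 1 - i)

/-- The coefficients of the power series of the solution with respect to the coordinates in which
the initial point is `1`. -/
structure IsTaylor (P : (Fin n → ℝ) →ₗ[ℝ] (Fin n → ℝ)) (γ q₀ : Fin n → ℝ) (h : ℝ)
    (x q : ℕ → Fin n → ℝ) : Prop where
  x_zero : x 0 = 1
  q_eq : ∀ k, q k = (if k = 0 then q₀ else 0) - P (convolution x q k)
  x_succ : ∀ k : ℕ, ((k : ℝ) + 1) • x (k + 1) = h • (γ * (convolution x q k + q k) - x k)

theorem sum_range_convolution {R : Type*} [AddCommMonoid R] (f : ℕ → ℕ → R) (m : ℕ) :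
    ∑ k ∈ Finset.range (m + 1), ∑ i ∈ Finset.range k, f i (k - 1 - i) =
      ∑ i ∈ Finset.range m, ∑ j ∈ Finset.range (m - i), f i j := by
  rw [Finset.sum_range_succ']
  simp only [Nat.add_sub_cancel, Finset.range_zero, Finset.sum_empty, add_zero]
  exact Finset.sum_range_diag_flip m f

theorem sum_range_convolution_le {u v : ℕ → ℝ} (hu : ∀ i, 0 ≤ u i) (hv : ∀ i, 0 ≤ v i) (m : ℕ) :
    ∑ k ∈ Finset.range (m + 1), ∑ i ∈ Finset.range k, u i * v (k - 1 - i) ≤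
      (∑ i ∈ Finset.range m, u i) * ∑ j ∈ Finset.range m, v j := by
  rw [sum_range_convolution (fun i j => u i * v j), Finset.sum_mul]
  refine Finset.sum_le_sum fun i _ => ?_
  rw [← Finset.mul_sum]
  refine mul_le_mul_of_nonneg_left ?_ (hu i)
  exact Finset.sum_le_sum_of_subset_of_nonneg (by intro; simp; omega) fun j _ _ => hv j

theorem norm_one_le : ‖(1 : Fin n → ℝ)‖ ≤ 1 := by
  rw [pi_norm_le_iff_of_nonneg zero_le_one]; simp

variable {P : (Fin n → ℝ) →ₗ[ℝ] (Fin n → ℝ)} {γ q₀ : Fin n → ℝ} {h α β : ℝ} {x q : ℕ → Fin n → ℝ}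

/-- The weights `2 ^ k` are multiplicative along the Cauchy product: degree `k` pairs `i + 1` with
`k - 1 - i`. -/
theorem convolution_weighted_le (x q : ℕ → Fin n → ℝ) (m : ℕ) :
    ∑ k ∈ Finset.range (m + 1), ‖convolution x q k‖ * 2 ^ k ≤
      (∑ k ∈ Finset.range m, ‖x (k + 1)‖ * 2 ^ (k + 1)) *
        ∑ k ∈ Finset.range m, ‖q k‖ * 2 ^ k := by
  refine le_trans ?_ (sum_range_convolution_le (u := fun k => ‖x (k + 1)‖ * 2 ^ (k + 1))
    (v := fun k => ‖q k‖ * 2 ^ k) (fun _ => by positivity) (fun _ => by positivity) m)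
  refine Finset.sum_le_sum fun k _ => ?_
  calc ‖convolution x q k‖ * 2 ^ k
      ≤ (∑ i ∈ Finset.range k, ‖x (i + 1)‖ * ‖q (k - 1 - i)‖) * 2 ^ k := by
        gcongr
        exact (norm_sum_le _ _).trans (Finset.sum_le_sum fun i _ => norm_mul_le _ _)
    _ = _ := by
        rw [Finset.sum_mul]
        refine Finset.sum_congr rfl fun i hi => ?_
        rw [Finset.mem_range] at hi
        have : (2 : ℝ) ^ k = 2 ^ (i + 1) * 2 ^ (k - 1 - i) := by
          rw [← pow_add]; congr 1; omega
        rw [this]; ring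

/-- A majorant argument at radius `2`, twice the length of the step. The product of the two partial
sums has an index shift, so the bounds up to `m` control all convolutions up to `m`, hence `q`
there, hence the next coefficient of `x`. -/
theorem IsTaylor.weighted_bounds (ht : IsTaylor P γ q₀ h x q) (hα : 1 ≤ α) (hβ : 1 ≤ β)
    (hh : 0 ≤ h) (hhab : 100 * h * α * β ≤ 1) (hγ : ‖γ‖ ≤ 1) (hP : ∀ v, ‖P v‖ ≤ α * ‖v‖)
    (hq₀ : ‖q₀‖ ≤ β) (m : ℕ) :
    ∑ k ∈ Finset.range m, ‖x (k + 1)‖ * 2 ^ (k + 1) ≤ 9 * h * β ∧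
      ∑ k ∈ Finset.range m, ‖q k‖ * 2 ^ k ≤ 2 * β := by
  have hhb : 0 ≤ h * β := by positivity
  induction m with
  | zero => simp; exact ⟨by positivity, by positivity⟩
  | succ m ih =>
    obtain ⟨hA, hB⟩ := ih
    set A := ∑ k ∈ Finset.range m, ‖x (k + 1)‖ * 2 ^ (k + 1) with hAdef
    set B := ∑ k ∈ Finset.range m, ‖q k‖ * 2 ^ k with hBdef
    have hA0 : 0 ≤ A := Finset.sum_nonneg fun _ _ => by positivity
    have hB0 : 0 ≤ B := Finset.sum_nonneg fun _ _ => by positivity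
    have hc := convolution_weighted_le x q m
    rw [← hAdef, ← hBdef] at hc
    have hAB : A * B ≤ 9 * h * β * (2 * β) := mul_le_mul hA hB hB0 (by positivity)
    -- `α * 9 h β * 2 β = 18 h α β * β`, and `h α β ≤ 1 / 100`.
    have hαAB : α * (A * B) ≤ 0.18 * β := by nlinarith
    have hAB' : A * B ≤ 0.18 * β := by nlinarith [mul_nonneg hA0 hB0]
    have hA' : A ≤ 0.09 := by nlinarith
    have hB' : ∑ k ∈ Finset.range (m + 1), ‖q k‖ * 2 ^ k ≤ 2 * β := by
      calc ∑ k ∈ Finset.range (m + 1), ‖q k‖ * 2 ^ k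
          ≤ ∑ k ∈ Finset.range (m + 1),
            ((if k = 0 then β else 0) + α * (‖convolution x q k‖ * 2 ^ k)) := by
            refine Finset.sum_le_sum fun k _ => ?_
            have h1 : ‖q k‖ ≤ (if k = 0 then β else 0) + α * ‖convolution x q k‖ := by
              rw [ht.q_eq k]
              refine (norm_sub_le _ _).trans (add_le_add ?_ (hP _))
              split_ifs <;> simp [hq₀]
            by_cases hk : k = 0
            · subst hk; simpa using h1
            · simp only [hk, if_false, zero_add] at h1 ⊢
              rw [← mul_assoc]
              exact mul_le_mul_of_nonneg_right h1 (by positivity)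
        _ ≤ β + α * (A * B) := by
            rw [Finset.sum_add_distrib, ← Finset.mul_sum]
            refine add_le_add ?_ (mul_le_mul_of_nonneg_left hc (by linarith))
            simp
        _ ≤ 2 * β := by linarith
    refine ⟨?_, hB'⟩
    calc ∑ k ∈ Finset.range (m + 1), ‖x (k + 1)‖ * 2 ^ (k + 1)
        ≤ ∑ k ∈ Finset.range (m + 1),
          2 * h * (‖convolution x q k‖ * 2 ^ k + ‖q k‖ * 2 ^ k + ‖x k‖ * 2 ^ k) := by
          refine Finset.sum_le_sum fun k _ => ?_
          have h1 : ‖x (k + 1)‖ ≤ h * (‖convolution x q k‖ + ‖q k‖ + ‖x k‖) := by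
            have h2 := congrArg norm (ht.x_succ k)
            rw [norm_smul, norm_smul, Real.norm_of_nonneg hh,
              Real.norm_of_nonneg (by positivity)] at h2
            calc ‖x (k + 1)‖ ≤ ((k : ℝ) + 1) * ‖x (k + 1)‖ := by
                  have : (0 : ℝ) ≤ k := Nat.cast_nonneg k
                  nlinarith [norm_nonneg (x (k + 1))]
              _ = _ := h2
              _ ≤ _ := by
                  refine mul_le_mul_of_nonneg_left ((norm_sub_le _ _).trans ?_) hh
                  refine add_le_add ?_ le_rfl
                  calc _ ≤ ‖γ‖ * ‖convolution x q k + q k‖ := norm_mul_le _ _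
                    _ ≤ 1 * (‖convolution x q k‖ + ‖q k‖) :=
                      mul_le_mul hγ (norm_add_le _ _) (norm_nonneg _) zero_le_one
                    _ = _ := one_mul _
          rw [pow_succ]
          have : (0 : ℝ) < 2 ^ k := by positivity
          nlinarith
      _ ≤ 2 * h * (A * B + 2 * β + (1 + A)) := by
          rw [← Finset.mul_sum, Finset.sum_add_distrib, Finset.sum_add_distrib]
          refine mul_le_mul_of_nonneg_left (add_le_add (add_le_add hc hB') ?_) (by positivity)
          rw [Finset.sum_range_succ', ht.x_zero, add_comm]
          have := norm_one_le (n := n)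
          simp only [pow_zero, mul_one]
          exact add_le_add this le_rfl
      _ ≤ 2 * h * (0.18 * β + 2 * β + (β + 0.09 * β)) := by
          refine mul_le_mul_of_nonneg_left ?_ (by positivity)
          nlinarith
      _ ≤ 9 * h * β := by nlinarith

/-- The partial sum of a power series. -/
noncomputable def partialSum (x : ℕ → Fin n → ℝ) (m : ℕ) (s : ℝ) : Fin n → ℝ :=
  ∑ k ∈ Finset.range m, s ^ k • x k

theorem hasDerivAt_partialSum (x : ℕ → Fin n → ℝ) (m : ℕ) (s : ℝ) :
    HasDerivAt (partialSum x (m + 1))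
      (∑ k ∈ Finset.range m, s ^ k • (((k : ℝ) + 1) • x (k + 1))) s := by
  have h1 : ∀ k ∈ Finset.range (m + 1),
      HasDerivAt (fun s : ℝ => s ^ k • x k) (((k : ℝ) * s ^ (k - 1)) • x k) s :=
    fun k _ => (hasDerivAt_pow k s).smul_const (x k)
  have h2 := HasDerivAt.fun_sum h1
  rw [Finset.sum_range_succ'] at h2
  simp only [Nat.cast_zero, zero_mul, zero_smul, add_zero, Nat.add_sub_cancel] at h2
  refine h2.congr_deriv (Finset.sum_congr rfl fun k _ => ?_)
  rw [smul_smul]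
  push_cast
  ring_nf

/-- What the truncation leaves over in the products. -/
noncomputable def truncationError (x q : ℕ → Fin n → ℝ) (m : ℕ) (s : ℝ) : Fin n → ℝ :=
  (partialSum x (m + 1) s - 1) * partialSum q m s -
    ∑ k ∈ Finset.range m, s ^ k • convolution x q k

/-- The product of the truncated series differs from the truncated product by terms of degree at
least `m` only. For these `s ^ d ≤ 1 ≤ (1 / 2) ^ m * 2 ^ d`, which turns the weighted sums into a
geometrically small error. -/
theorem norm_truncationError_le (hx : x 0 = 1) {m : ℕ} (hm : 1 ≤ m) {s : ℝ} (hs : 0 ≤ s)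
    (hs1 : s ≤ 1) : ‖truncationError x q m s‖ ≤
      (1 / 2) ^ m * ((∑ k ∈ Finset.range m, ‖x (k + 1)‖ * 2 ^ (k + 1)) *
        ∑ k ∈ Finset.range m, ‖q k‖ * 2 ^ k) := by
  obtain ⟨M, rfl⟩ : ∃ M, m = M + 1 := ⟨m - 1, by omega⟩
  have h1 : partialSum x (M + 1 + 1) s - 1 = ∑ i ∈ Finset.range (M + 1), s ^ (i + 1) • x (i + 1) := by
    rw [partialSum, Finset.sum_range_succ']
    simp [hx]
  have h2 : ∑ k ∈ Finset.range (M + 1), s ^ k • convolution x q k =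
      ∑ i ∈ Finset.range (M + 1), ∑ j ∈ Finset.range (M - i),
        (s ^ (i + 1) • x (i + 1)) * (s ^ j • q j) := by
    rw [Finset.sum_range_succ (fun i => ∑ j ∈ Finset.range (M - i),
      (s ^ (i + 1) • x (i + 1)) * (s ^ j • q j)), Nat.sub_self, Finset.range_zero,
      Finset.sum_empty, add_zero,
      ← sum_range_convolution (fun i j => (s ^ (i + 1) • x (i + 1)) * (s ^ j • q j))]
    refine Finset.sum_congr rfl fun k _ => ?_
    rw [convolution, Finset.smul_sum]
    refine Finset.sum_congr rfl fun i hi => ?_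
    rw [Finset.mem_range] at hi
    rw [smul_mul_smul_comm, ← pow_add]
    congr 2
    omega
  have h3 : truncationError x q (M + 1) s = ∑ i ∈ Finset.range (M + 1),
      ∑ j ∈ Finset.Ico (M - i) (M + 1), (s ^ (i + 1) • x (i + 1)) * (s ^ j • q j) := by
    rw [truncationError, h1, h2, partialSum, Finset.sum_mul, ← Finset.sum_sub_distrib]
    refine Finset.sum_congr rfl fun i _ => ?_
    rw [Finset.mul_sum, Finset.sum_Ico_eq_sub _ (by omega)]
  rw [h3, Finset.sum_mul, Finset.mul_sum]
  refine (norm_sum_le _ _).trans (Finset.sum_le_sum fun i _ => ?_)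
  refine (norm_sum_le _ _).trans ?_
  rw [Finset.mul_sum, Finset.mul_sum]
  refine (Finset.sum_le_sum fun j hj => ?_).trans
    (Finset.sum_le_sum_of_subset_of_nonneg (s := Finset.Ico (M - i) (M + 1))
      (by intro; simp) fun j _ _ => by positivity)
  rw [Finset.mem_Ico] at hj
  rw [smul_mul_smul_comm, norm_smul, ← pow_add, Real.norm_of_nonneg (by positivity)]
  have h4 : s ^ (i + 1 + j) ≤ (1 / 2) ^ (M + 1) * 2 ^ (i + 1) * 2 ^ j := by
    have h5 : (1 : ℝ) ≤ (1 / 2) ^ (M + 1) * 2 ^ (i + 1 + j) := by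
      rw [one_div, inv_pow, inv_mul_eq_div, one_le_div (by positivity)]
      exact pow_le_pow_right₀ (by norm_num) (by omega)
    rw [mul_assoc, ← pow_add]
    exact (pow_le_one₀ hs hs1).trans h5
  calc s ^ (i + 1 + j) * ‖x (i + 1) * q j‖
      ≤ ((1 / 2) ^ (M + 1) * 2 ^ (i + 1) * 2 ^ j) * (‖x (i + 1)‖ * ‖q j‖) :=
        mul_le_mul h4 (norm_mul_le _ _) (norm_nonneg _) (by positivity)
    _ = _ := by ring

/-- The truncated flow satisfies the exact fixed point equation up to a defect; likewise for the
differential equation in `IsTaylor.hasDerivAt`, where the top term of the series is a second defect.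
-/
theorem IsTaylor.partialSum_q (ht : IsTaylor P γ q₀ h x q) {m : ℕ} (hm : 1 ≤ m) (s : ℝ) :
    partialSum q m s = q₀ -
      P ((partialSum x (m + 1) s - 1) * partialSum q m s - truncationError x q m s) := by
  rw [truncationError, sub_sub_cancel, map_sum]
  simp only [map_smul]
  rw [partialSum]
  have h1 : ∀ k ∈ Finset.range m, s ^ k • q k =
      (if k = 0 then q₀ else 0) - s ^ k • P (convolution x q k) := by
    intro k _
    rw [ht.q_eq k, smul_sub]
    by_cases hk : k = 0 <;> simp [hk]
  rw [Finset.sum_congr rfl h1, Finset.sum_sub_distrib]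
  congr 1
  rw [Finset.sum_ite_eq' (Finset.range m) 0, if_pos (Finset.mem_range.2 hm)]

theorem IsTaylor.hasDerivAt (ht : IsTaylor P γ q₀ h x q) (m : ℕ) (s : ℝ) :
    HasDerivAt (partialSum x (m + 1))
      (h • (γ * (partialSum x (m + 1) s * partialSum q m s - truncationError x q m s) -
        (partialSum x (m + 1) s - s ^ m • x m))) s := by
  refine (hasDerivAt_partialSum x m s).congr_deriv ?_
  have h1 : partialSum x (m + 1) s * partialSum q m s - truncationError x q m s =
      ∑ k ∈ Finset.range m, s ^ k • convolution x q k + partialSum q m s := by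
    rw [truncationError]; ring
  have h2 : partialSum x (m + 1) s - s ^ m • x m = ∑ k ∈ Finset.range m, s ^ k • x k := by
    rw [partialSum, Finset.sum_range_succ]; abel
  rw [h1, h2, partialSum, ← Finset.sum_add_distrib, Finset.mul_sum, ← Finset.sum_sub_distrib,
    Finset.smul_sum]
  refine Finset.sum_congr rfl fun k _ => ?_
  rw [ht.x_succ k, smul_comm, smul_sub, ← smul_add, mul_smul_comm]

theorem norm_partialSum_sub_one_le (hx : x 0 = 1) (m : ℕ) {s : ℝ} (hs : 0 ≤ s) (hs1 : s ≤ 1) :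
    ‖partialSum x (m + 1) s - 1‖ ≤ ∑ k ∈ Finset.range m, ‖x (k + 1)‖ * 2 ^ (k + 1) := by
  rw [partialSum, Finset.sum_range_succ']
  simp only [pow_zero, hx, one_smul, add_sub_cancel_right]
  refine (norm_sum_le _ _).trans (Finset.sum_le_sum fun k _ => ?_)
  rw [norm_smul, Real.norm_of_nonneg (by positivity), mul_comm]
  refine mul_le_mul_of_nonneg_left ?_ (norm_nonneg _)
  exact (pow_le_one₀ hs hs1).trans (one_le_pow₀ (by norm_num))

theorem norm_partialSum_le (q : ℕ → Fin n → ℝ) (m : ℕ) {s : ℝ} (hs : 0 ≤ s) (hs1 : s ≤ 1) :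
    ‖partialSum q m s‖ ≤ ∑ k ∈ Finset.range m, ‖q k‖ * 2 ^ k := by
  refine (norm_sum_le _ _).trans (Finset.sum_le_sum fun k _ => ?_)
  rw [norm_smul, Real.norm_of_nonneg (by positivity), mul_comm]
  refine mul_le_mul_of_nonneg_left ?_ (norm_nonneg _)
  exact (pow_le_one₀ hs hs1).trans (one_le_pow₀ (by norm_num))

end

end Physarum

namespace Physarum

/-! ### The error of one step -/

section

variable {n : ℕ} {P : (Fin n → ℝ) →ₗ[ℝ] (Fin n → ℝ)} {γ q₀ : Fin n → ℝ} {h α β : ℝ}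
  {x q : ℕ → Fin n → ℝ}

/-- The solution of the dynamics, in coordinates relative to a point nearby. -/
structure IsRelativeSolution (P : (Fin n → ℝ) →ₗ[ℝ] (Fin n → ℝ)) (γ q₀ : Fin n → ℝ) (h : ℝ)
    (z p : ℝ → Fin n → ℝ) : Prop where
  p_eq : ∀ s ∈ Set.Icc (0 : ℝ) 1, p s = q₀ - P ((z s - 1) * p s)
  deriv : ∀ s ∈ Set.Icc (0 : ℝ) 1,
    HasDerivWithinAt z (h • (z s * (γ * p s - 1))) (Set.Icc 0 1) s

/-- Near the base point the fixed point equation is a contraction with factor `1 / 2`, so the flow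
is at most twice its inhomogeneous term. -/
theorem norm_flow_le (hα : 1 ≤ α) (hP : ∀ v, ‖P v‖ ≤ α * ‖v‖) (hq₀ : ‖q₀‖ ≤ β)
    {z p : Fin n → ℝ} (hp : p = q₀ - P ((z - 1) * p)) (hz : α * ‖z - 1‖ ≤ 1 / 2) :
    ‖p‖ ≤ 2 * β := by
  have h1 : ‖p‖ ≤ β + α * (‖z - 1‖ * ‖p‖) := by
    calc ‖p‖ = ‖q₀ - P ((z - 1) * p)‖ := congrArg norm hp
      _ ≤ ‖q₀‖ + ‖P ((z - 1) * p)‖ := norm_sub_le _ _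
      _ ≤ β + α * (‖z - 1‖ * ‖p‖) := by
        refine add_le_add hq₀ ((hP _).trans ?_)
        exact mul_le_mul_of_nonneg_left (norm_mul_le _ _) (by linarith)
  nlinarith [norm_nonneg p]

theorem hasDerivWithinAt_Ici {z : ℝ → Fin n → ℝ} {z' : Fin n → ℝ} {s : ℝ}
    (hs : s ∈ Set.Ico (0 : ℝ) 1) (hz : HasDerivWithinAt z z' (Set.Icc 0 1) s) :
    HasDerivWithinAt z z' (Set.Ici s) s := by
  refine hz.mono_of_mem_nhdsWithin ?_
  exact Filter.mem_of_superset (Icc_mem_nhdsGE hs.2) (Set.Icc_subset_Icc_left hs.1)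

/-- A continuity argument: up to the first time at which `α ‖z - 1‖` reaches `1 / 2` the flow is
bounded, so the speed is too small for the distance to have grown from `1 / 4` to `1 / 2`. -/
theorem IsRelativeSolution.norm_sub_one_le {z p : ℝ → Fin n → ℝ}
    (hz : IsRelativeSolution P γ q₀ h z p) (hα : 1 ≤ α) (hβ : 1 ≤ β)
    (hh : 0 ≤ h) (hhab : 100 * h * α * β ≤ 1) (hγ : ‖γ‖ ≤ 1) (hP : ∀ v, ‖P v‖ ≤ α * ‖v‖)
    (hq₀ : ‖q₀‖ ≤ β) (h0 : 4 * α * ‖z 0 - 1‖ ≤ 1) :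
    ∀ s ∈ Set.Icc (0 : ℝ) 1, α * ‖z s - 1‖ ≤ 1 / 2 := by
  have hα0 : 0 < α := by linarith
  have hcont : ContinuousOn z (Set.Icc 0 1) := fun s hs => (hz.deriv s hs).continuousWithinAt
  have hcont' : ContinuousOn (fun s => α * ‖z s - 1‖) (Set.Icc 0 1) :=
    continuousOn_const.mul (hcont.sub continuousOn_const).norm
  by_contra! hne
  obtain ⟨s₁, hs₁, hs₁'⟩ := hne
  have hclosed : IsClosed (Set.Icc (0 : ℝ) 1 ∩ (fun s => α * ‖z s - 1‖) ⁻¹' Set.Ici (1 / 2)) :=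
    hcont'.preimage_isClosed_of_isClosed isClosed_Icc isClosed_Ici
  have hcompact : IsCompact (Set.Icc (0 : ℝ) 1 ∩ (fun s => α * ‖z s - 1‖) ⁻¹' Set.Ici (1 / 2)) :=
    isCompact_Icc.of_isClosed_subset hclosed Set.inter_subset_left
  obtain ⟨τ, ⟨hτ, hτ'⟩, hmin⟩ := hcompact.exists_isLeast ⟨s₁, hs₁, hs₁'.le⟩
  have hbefore : ∀ s ∈ Set.Ico 0 τ, α * ‖z s - 1‖ ≤ 1 / 2 := by
    intro s hs
    by_contra! hs'
    have := hmin ⟨⟨hs.1, hs.2.le.trans hτ.2⟩, hs'.le⟩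
    exact absurd hs.2 (not_lt.2 this)
  -- The speed is at most `h * 1.5 * 3 β = 4.5 h β`, and `100 h α β ≤ 1` makes this less than `1 /
  -- (20 α)`. With `K = 0` the Grönwall bound is the mean value inequality.
  have hbound := norm_le_gronwallBound_of_norm_deriv_right_le (f := fun s => z s - 1)
    (f' := fun s => h • (z s * (γ * p s - 1))) (δ := 1 / (4 * α)) (K := 0) (ε := 1 / (20 * α))
    (a := 0) (b := τ) ((hcont.mono (Set.Icc_subset_Icc_right hτ.2)).sub continuousOn_const)
    (fun s hs => ((hasDerivWithinAt_Ici ⟨hs.1, hs.2.trans_le hτ.2⟩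
      (hz.deriv s ⟨hs.1, hs.2.le.trans hτ.2⟩))).sub_const _)
    (by rw [le_div_iff₀ (by positivity)]; linarith) ?_ τ ⟨hτ.1, le_rfl⟩
  · rw [gronwallBound_K0] at hbound
    have h1 : 1 / 2 ≤ α * ‖z τ - 1‖ := hτ'
    have h2 : α * (1 / (4 * α) + 1 / (20 * α) * (τ - 0)) = 1 / 4 + τ / 20 := by field_simp; ring
    have h3 := mul_le_mul_of_nonneg_left hbound hα0.le
    rw [h2] at h3
    linarith [hτ.2]
  · intro s hs
    have hs' := hbefore s hs
    have hp := norm_flow_le hα hP hq₀ (hz.p_eq s ⟨hs.1, hs.2.le.trans hτ.2⟩) hs'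
    rw [zero_mul, zero_add, norm_smul, Real.norm_of_nonneg hh, le_div_iff₀ (by positivity)]
    have hz1 : ‖z s‖ ≤ 1.5 := by
      have h5 : ‖z s - 1‖ ≤ 1 / 2 := by nlinarith [norm_nonneg (z s - 1)]
      calc ‖z s‖ = ‖(z s - 1) + 1‖ := by rw [sub_add_cancel]
        _ ≤ ‖z s - 1‖ + 1 := (norm_add_le _ _).trans (add_le_add le_rfl norm_one_le)
        _ ≤ 1.5 := by linarith
    have hp1 : ‖γ * p s - 1‖ ≤ 3 * β := by
      calc ‖γ * p s - 1‖ ≤ ‖γ‖ * ‖p s‖ + 1 :=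
            (norm_sub_le _ _).trans (add_le_add (norm_mul_le _ _) norm_one_le)
        _ ≤ 1 * (2 * β) + 1 := by gcongr
        _ ≤ 3 * β := by linarith
    have h6 : ‖z s * (γ * p s - 1)‖ ≤ 1.5 * (3 * β) :=
      (norm_mul_le _ _).trans (mul_le_mul hz1 hp1 (norm_nonneg _) (by norm_num))
    have h7 : h * ‖z s * (γ * p s - 1)‖ * (20 * α) ≤ h * (1.5 * (3 * β)) * (20 * α) := by gcongr
    linarith

theorem exp_tenth_le : Real.exp 0.1 ≤ 1.12 := by
  have := Real.exp_bound_div_one_sub_of_interval (x := 0.1) (by norm_num) (by norm_num)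
  refine this.trans ?_
  norm_num

/-- One step of the Taylor method. -/
theorem IsTaylor.step (ht : IsTaylor P γ q₀ h x q) (hα : 1 ≤ α) (hβ : 1 ≤ β)
    (hh : 0 ≤ h) (hhab : 100 * h * α * β ≤ 1) (hγ : ‖γ‖ ≤ 1) (hP : ∀ v, ‖P v‖ ≤ α * ‖v‖)
    (hq₀ : ‖q₀‖ ≤ β) {m : ℕ} (hm : 1 ≤ m) {z p : ℝ → Fin n → ℝ}
    (hz : IsRelativeSolution P γ q₀ h z p) (h0 : 4 * α * ‖z 0 - 1‖ ≤ 1) :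
    α * ‖∑ k ∈ Finset.range (m + 1), x k - 1‖ ≤ 0.09 ∧
      ‖z 1 - ∑ k ∈ Finset.range (m + 1), x k‖ ≤ 1.2 * ‖z 0 - 1‖ + 0.2 * (1 / 2) ^ m := by
  have hα0 : 0 < α := by linarith
  obtain ⟨hA, hB⟩ := ht.weighted_bounds hα hβ hh hhab hγ hP hq₀ m
  have hregion := hz.norm_sub_one_le hα hβ hh hhab hγ hP hq₀ h0
  have hone : ∑ k ∈ Finset.range (m + 1), x k = partialSum x (m + 1) 1 := by
    simp [partialSum]
  have hβh : 0 ≤ h * β := by positivity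
  have hpos : (0 : ℝ) < (1 / 2) ^ m := by positivity
  have hx1 : ∀ s ∈ Set.Icc (0 : ℝ) 1, α * ‖partialSum x (m + 1) s - 1‖ ≤ 0.09 := by
    intro s hs
    have := (norm_partialSum_sub_one_le ht.x_zero m hs.1 hs.2).trans hA
    nlinarith
  -- The last coefficient is a single term of the weighted sum.
  have hxm : ‖x m‖ ≤ 0.09 * (1 / 2) ^ m := by
    have h1 : ‖x m‖ * 2 ^ m ≤ 9 * h * β := by
      refine le_trans ?_ hA
      obtain ⟨M, rfl⟩ : ∃ M, m = M + 1 := ⟨m - 1, by omega⟩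
      exact Finset.single_le_sum (f := fun k => ‖x (k + 1)‖ * 2 ^ (k + 1))
        (fun _ _ => by positivity) (Finset.mem_range.2 (Nat.lt_succ_self M))
    have h2 : ‖x m‖ = ‖x m‖ * 2 ^ m * (1 / 2) ^ m := by
      rw [mul_assoc, ← mul_pow]; norm_num
    rw [h2]
    refine mul_le_mul_of_nonneg_right (h1.trans ?_) hpos.le
    nlinarith
  refine ⟨by rw [hone]; exact hx1 1 ⟨zero_le_one, le_rfl⟩, ?_⟩
  have hτ : ∀ s ∈ Set.Icc (0 : ℝ) 1,
      α * ‖truncationError x q m s‖ ≤ 0.18 * β * (1 / 2) ^ m := by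
    intro s hs
    have h1 := norm_truncationError_le (q := q) ht.x_zero hm hs.1 hs.2
    have h2 : (∑ k ∈ Finset.range m, ‖x (k + 1)‖ * 2 ^ (k + 1)) *
        ∑ k ∈ Finset.range m, ‖q k‖ * 2 ^ k ≤ 9 * h * β * (2 * β) :=
      mul_le_mul hA hB (Finset.sum_nonneg fun _ _ => by positivity) (by positivity)
    calc α * ‖truncationError x q m s‖ ≤ α * ((1 / 2) ^ m * (9 * h * β * (2 * β))) :=
          mul_le_mul_of_nonneg_left (h1.trans (mul_le_mul_of_nonneg_left h2 hpos.le)) hα0.le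
      _ = 0.18 * (100 * h * α * β) * β * (1 / 2) ^ m := by ring
      _ ≤ 0.18 * 1 * β * (1 / 2) ^ m := by gcongr
      _ = _ := by ring
  -- The difference satisfies an inequality with Lipschitz constant `0.1` and defect `0.1 * (1 / 2)
  -- ^ m`. Over unit time this gives the factor `exp 0.1 ≤ 1.12` for the initial error and `exp 0.1
  -- - 1 ≤ 0.12` for `(1 / 2) ^ m`.
  have hgron := norm_le_gronwallBound_of_norm_deriv_right_le
    (f := fun s => z s - partialSum x (m + 1) s)
    (f' := fun s => h • (z s * (γ * p s - 1)) - h • (γ * (partialSum x (m + 1) s *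
      partialSum q m s - truncationError x q m s) - (partialSum x (m + 1) s - s ^ m • x m)))
    (δ := ‖z 0 - 1‖) (K := 0.1) (ε := 0.1 * (1 / 2) ^ m) (a := 0) (b := 1)
    ?_ ?_ ?_ ?_ 1 ⟨zero_le_one, le_rfl⟩
  · rw [hone]
    refine hgron.trans ?_
    rw [gronwallBound_of_K_ne_0 (by norm_num)]
    simp only [sub_zero, mul_one]
    have he := exp_tenth_le
    rw [mul_div_cancel_left₀ _ (by norm_num)]
    nlinarith [norm_nonneg (z 0 - 1)]
  · exact ContinuousOn.sub (fun s hs => (hz.deriv s hs).continuousWithinAt)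
      (fun s _ => (ht.hasDerivAt m s).continuousAt.continuousWithinAt)
  · intro s hs
    exact (hasDerivWithinAt_Ici hs (hz.deriv s ⟨hs.1, hs.2.le⟩)).sub
      (ht.hasDerivAt m s).hasDerivWithinAt
  · have : partialSum x (m + 1) 0 = 1 := by
      rw [partialSum, Finset.sum_range_succ']
      simp [ht.x_zero]
    rw [this]
  · intro s hs
    have hs' : s ∈ Set.Icc (0 : ℝ) 1 := ⟨hs.1, hs.2.le⟩
    have hzr := hregion s hs'
    have hxr := hx1 s hs'
    have hτs := hτ s hs'
    have hqs := (norm_partialSum_le q m hs'.1 hs'.2).trans hB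
    have hps := hz.p_eq s hs'
    have hqe := ht.partialSum_q hm s
    set X := partialSum x (m + 1) s
    set Y := partialSum q m s
    set τ := truncationError x q m s
    -- Subtracting the two fixed point equations leaves a term `(z - 1) (p - Y)` under `P`, which is
    -- half absorbed on the left; this doubles the other terms.
    have hpY : ‖p s - Y‖ ≤ 4 * α * β * ‖z s - X‖ + 2 * (α * ‖τ‖) := by
      have h1 : p s - Y = -P ((z s - 1) * (p s - Y) + (z s - X) * Y + τ) := by
        have h2 : p s - Y = (q₀ - P ((z s - 1) * p s)) - (q₀ - P ((X - 1) * Y - τ)) := by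
          rw [← hps, ← hqe]
        rw [h2, ← neg_eq_iff_eq_neg, neg_sub, sub_sub_sub_cancel_left, ← map_sub]
        congr 1
        rw [← h2]
        ring
      have h3 : ‖p s - Y‖ ≤ α * (‖z s - 1‖ * ‖p s - Y‖ + ‖z s - X‖ * ‖Y‖ + ‖τ‖) := by
        calc ‖p s - Y‖ = ‖P ((z s - 1) * (p s - Y) + (z s - X) * Y + τ)‖ := by
              conv_lhs => rw [h1, norm_neg]
          _ ≤ _ := (hP _).trans (mul_le_mul_of_nonneg_left ((norm_add_le _ _).trans
              (add_le_add ((norm_add_le _ _).trans (add_le_add (norm_mul_le _ _)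
              (norm_mul_le _ _))) le_rfl)) hα0.le)
      have h4 : α * ‖z s - 1‖ * ‖p s - Y‖ ≤ 1 / 2 * ‖p s - Y‖ :=
        mul_le_mul_of_nonneg_right hzr (norm_nonneg _)
      have h5 : α * (‖z s - X‖ * ‖Y‖) ≤ α * (‖z s - X‖ * (2 * β)) := by gcongr
      linarith
    have hz1 : ‖z s‖ ≤ 1.5 := by
      have h5 : ‖z s - 1‖ ≤ 1 / 2 := by nlinarith [norm_nonneg (z s - 1)]
      calc ‖z s‖ = ‖(z s - 1) + 1‖ := by rw [sub_add_cancel]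
        _ ≤ ‖z s - 1‖ + 1 := (norm_add_le _ _).trans (add_le_add le_rfl norm_one_le)
        _ ≤ 1.5 := by linarith
    have hform : z s * (γ * p s - 1) - (γ * (X * Y - τ) - (X - s ^ m • x m)) =
        (z s - X) * (γ * Y - 1) + z s * (γ * (p s - Y)) + γ * τ - s ^ m • x m := by ring
    rw [← smul_sub, hform, norm_smul, Real.norm_of_nonneg hh]
    have hγY : ‖γ * Y - 1‖ ≤ 3 * β := by
      calc ‖γ * Y - 1‖ ≤ ‖γ‖ * ‖Y‖ + 1 :=
            (norm_sub_le _ _).trans (add_le_add (norm_mul_le _ _) norm_one_le)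
        _ ≤ 1 * (2 * β) + 1 := by gcongr
        _ ≤ 3 * β := by linarith
    have hγ1 : ∀ v : Fin n → ℝ, ‖γ * v‖ ≤ ‖v‖ := fun v =>
      (norm_mul_le _ _).trans (mul_le_of_le_one_left (norm_nonneg _) hγ)
    have hsx : ‖s ^ m • x m‖ ≤ 0.09 * (1 / 2) ^ m := by
      rw [norm_smul, Real.norm_of_nonneg (pow_nonneg hs'.1 _)]
      exact (mul_le_of_le_one_left (norm_nonneg _) (pow_le_one₀ hs'.1 hs'.2)).trans hxm
    have hτ1 : ‖τ‖ ≤ α * ‖τ‖ := le_mul_of_one_le_left (norm_nonneg _) hα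
    calc h * ‖(z s - X) * (γ * Y - 1) + z s * (γ * (p s - Y)) + γ * τ - s ^ m • x m‖
        ≤ h * (‖z s - X‖ * (3 * β) + 1.5 * (4 * α * β * ‖z s - X‖ + 2 * (α * ‖τ‖)) + α * ‖τ‖ +
          0.09 * (1 / 2) ^ m) := by
          refine mul_le_mul_of_nonneg_left ((norm_sub_le _ _).trans (add_le_add
            ((norm_add_le _ _).trans (add_le_add ((norm_add_le _ _).trans (add_le_add ?_ ?_)) ?_))
            hsx)) hh
          · exact (norm_mul_le _ _).trans (mul_le_mul_of_nonneg_left hγY (norm_nonneg _))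
          · exact (norm_mul_le _ _).trans (mul_le_mul hz1 ((hγ1 _).trans hpY) (norm_nonneg _)
              (by norm_num))
          · exact (hγ1 _).trans hτ1
      _ ≤ h * (‖z s - X‖ * (3 * (α * β)) + 6 * (α * β) * ‖z s - X‖ +
          4 * (0.18 * (α * β) * (1 / 2) ^ m) + 0.09 * (α * β) * (1 / 2) ^ m) := by
          have e1 : β ≤ α * β := le_mul_of_one_le_left (by linarith) hα
          have e2 : 1 ≤ α * β := by nlinarith
          have e3 : ‖z s - X‖ * (3 * β) ≤ ‖z s - X‖ * (3 * (α * β)) := by gcongr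
          have e4 : 0.18 * β * (1 / 2 : ℝ) ^ m ≤ 0.18 * (α * β) * (1 / 2) ^ m := by gcongr
          have e5 : 0.09 * 1 * (1 / 2 : ℝ) ^ m ≤ 0.09 * (α * β) * (1 / 2) ^ m := by gcongr
          refine mul_le_mul_of_nonneg_left ?_ hh
          linarith
      _ = (100 * h * α * β) * (0.09 * ‖z s - X‖ + 0.0081 * (1 / 2) ^ m) := by ring
      _ ≤ 1 * (0.09 * ‖z s - X‖ + 0.0081 * (1 / 2) ^ m) := by gcongr
      _ ≤ 0.1 * ‖z s - X‖ + 0.1 * (1 / 2) ^ m := by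
          nlinarith [norm_nonneg (z s - X)]

end

end Physarum

/-! ### Existence of the Taylor coefficients -/

namespace Physarum

open Matrix

section

variable {m n : ℕ}

/-- The coefficients of the power series can be computed one after the other. -/
noncomputable def taylorCoeff (P : (Fin n → ℝ) →ₗ[ℝ] (Fin n → ℝ)) (γ q₀ : Fin n → ℝ) (h : ℝ) :
    ℕ → (Fin n → ℝ) × (Fin n → ℝ)
  | 0 => (1, q₀)
  | k + 1 =>
    let x := (h / ((k : ℝ) + 1)) • (γ * (∑ i : Fin k, (taylorCoeff P γ q₀ h (i + 1)).1 *
      (taylorCoeff P γ q₀ h (k - 1 - i)).2 + (taylorCoeff P γ q₀ h k).2) -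
      (taylorCoeff P γ q₀ h k).1)
    (x, -P (∑ i : Fin k, (taylorCoeff P γ q₀ h (i + 1)).1 * (taylorCoeff P γ q₀ h (k - i)).2 +
      x * (taylorCoeff P γ q₀ h 0).2))
  decreasing_by all_goals omega

/-- The recurrence is well founded in the order `q 0, x 1, q 1, x 2, …`: the convolution in degree
`k + 1` involves `x (k + 1)` but only `q` up to degree `k`. -/
theorem exists_isTaylor (P : (Fin n → ℝ) →ₗ[ℝ] (Fin n → ℝ)) (γ q₀ : Fin n → ℝ) (h : ℝ) :
    ∃ x q, IsTaylor P γ q₀ h x q := by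
  refine ⟨fun k => (taylorCoeff P γ q₀ h k).1, fun k => (taylorCoeff P γ q₀ h k).2, ?_, ?_, ?_⟩
  · simp only [taylorCoeff.eq_1]
  · rintro (_ | k)
    · simp [taylorCoeff.eq_1, convolution]
    · have hx : (taylorCoeff P γ q₀ h (k + 1)).1 = (h / ((k : ℝ) + 1)) • (γ * (∑ i : Fin k,
          (taylorCoeff P γ q₀ h (i + 1)).1 *
          (taylorCoeff P γ q₀ h (k - 1 - i)).2 + (taylorCoeff P γ q₀ h k).2) -
          (taylorCoeff P γ q₀ h k).1) := by rw [taylorCoeff.eq_2]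
      simp only [Nat.add_eq_zero_iff, one_ne_zero, and_false, if_false, zero_sub, convolution,
        Nat.add_sub_cancel]
      rw [Finset.sum_range_succ, Nat.sub_self, hx, Finset.sum_range]
      rw [taylorCoeff.eq_2]
  · intro k
    simp only [convolution, Finset.sum_range]
    rw [taylorCoeff.eq_2, smul_smul]
    congr 1
    have : (k : ℝ) + 1 ≠ 0 := by positivity
    field_simp

/-! ### The dynamics in relative coordinates -/

theorem diagonal_div_mulVec (x c v : Fin n → ℝ) :
    (diagonal fun j => x j / c j) *ᵥ v = x / c * v := by
  ext j; simp [mulVec_diagonal]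

theorem field_eq {A : Matrix (Fin m) (Fin n) ℤ} {b : Fin m → ℤ} {c : Fin n → ℤ} {x : Fin n → ℝ}
    (hb : realMatrix A *ᵥ x = fun i => (b i : ℝ)) :
    field A b c x = x / (fun j => (c j : ℝ)) *
      (response (realMatrix A) (x / fun j => (c j : ℝ)) *ᵥ x) - x := by
  simp only [field, response, laplacian]
  rw [← hb, ← diagonal_div_mulVec, mulVec_mulVec, mulVec_mulVec]
  simp only [Matrix.mul_assoc]
  rfl

theorem mulVec_field {A : Matrix (Fin m) (Fin n) ℤ} (hA : (realMatrix A).rank = m) {b : Fin m → ℤ}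
    {c : Fin n → ℤ} (hc : ∀ j, 0 < c j) {x : Fin n → ℝ} (hx : ∀ j, 0 < x j) :
    realMatrix A *ᵥ field A b c x = (fun i => (b i : ℝ)) - realMatrix A *ᵥ x := by
  have hw : ∀ j, 0 < x j / (c j : ℝ) := fun j => div_pos (hx j) (by exact_mod_cast hc j)
  have h := (isUnit_iff_isUnit_det _).1 (laplacian_posDef hA hw).isUnit
  simp only [field]
  rw [mulVec_sub, mulVec_mulVec]
  have : realMatrix A * ((diagonal fun j => x j / (c j : ℝ)) * (realMatrix A)ᵀ *
      (realMatrix A * (diagonal fun j => x j / (c j : ℝ)) * (realMatrix A)ᵀ)⁻¹) =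
      laplacian (realMatrix A) (fun j => x j / (c j : ℝ)) *
        (laplacian (realMatrix A) (fun j => x j / (c j : ℝ)))⁻¹ := by
    simp only [laplacian, Matrix.mul_assoc]
  rw [this, mul_nonsing_inv _ h, one_mulVec]

/-- The residual `r = A x - b` satisfies `r' = -r` and starts at zero. -/
theorem IsSolution.mulVec_eq {A : Matrix (Fin m) (Fin n) ℤ} (hA : (realMatrix A).rank = m)
    {b : Fin m → ℤ} {c : Fin n → ℤ} (hc : ∀ j, 0 < c j) {x₀ : Fin n → ℝ} {T : ℝ}
    {x : ℝ → Fin n → ℝ} (hx : IsSolution A b c x₀ T x)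
    (hb : realMatrix A *ᵥ x₀ = fun i => (b i : ℝ)) {t : ℝ} (ht : t ∈ Set.Icc 0 T) :
    realMatrix A *ᵥ x t = fun i => (b i : ℝ) := by
  have hderiv : ∀ t ∈ Set.Icc 0 T, HasDerivWithinAt
      (fun t => realMatrix A *ᵥ x t - fun i => (b i : ℝ))
      (-(realMatrix A *ᵥ x t - fun i => (b i : ℝ))) (Set.Icc 0 T) t := by
    intro t ht
    have h1 := ((mulVecLin (realMatrix A)).toContinuousLinearMap.hasFDerivAt
      (x := x t)).comp_hasDerivWithinAt t (hx.2 t ht).2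
    have h2 : (mulVecLin (realMatrix A)).toContinuousLinearMap (field A b c (x t)) =
        -(realMatrix A *ᵥ x t - fun i => (b i : ℝ)) := by
      rw [neg_sub, ← mulVec_field hA hc (hx.2 t ht).1]
      rfl
    rw [h2] at h1
    exact h1.sub_const _
  have := eq_zero_of_abs_deriv_le_mul_abs_self_of_eq_zero_right (K := 1) (a := 0) (b := T)
    (f := fun t => realMatrix A *ᵥ x t - fun i => (b i : ℝ))
    (fun t ht => (hderiv t ht).continuousWithinAt)
    (fun t ht => (hderiv t ⟨ht.1, ht.2.le⟩).mono_of_mem_nhdsWithin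
      (Filter.mem_of_superset (Icc_mem_nhdsGE ht.2) (Set.Icc_subset_Icc_left ht.1)))
    (by simp only [hx.1, hb, sub_self]) (fun t _ => by rw [norm_neg, one_mul]) t ht
  exact sub_eq_zero.1 this

theorem projection_mulVec (A : Matrix (Fin m) (Fin n) ℝ) (w v : Fin n → ℝ) :
    projection A w *ᵥ v = response A w *ᵥ (w * v) := by
  rw [projection, ← mulVec_mulVec]
  congr 1
  ext j; simp [mulVec_diagonal]

/-- The flow at a point, as the solution of a fixed point equation at another point. -/
theorem response_mulVec_eq {A : Matrix (Fin m) (Fin n) ℝ} (hA : A.rank = m) {c y x : Fin n → ℝ}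
    (hc : ∀ j, 0 < c j) (hy : ∀ j, 0 < y j) (hx : ∀ j, 0 < x j) (hxy : A *ᵥ x = A *ᵥ y) :
    response A (x / c) *ᵥ x = response A (y / c) *ᵥ y -
      projection A (y / c) *ᵥ ((x / y - 1) * (response A (x / c) *ᵥ x)) := by
  have hwx : ∀ j, 0 < (x / c) j := fun j => div_pos (hx j) (hc j)
  have hwy : ∀ j, 0 < (y / c) j := fun j => div_pos (hy j) (hc j)
  have h0 : ∀ w, response A w *ᵥ x = response A w *ᵥ y := fun w => by
    simp only [response, ← mulVec_mulVec, hxy]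
  -- The potential differences at `x` lie in the row space of `A`, which the projection at `y`
  -- fixes.
  have h1 : projection A (y / c) *ᵥ (response A (x / c) *ᵥ x) = response A (x / c) *ᵥ x := by
    rw [mulVec_mulVec, projection, response_mul_diagonal_mul_response' hA hwy]
  -- The factor `x / y` converts the weights at `y` to those at `x`, so Kirchhoff's law at `x`
  -- applies, and `A x = A y` gives the value at `y`.
  have h2 : projection A (y / c) *ᵥ (x / y * (response A (x / c) *ᵥ x)) =
      response A (y / c) *ᵥ y := by
    rw [projection_mulVec, ← h0 (y / c)]
    have h3 := response_mul_diagonal_mul_response hA (y / c) hwx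
    conv_rhs => rw [← h3, Matrix.mul_assoc, ← mulVec_mulVec, ← mulVec_mulVec]
    congr 1
    ext j
    have := (hy j).ne'
    simp only [mulVec_diagonal, Pi.mul_apply, Pi.div_apply]
    field_simp
  rw [sub_mul, one_mul, mulVec_sub, h1, h2]
  abel

/-- Time is rescaled so that a step of length `h` becomes the unit interval, and each coordinate is
divided by that of `y`. Componentwise the field is `x (p / c - 1)`, so the division by `y` leaves
its form unchanged. -/
theorem IsSolution.isRelativeSolution {A : Matrix (Fin m) (Fin n) ℤ}
    (hA : (realMatrix A).rank = m) {b : Fin m → ℤ} {c : Fin n → ℤ} (hc : ∀ j, 0 < c j)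
    {x₀ : Fin n → ℝ} {T : ℝ} {x : ℝ → Fin n → ℝ} (hx : IsSolution A b c x₀ T x)
    (hb : realMatrix A *ᵥ x₀ = fun i => (b i : ℝ)) {y : Fin n → ℝ} (hy : ∀ j, 0 < y j)
    (hyb : realMatrix A *ᵥ y = fun i => (b i : ℝ)) {t h : ℝ} (ht : 0 ≤ t) (hh : 0 ≤ h)
    (hT : t + h ≤ T) :
    IsRelativeSolution (mulVecLin (projection (realMatrix A) (y / fun j => (c j : ℝ))))
      (fun j => 1 / (c j : ℝ)) (response (realMatrix A) (y / fun j => (c j : ℝ)) *ᵥ y) h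
      (fun s => x (t + s * h) / y)
      (fun s => response (realMatrix A) (x (t + s * h) / fun j => (c j : ℝ)) *ᵥ x (t + s * h)) := by
  have hc' : ∀ j, (0 : ℝ) < c j := fun j => by exact_mod_cast hc j
  have hmem : ∀ s ∈ Set.Icc (0 : ℝ) 1, t + s * h ∈ Set.Icc 0 T := fun s hs =>
    ⟨add_nonneg ht (mul_nonneg hs.1 hh), by nlinarith [hs.2, mul_nonneg (sub_nonneg.2 hs.2) hh]⟩
  refine ⟨fun s hs => ?_, fun s hs => ?_⟩
  · exact response_mulVec_eq hA hc' hy (hx.2 _ (hmem s hs)).1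
      ((hx.mulVec_eq hA hc hb (hmem s hs)).trans hyb.symm)
  · have h1 : HasDerivWithinAt (fun s : ℝ => t + s * h) h (Set.Icc 0 1) s := by
      simpa using ((hasDerivWithinAt_id s _).mul_const h).const_add t
    have h2 := (hx.2 _ (hmem s hs)).2.scomp s h1 hmem
    rw [hasDerivWithinAt_pi] at h2 ⊢
    intro j
    refine ((h2 j).div_const (y j)).congr_deriv ?_
    rw [field_eq (hx.mulVec_eq hA hc hb (hmem s hs))]
    have := (hc' j).ne'
    have := (hy j).ne'
    simp only [Pi.smul_apply, Pi.mul_apply, Pi.sub_apply, Pi.div_apply, smul_eq_mul, Pi.one_apply]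
    field_simp

end

end Physarum

/-! ### Step size control and propagation of errors -/

namespace Physarum

open Matrix

section

variable {m n : ℕ}

/-- The norm of the weighted projection, but at least `1`. -/
noncomputable def amplification (A : Matrix (Fin m) (Fin n) ℝ) (c y : Fin n → ℝ) : ℝ :=
  max 1 ‖fun j => ∑ k, |projection A (y / c) j k|‖

/-- The size of the potential differences, but at least `1`. -/
noncomputable def flowBound (A : Matrix (Fin m) (Fin n) ℝ) (c y : Fin n → ℝ) : ℝ :=
  max 1 ‖response A (y / c) *ᵥ y‖

theorem norm_projection_mulVec_le (A : Matrix (Fin m) (Fin n) ℝ) (c y v : Fin n → ℝ) :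
    ‖projection A (y / c) *ᵥ v‖ ≤ amplification A c y * ‖v‖ := by
  have h1 : 0 ≤ amplification A c y := zero_le_one.trans (le_max_left _ _)
  rw [pi_norm_le_iff_of_nonneg (by positivity)]
  intro j
  have h2 : ∑ k, |projection A (y / c) j k| ≤ amplification A c y := by
    refine le_trans ?_ (le_max_right _ _)
    refine (le_abs_self _).trans ?_
    exact norm_le_pi_norm (fun j => ∑ k, |projection A (y / c) j k|) j
  calc ‖(projection A (y / c) *ᵥ v) j‖ ≤ ∑ k, |projection A (y / c) j k| * |v k| := by
        rw [mulVec, dotProduct]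
        refine (norm_sum_le _ _).trans (Finset.sum_le_sum fun k _ => ?_)
        rw [Real.norm_eq_abs, abs_mul]
    _ ≤ ∑ k, |projection A (y / c) j k| * ‖v‖ :=
        Finset.sum_le_sum fun k _ => mul_le_mul_of_nonneg_left (norm_le_pi_norm v k) (abs_nonneg _)
    _ ≤ _ := by
        rw [← Finset.sum_mul]
        exact mul_le_mul_of_nonneg_right h2 (norm_nonneg _)

theorem amplification_le {A : Matrix (Fin m) (Fin n) ℤ} (hA : (realMatrix A).rank = m)
    (hn : 1 ≤ n) {c y : Fin n → ℝ} (hc : ∀ j, 0 < c j) (hy : ∀ j, 0 < y j) :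
    amplification (realMatrix A) c y ≤ n * maxSubdet A := by
  have hD : (1 : ℝ) ≤ maxSubdet A := by exact_mod_cast one_le_maxSubdet A
  have hn' : (1 : ℝ) ≤ n := by exact_mod_cast hn
  refine max_le (by nlinarith) ?_
  rw [pi_norm_le_iff_of_nonneg (by positivity)]
  intro j
  rw [Real.norm_of_nonneg (Finset.sum_nonneg fun _ _ => abs_nonneg _)]
  calc ∑ k, |projection (realMatrix A) (y / c) j k| ≤ ∑ _k : Fin n, (maxSubdet A : ℝ) :=
        Finset.sum_le_sum fun k _ => abs_projection_le hA (fun j => div_pos (hy j) (hc j)) j k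
    _ = _ := by simp

theorem one_le_norm1 {n : ℕ} (hn : 1 ≤ n) {c : Fin n → ℤ} (hc : ∀ j, 0 < c j) : 1 ≤ norm1 c := by
  have h1 : |(c ⟨0, hn⟩ : ℝ)| ≤ norm1 c :=
    Finset.single_le_sum (f := fun j => |(c j : ℝ)|) (fun _ _ => abs_nonneg _) (Finset.mem_univ _)
  have h2 : (1 : ℝ) ≤ c ⟨0, hn⟩ := by exact_mod_cast hc ⟨0, hn⟩
  exact h2.trans ((le_abs_self _).trans h1)

/-- Since `y = W c`, the vector `R y` is the projection applied to the cost vector, whatever `y` is.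
-/
theorem flowBound_le {A : Matrix (Fin m) (Fin n) ℤ} (hA : (realMatrix A).rank = m) (hn : 1 ≤ n)
    {c : Fin n → ℤ} {y : Fin n → ℝ} (hc : ∀ j, 0 < c j) (hy : ∀ j, 0 < y j) :
    flowBound (realMatrix A) (fun j => (c j : ℝ)) y ≤ maxSubdet A * norm1 c := by
  have hD : (1 : ℝ) ≤ maxSubdet A := by exact_mod_cast one_le_maxSubdet A
  have hc' : ∀ j, (0 : ℝ) < c j := fun j => by exact_mod_cast hc j
  have hc1 := one_le_norm1 hn hc
  refine max_le (by nlinarith) ?_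
  rw [pi_norm_le_iff_of_nonneg (by positivity)]
  intro j
  have h1 : response (realMatrix A) (y / fun j => (c j : ℝ)) *ᵥ y =
      projection (realMatrix A) (y / fun j => (c j : ℝ)) *ᵥ (fun j => (c j : ℝ)) := by
    rw [projection_mulVec]
    congr 1
    ext j
    have := (hc' j).ne'
    simp only [Pi.mul_apply, Pi.div_apply]
    field_simp
  rw [h1, mulVec, dotProduct, norm1, Finset.mul_sum]
  refine (norm_sum_le _ _).trans (Finset.sum_le_sum fun k _ => ?_)
  rw [Real.norm_eq_abs, abs_mul]
  exact mul_le_mul_of_nonneg_right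
    (abs_projection_le hA (fun j => div_pos (hy j) (hc' j)) j k) (abs_nonneg _)

/-- Let `u` be the image of `v` under the new projection. The old projection `P` fixes `u` and
agrees on `z u` and `z v`, so `u = P (z v) - P ((z - 1) u)`. Absorbing the last term gives a factor
`1.09 / 0.91`, which is less than `2`. -/
theorem amplification_mul_le {A : Matrix (Fin m) (Fin n) ℝ} (hA : A.rank = m) {c y z : Fin n → ℝ}
    (hc : ∀ j, 0 < c j) (hy : ∀ j, 0 < y j) (hz : ∀ j, 0 < z j)
    (h : amplification A c y * ‖z - 1‖ ≤ 0.09) :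
    amplification A c (y * z) ≤ 2 * amplification A c y := by
  set α := amplification A c y with hα
  have hα1 : 1 ≤ α := le_max_left _ _
  have hw : ∀ j, 0 < (y / c) j := fun j => div_pos (hy j) (hc j)
  have hw' : ∀ j, 0 < (y * z / c) j := fun j => div_pos (mul_pos (hy j) (hz j)) (hc j)
  have hP : ∀ v, ‖projection A (y / c) *ᵥ v‖ ≤ α * ‖v‖ := norm_projection_mulVec_le A c y
  have key : ∀ v, ‖projection A (y * z / c) *ᵥ v‖ ≤ 2 * α * ‖v‖ := by
    intro v
    set u := projection A (y * z / c) *ᵥ v with hu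
    have h1 : projection A (y / c) *ᵥ u = u := by
      rw [hu, projection_mulVec A (y * z / c), mulVec_mulVec, projection,
        response_mul_diagonal_mul_response' hA hw]
    have h2 : projection A (y / c) *ᵥ (z * u) = projection A (y / c) *ᵥ (z * v) := by
      rw [projection_mulVec, projection_mulVec, ← mul_assoc, ← mul_assoc]
      have h3 : y / c * z = y * z / c := by ext j; simp; ring
      have h4 : y * z / c * u = diagonal (y * z / c) *ᵥ u := by ext j; simp [mulVec_diagonal]
      rw [h3, h4, hu, projection_mulVec, mulVec_mulVec, mulVec_mulVec,
        response_mul_diagonal_mul_response hA _ hw']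
    have h5 : u = projection A (y / c) *ᵥ (z * v) - projection A (y / c) *ᵥ ((z - 1) * u) := by
      rw [sub_mul, one_mul, mulVec_sub, h1, h2]; abel
    have h6 : ‖u‖ ≤ α * ((1.09 : ℝ) * ‖v‖) + α * (‖z - 1‖ * ‖u‖) := by
      calc ‖u‖ = ‖projection A (y / c) *ᵥ (z * v) - projection A (y / c) *ᵥ ((z - 1) * u)‖ := by
            conv_lhs => rw [h5]
        _ ≤ _ := by
          refine (norm_sub_le _ _).trans (add_le_add ((hP _).trans ?_) ((hP _).trans ?_))
          · refine mul_le_mul_of_nonneg_left ((norm_mul_le _ _).trans ?_) (by linarith)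
            refine mul_le_mul_of_nonneg_right ?_ (norm_nonneg _)
            have h7 : ‖z - 1‖ ≤ 0.09 := by nlinarith [norm_nonneg (z - 1)]
            calc ‖z‖ = ‖(z - 1) + 1‖ := by rw [sub_add_cancel]
              _ ≤ ‖z - 1‖ + 1 := (norm_add_le _ _).trans (add_le_add le_rfl norm_one_le)
              _ ≤ _ := by linarith
          · exact mul_le_mul_of_nonneg_left (norm_mul_le _ _) (by linarith)
    have h8 : α * ‖z - 1‖ * ‖u‖ ≤ 0.09 * ‖u‖ := mul_le_mul_of_nonneg_right h (norm_nonneg _)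
    nlinarith [norm_nonneg u, norm_nonneg v, mul_nonneg (zero_le_one.trans hα1) (norm_nonneg v)]
  refine max_le (by linarith) ?_
  rw [pi_norm_le_iff_of_nonneg (by linarith)]
  intro j
  rw [Real.norm_of_nonneg (Finset.sum_nonneg fun _ _ => abs_nonneg _)]
  -- The sign vector of row `j` turns the operator norm bound back into a bound for the absolute row
  -- sum.
  set v : Fin n → ℝ := fun k => SignType.sign (projection A (y * z / c) j k) with hv
  have hv1 : ‖v‖ ≤ 1 := by
    rw [pi_norm_le_iff_of_nonneg zero_le_one]
    intro k
    simp only [hv]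
    rcases lt_trichotomy (projection A (y * z / c) j k) 0 with h | h | h <;> simp [h]
  calc ∑ k, |projection A (y * z / c) j k| = (projection A (y * z / c) *ᵥ v) j := by
        rw [mulVec, dotProduct]
        refine Finset.sum_congr rfl fun k _ => ?_
        simp only [hv]
        exact (self_mul_sign _).symm
    _ ≤ ‖projection A (y * z / c) *ᵥ v‖ := (le_abs_self _).trans
        (norm_le_pi_norm (projection A (y * z / c) *ᵥ v) j)
    _ ≤ 2 * α * ‖v‖ := key v
    _ ≤ 2 * α := by nlinarith

/-- The point `y` approximates the point `x` of the trajectory after `i` steps. -/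
structure Tracks (A : Matrix (Fin m) (Fin n) ℝ) (b : Fin m → ℝ) (c x : Fin n → ℝ) (α₀ : ℝ)
    (K i : ℕ) (y : Fin n → ℝ) : Prop where
  pos : ∀ j, 0 < y j
  feasible : A *ᵥ y = b
  growth : amplification A c y ≤ 2 ^ i * α₀
  err : ‖x / y - 1‖ ≤ (2 ^ i - 1) * (1 / 2) ^ K

/-- The linear constraints are preserved by the truncated power series. -/
theorem IsTaylor.mulVec_sum {A : Matrix (Fin m) (Fin n) ℝ} (hA : A.rank = m) {c y : Fin n → ℝ}
    (hc : ∀ j, 0 < c j) (hy : ∀ j, 0 < y j) {h : ℝ} {x q : ℕ → Fin n → ℝ}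
    (ht : IsTaylor (mulVecLin (projection A (y / c))) (fun j => 1 / c j)
      (response A (y / c) *ᵥ y) h x q) (K : ℕ) :
    A *ᵥ (y * ∑ k ∈ Finset.range (K + 1), x k) = A *ᵥ y := by
  have hw : ∀ j, 0 < (y / c) j := fun j => div_pos (hy j) (hc j)
  have hAR : ∀ v, A *ᵥ (y / c * (response A (y / c) *ᵥ v)) = A *ᵥ v := fun v => by
    have : y / c * (response A (y / c) *ᵥ v) = diagonal (y / c) *ᵥ (response A (y / c) *ᵥ v) := by
      ext j; simp [mulVec_diagonal]
    rw [this, mulVec_mulVec, mulVec_mulVec, mul_diagonal_mul_response hA hw]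
  -- The identity `A W R = A` cancels the convolution against its projection, so the flow meets the
  -- demand `A y` in degree `0` and zero in all others. By induction `A` then kills all higher
  -- coefficients.
  have hflow : ∀ k, A *ᵥ (y / c * (convolution x q k + q k)) = if k = 0 then A *ᵥ y else 0 := by
    intro k
    rw [ht.q_eq k, mulVecLin_apply, projection_mulVec, mul_add, mul_sub, mulVec_add, mulVec_sub,
      hAR]
    split_ifs
    · rw [hAR]; abel
    · simp
  have hzero : ∀ k, A *ᵥ (y * x (k + 1)) = 0 := by
    have hk : ∀ k : ℕ, ((k : ℝ) + 1) • (A *ᵥ (y * x (k + 1))) =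
        h • ((if k = 0 then A *ᵥ y else 0) - A *ᵥ (y * x k)) := by
      intro k
      rw [← hflow, ← mulVec_sub, ← mulVec_smul, ← mulVec_smul, ← mul_smul_comm, ht.x_succ,
        mul_smul_comm]
      congr 2
      ext j
      have := (hc j).ne'
      simp only [Pi.mul_apply, Pi.sub_apply, Pi.add_apply, Pi.div_apply]
      field_simp
    intro k
    have hk1 : ((k : ℝ) + 1) ≠ 0 := by positivity
    induction k with
    | zero =>
      have := hk 0
      rw [ht.x_zero, mul_one, if_pos rfl, sub_self, smul_zero] at this
      exact (smul_eq_zero.1 this).resolve_left hk1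
    | succ k ih =>
      have := hk (k + 1)
      rw [ih (by positivity), if_neg (by omega), sub_self, smul_zero] at this
      exact (smul_eq_zero.1 this).resolve_left hk1
  rw [Finset.mul_sum, Finset.sum_range_succ', ht.x_zero, mul_one, mulVec_add]
  rw [← mulVecLin_apply, map_sum]
  simp [hzero]

/-- The new point is `y Z`, with `Z` the Taylor polynomial at time `1`. Since `Z ≥ 0.91`, it stays
positive, and passing from errors relative to `y` to errors relative to `y Z` costs a factor `1 /
0.91`, which fits into the doubling of the bound. -/
theorem Tracks.step {A : Matrix (Fin m) (Fin n) ℤ} (hA : (realMatrix A).rank = m) {b : Fin m → ℤ}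
    {c : Fin n → ℤ} (hc : ∀ j, 0 < c j) {x₀ : Fin n → ℝ} {T : ℝ} {x : ℝ → Fin n → ℝ}
    (hx : IsSolution A b c x₀ T x) (hb : realMatrix A *ᵥ x₀ = fun i => (b i : ℝ)) {α₀ : ℝ}
    {G κ i : ℕ} (hi : i < G) (hκ : 4 * α₀ ≤ 2 ^ κ) {t h : ℝ} (ht : 0 ≤ t) (hh : 0 ≤ h)
    (hT : t + h ≤ T) {y : Fin n → ℝ}
    (hy : Tracks (realMatrix A) (fun i => (b i : ℝ)) (fun j => (c j : ℝ)) (x t) α₀ (2 * G + κ) i y)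
    (hcheck : 100 * h * amplification (realMatrix A) (fun j => (c j : ℝ)) y *
      flowBound (realMatrix A) (fun j => (c j : ℝ)) y ≤ 1) {ξ q : ℕ → Fin n → ℝ}
    (hξ : IsTaylor (mulVecLin (projection (realMatrix A) (y / fun j => (c j : ℝ))))
      (fun j => 1 / (c j : ℝ)) (response (realMatrix A) (y / fun j => (c j : ℝ)) *ᵥ y) h ξ q) :
    Tracks (realMatrix A) (fun i => (b i : ℝ)) (fun j => (c j : ℝ)) (x (t + h)) α₀ (2 * G + κ)
      (i + 1) (y * ∑ k ∈ Finset.range (2 * G + κ + 1), ξ k) := by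
  have hc' : ∀ j, (0 : ℝ) < c j := fun j => by exact_mod_cast hc j
  set K := 2 * G + κ with hK
  set α := amplification (realMatrix A) (fun j => (c j : ℝ)) y with hα
  have hα1 : 1 ≤ α := le_max_left _ _
  have hz := hx.isRelativeSolution hA hc hb hy.pos hy.feasible ht hh hT
  have hγ : ‖fun j => 1 / (c j : ℝ)‖ ≤ 1 := by
    rw [pi_norm_le_iff_of_nonneg zero_le_one]
    intro j
    have : (1 : ℝ) ≤ c j := by exact_mod_cast hc j
    rw [Real.norm_of_nonneg (by have := hc' j; positivity)]
    exact (div_le_one (hc' j)).2 this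
  -- The product `4 α * error` may grow by `4` in each step, `2` from each factor. The part `2 G` of
  -- the degree pays for `G` steps, the part `κ` for the initial `4 α₀`.
  have h2K : (2 : ℝ) ^ i * (2 ^ i) * 2 ^ κ * (1 / 2) ^ K ≤ 1 := by
    have e1 : (2 : ℝ) ^ i * (2 ^ i) * 2 ^ κ ≤ 2 ^ K := by
      rw [← pow_add, ← pow_add]
      exact pow_le_pow_right₀ (by norm_num) (by omega)
    calc (2 : ℝ) ^ i * (2 ^ i) * 2 ^ κ * (1 / 2) ^ K ≤ 2 ^ K * (1 / 2) ^ K := by gcongr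
      _ = 1 := by rw [← mul_pow]; norm_num
  have hhalf : (0 : ℝ) < (1 / 2) ^ K := by positivity
  have hE : 4 * α * ‖x t / y - 1‖ ≤ 1 := by
    have h2i : (1 : ℝ) ≤ 2 ^ i := one_le_pow₀ (by norm_num)
    calc 4 * α * ‖x t / y - 1‖ ≤ 4 * (2 ^ i * α₀) * (2 ^ i * (1 / 2) ^ K) := by
          have := hy.growth
          have e3 : ‖x t / y - 1‖ ≤ 2 ^ i * (1 / 2) ^ K := hy.err.trans (by nlinarith)
          exact mul_le_mul (by linarith) e3 (norm_nonneg _) (by linarith)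
      _ = (4 * α₀) * ((2 : ℝ) ^ i * (2 ^ i) * (1 / 2) ^ K) := by ring
      _ ≤ 2 ^ κ * ((2 : ℝ) ^ i * (2 ^ i) * (1 / 2) ^ K) := by gcongr
      _ = (2 : ℝ) ^ i * (2 ^ i) * 2 ^ κ * (1 / 2) ^ K := by ring
      _ ≤ 1 := h2K
  have hE' : 4 * α * ‖x (t + 0 * h) / y - 1‖ ≤ 1 := by simpa using hE
  obtain ⟨hs1, hs2⟩ := hξ.step (α := α) (β := flowBound (realMatrix A) (fun j => (c j : ℝ)) y)
    hα1 (le_max_left _ _) hh hcheck hγ (fun v => norm_projection_mulVec_le _ _ _ v)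
    (le_max_right _ _) (m := K) (by omega) hz hE'
  set Z := ∑ k ∈ Finset.range (K + 1), ξ k with hZ
  have hZ1 : ‖Z - 1‖ ≤ 0.09 := by nlinarith [norm_nonneg (Z - 1)]
  have hZpos : ∀ j, 0.91 ≤ Z j := by
    intro j
    have h1 := (norm_le_pi_norm (Z - 1) j).trans hZ1
    rw [Real.norm_eq_abs, abs_le] at h1
    have h2 := h1.1
    simp only [Pi.sub_apply, Pi.one_apply] at h2
    linarith
  refine ⟨fun j => mul_pos (hy.pos j) (by linarith [hZpos j]), ?_, ?_, ?_⟩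
  · rw [hξ.mulVec_sum hA hc' hy.pos, hy.feasible]
  · refine (amplification_mul_le hA hc' hy.pos (fun j => by linarith [hZpos j]) hs1).trans ?_
    rw [pow_succ]
    linarith [hy.growth]
  · rw [one_mul, zero_mul, add_zero] at hs2
    have h2i : (1 : ℝ) ≤ 2 ^ i := one_le_pow₀ (by norm_num)
    have hbound : 0 ≤ (2 ^ (i + 1) - 1) * (1 / 2 : ℝ) ^ K := by
      refine mul_nonneg ?_ hhalf.le
      rw [pow_succ]; linarith
    rw [pi_norm_le_iff_of_nonneg hbound]
    intro j
    have hyj := hy.pos j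
    have hZj := hZpos j
    have h3 : |x (t + h) j / y j - Z j| ≤ ‖x (t + h) / y - Z‖ :=
      norm_le_pi_norm (x (t + h) / y - Z) j
    have h4 : (x (t + h) / (y * Z) - 1) j = (x (t + h) j / y j - Z j) / Z j := by
      have : Z j ≠ 0 := by linarith
      simp only [Pi.sub_apply, Pi.div_apply, Pi.mul_apply, Pi.one_apply]
      field_simp
    rw [h4, Real.norm_eq_abs, abs_div, abs_of_pos (by linarith : 0 < Z j),
      div_le_iff₀ (by linarith)]
    have h5 := hy.err
    calc _ ≤ (1.2 : ℝ) * ((2 ^ i - 1) * (1 / 2) ^ K) + 0.2 * (1 / 2) ^ K := by linarith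
      _ ≤ (2 ^ (i + 1) - 1) * (1 / 2) ^ K * 0.91 := by
        rw [pow_succ]
        nlinarith
      _ ≤ _ := mul_le_mul_of_nonneg_left hZj hbound

theorem Tracks.initial {A : Matrix (Fin m) (Fin n) ℝ} {b : Fin m → ℝ} {c x : Fin n → ℝ}
    (hx : ∀ j, 0 < x j) (hb : A *ᵥ x = b) (K : ℕ) :
    Tracks A b c x (amplification A c x) K 0 x := by
  refine ⟨hx, hb, by simp, ?_⟩
  have : x / x - 1 = 0 := by ext j; simp [(hx j).ne']
  simp [this]

/-- The final error is below `2 ^ (-κ) ≤ ε / 4`. It is measured relative to `y`; the factor `4`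
leaves room for measuring it relative to `x`. -/
theorem Tracks.bounds {A : Matrix (Fin m) (Fin n) ℝ} {b : Fin m → ℝ} {c x y : Fin n → ℝ} {α₀ ε : ℝ}
    {G κ : ℕ} (hy : Tracks A b c x α₀ (2 * G + κ) G y) (hα₀ : 1 ≤ α₀) (hε : 0 < ε) (hε1 : ε < 1)
    (hκ : 4 * α₀ ≤ ε * 2 ^ κ) (j : Fin n) : (1 - ε) * x j ≤ y j ∧ y j ≤ (1 + ε) * x j := by
  have h1 : ‖x / y - 1‖ ≤ ε / 4 := by
    refine hy.err.trans ?_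
    have h2 : ((2 : ℝ) ^ G - 1) * (1 / 2) ^ (2 * G + κ) ≤ 1 / 2 ^ κ := by
      have e : (2 : ℝ) ^ (2 * G + κ) = 2 ^ G * 2 ^ G * 2 ^ κ := by rw [← pow_add, ← pow_add]; ring_nf
      have e1 : (1 : ℝ) ≤ 2 ^ G := one_le_pow₀ (by norm_num)
      rw [one_div, inv_pow, ← div_eq_mul_inv, e, div_le_div_iff₀ (by positivity) (by positivity)]
      have : (2 : ℝ) ^ G - 1 ≤ 2 ^ G * 2 ^ G := by nlinarith
      nlinarith [pow_pos (zero_lt_two (α := ℝ)) κ]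
    refine h2.trans ?_
    rw [div_le_iff₀ (by positivity)]
    linarith
  have h2 := (norm_le_pi_norm (x / y - 1) j).trans h1
  have hyj := hy.pos j
  rw [Real.norm_eq_abs, abs_le] at h2
  simp only [Pi.sub_apply, Pi.div_apply, Pi.one_apply] at h2
  obtain ⟨h3, h4⟩ := h2
  have h5 : (1 - ε / 4) * y j ≤ x j := by
    have : 1 - ε / 4 ≤ x j / y j := by linarith
    rwa [le_div_iff₀ hyj] at this
  have h6 : x j ≤ (1 + ε / 4) * y j := by
    have : x j / y j ≤ 1 + ε / 4 := by linarith
    rwa [div_le_iff₀ hyj] at this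
  constructor <;> nlinarith
end

end Physarum

namespace Physarum

open Matrix

section

variable {m n : ℕ}

/-! ### Padding to square matrices -/

/-- The matrix `A` with rows and columns of zeros added. -/
noncomputable def padded (A : Matrix (Fin m) (Fin n) ℝ) (N : ℕ) : Matrix (Fin N) (Fin N) ℝ :=
  fun i j => if h : (i : ℕ) < m ∧ (j : ℕ) < n then A ⟨i, h.1⟩ ⟨j, h.2⟩ else 0

/-- The vector `w` with zeros added. -/
noncomputable def paddedVec (w : Fin n → ℝ) (N : ℕ) : Fin N → ℝ :=
  fun j => if h : (j : ℕ) < n then w ⟨j, h⟩ else 0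

/-- The projection to the coordinates from `m` on. -/
noncomputable def padUnit (m N : ℕ) : Matrix (Fin N) (Fin N) ℝ :=
  fun i j => if i = j ∧ m ≤ i then 1 else 0

/-- The weighted Laplacian, made an invertible matrix of size `N`. -/
noncomputable def paddedLaplacian (A : Matrix (Fin m) (Fin n) ℝ) (w : Fin n → ℝ) (N : ℕ) :
    Matrix (Fin N) (Fin N) ℝ :=
  padded A N * diagonal (paddedVec w N) * (padded A N)ᵀ + padUnit m N

theorem sum_castLE {k N : ℕ} (h : k ≤ N) (f : Fin N → ℝ) (hf : ∀ i : Fin N, k ≤ i → f i = 0) :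
    ∑ i, f i = ∑ i : Fin k, f (Fin.castLE h i) := by
  symm
  refine Fintype.sum_of_injective (Fin.castLE h) (Fin.castLE_injective h) _ _ (fun i hi => ?_)
    fun _ => rfl
  refine hf i ?_
  by_contra! hik
  exact hi ⟨⟨i, hik⟩, rfl⟩

@[simp] theorem padded_castLE (A : Matrix (Fin m) (Fin n) ℝ) {N : ℕ} (hm : m ≤ N) (hn : n ≤ N)
    (i : Fin m) (j : Fin n) : padded A N (Fin.castLE hm i) (Fin.castLE hn j) = A i j := by
  simp [padded]

theorem padded_row (A : Matrix (Fin m) (Fin n) ℝ) {N : ℕ} {i : Fin N} (hi : m ≤ i) (j : Fin N) :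
    padded A N i j = 0 := by
  rw [padded, dif_neg (by omega)]

theorem padded_col (A : Matrix (Fin m) (Fin n) ℝ) {N : ℕ} (i : Fin N) {j : Fin N} (hj : n ≤ j) :
    padded A N i j = 0 := by
  rw [padded, dif_neg (by omega)]

@[simp] theorem paddedVec_castLE (w : Fin n → ℝ) {N : ℕ} (hn : n ≤ N) (j : Fin n) :
    paddedVec w N (Fin.castLE hn j) = w j := by
  simp [paddedVec]

theorem paddedLaplacian_apply (A : Matrix (Fin m) (Fin n) ℝ) (w : Fin n → ℝ) {N : ℕ} (hn : n ≤ N)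
    (i k : Fin N) : paddedLaplacian A w N i k =
      ∑ j : Fin n, padded A N i (Fin.castLE hn j) * w j * padded A N k (Fin.castLE hn j) +
        padUnit m N i k := by
  rw [paddedLaplacian, Matrix.add_apply, Matrix.mul_apply, sum_castLE hn]
  · simp [mul_diagonal]
  · intro j hj
    simp [mul_diagonal, padded_col A _ hj]

/-- The matrix is a Gram matrix with positive weights: `B` stacks the padded `Aᵀ` on the projection
to the new coordinates. It is injective because the rows of `A` are independent and the second part
sees the rest. -/
theorem paddedLaplacian_posDef {A : Matrix (Fin m) (Fin n) ℝ} (hA : A.rank = m) {w : Fin n → ℝ}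
    (hw : ∀ j, 0 < w j) {N : ℕ} (hm : m ≤ N) (hn : n ≤ N) : (paddedLaplacian A w N).PosDef := by
  obtain ⟨B, hBl, hBr⟩ : ∃ B : Matrix (Fin n ⊕ Fin N) (Fin N) ℝ,
      (∀ j i, B (Sum.inl j) i = padded A N i (Fin.castLE hn j)) ∧
      ∀ k i, B (Sum.inr k) i = padUnit m N k i :=
    ⟨fun s i => Sum.elim (fun j => padded A N i (Fin.castLE hn j)) (fun k => padUnit m N k i) s,
      fun _ _ => rfl, fun _ _ => rfl⟩
  let d : Fin n ⊕ Fin N → ℝ := Sum.elim w 1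
  have hd : (diagonal d).PosDef := posDef_diagonal_iff.2 fun s => by
    rcases s with j | k <;> simp [d, hw]
  have hB : Function.Injective B.mulVec := by
    rw [← coe_mulVecLin, injective_iff_map_eq_zero]
    intro v hv
    rw [mulVecLin_apply] at hv
    have h1 : ∀ i : Fin N, m ≤ i → v i = 0 := by
      intro i hi
      have := congrFun hv (Sum.inr i)
      simpa only [mulVec, dotProduct, hBr, padUnit, hi, and_true, ite_mul, one_mul, zero_mul,
        Finset.sum_ite_eq, Finset.mem_univ, if_true, Pi.zero_apply] using this
    have h2 : Aᵀ *ᵥ (fun i => v (Fin.castLE hm i)) = 0 := by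
      ext j
      have := congrFun hv (Sum.inl j)
      rw [mulVec, dotProduct, sum_castLE hm _ (fun i hi => by simp [h1 i hi])] at this
      simp only [hBl, padded_castLE] at this
      exact this
    have h3 : (fun i => v (Fin.castLE hm i)) = 0 :=
      vecMul_injective_of_rank hA (h2.trans (mulVec_zero _).symm)
    ext i
    by_cases hi : m ≤ i
    · exact h1 i hi
    · exact congrFun h3 ⟨i, by omega⟩
  have h := hd.conjTranspose_mul_mul_same hB
  have h2 : Bᴴ * diagonal d * B = paddedLaplacian A w N := by
    ext i k
    rw [paddedLaplacian_apply A w hn, Matrix.mul_apply, Fintype.sum_sum_type]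
    congr 1
    · simp only [mul_diagonal, d, conjTranspose_apply, Sum.elim_inl, star_trivial, hBl]
    · simp only [mul_diagonal, d, conjTranspose_apply, Sum.elim_inr, star_trivial, hBr,
        Pi.one_apply, mul_one]
      rw [Finset.sum_eq_single i]
      · by_cases hi : m ≤ i <;> simp [padUnit, hi]
      · intro l _ hl; simp [padUnit, hl]
      · simp
  rwa [h2] at h

/-- The padded Laplacian is block diagonal, the Laplacian next to an identity. The upper part of a
solution of the padded system therefore solves the original one. -/
theorem padded_response {A : Matrix (Fin m) (Fin n) ℝ} (hA : A.rank = m) {w : Fin n → ℝ}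
    (hw : ∀ j, 0 < w j) {N : ℕ} (hm : m ≤ N) (hn : n ≤ N) (i j : Fin n) :
    ((padded A N)ᵀ * ((paddedLaplacian A w N)⁻¹ * padded A N)) (Fin.castLE hn i)
      (Fin.castLE hn j) = response A w i j := by
  set U := (paddedLaplacian A w N)⁻¹ * padded A N with hU
  have hMU : paddedLaplacian A w N * U = padded A N := by
    rw [hU, ← Matrix.mul_assoc, mul_nonsing_inv _ ((isUnit_iff_isUnit_det _).1
      (paddedLaplacian_posDef hA hw hm hn).isUnit), Matrix.one_mul]
  let U' : Matrix (Fin m) (Fin n) ℝ := fun i j => U (Fin.castLE hm i) (Fin.castLE hn j)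
  have hLU : laplacian A w * U' = A := by
    ext k l
    have h1 := congrFun (congrFun hMU (Fin.castLE hm k)) (Fin.castLE hn l)
    rw [padded_castLE, Matrix.mul_apply, sum_castLE hm] at h1
    · rw [← h1, Matrix.mul_apply]
      refine Finset.sum_congr rfl fun k' _ => ?_
      rw [paddedLaplacian_apply A w hn, laplacian, Matrix.mul_apply]
      have h2 : padUnit m N (Fin.castLE hm k) (Fin.castLE hm k') = 0 := by
        rw [padUnit, if_neg]
        simp
      rw [h2, add_zero]
      simp [mul_diagonal, U']
    · intro k' hk'
      rw [paddedLaplacian_apply A w hn]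
      have h2 : padUnit m N (Fin.castLE hm k) k' = 0 := by
        rw [padUnit, if_neg]
        rintro ⟨rfl, h⟩
        simp at hk'
        omega
      simp [padded_row A hk', h2]
  have hU' : U' = (laplacian A w)⁻¹ * A := by
    have h := (isUnit_iff_isUnit_det _).1 (laplacian_posDef hA hw).isUnit
    calc U' = (laplacian A w)⁻¹ * (laplacian A w * U') := by
          rw [← Matrix.mul_assoc, nonsing_inv_mul _ h, Matrix.one_mul]
      _ = _ := by rw [hLU]
  rw [response, Matrix.mul_assoc, ← hU', Matrix.mul_apply, Matrix.mul_apply, sum_castLE hm]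
  · simp [U']
  · intro k hk
    simp [padded_row A hk]

end

end Physarum

/-! ### Computing the response matrix -/

namespace RealRAM

open Physarum

/-- The data of the linear program in the arrays of the solver. -/
structure DataStored {m n : ℕ} (B top : ℕ) (A : Matrix (Fin m) (Fin n) ℝ) (c x₀ : Fin n → ℝ)
    (T ε : ℝ) (σ : State) : Prop where
  powers : PowersStored B top σ
  rows : σ.idx (B + 20) 0 = m
  cols : σ.idx (B + 21) 0 = n
  matrix : ∀ i j : Fin (2 ^ top), σ.val (B + 20) (i * 2 ^ top + j) = padded A (2 ^ top) i j
  cost : ∀ j : Fin n, σ.val (B + 21) j = c j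
  pad : ∀ i j : Fin (2 ^ top), σ.val (B + 22) (i * 2 ^ top + j) = padUnit m (2 ^ top) i j
  start : ∀ j : Fin n, σ.val (B + 23) j = x₀ j
  time : σ.val (B + 24) 0 = T
  accuracy : σ.val (B + 25) 0 = ε

/-- The arrays from `B + 20` on hold the problem data and are not written again once the input has
been read. -/
theorem DataStored.frame {m n : ℕ} {B top : ℕ} {A : Matrix (Fin m) (Fin n) ℝ} {c x₀ : Fin n → ℝ}
    {T ε : ℝ} {σ σ' : State} (h : DataStored B top A c x₀ T ε σ) {b b' : ℕ}
    (hσ : Frame (Set.Iio b) (Set.Iio b') σ σ') (hb : b ≤ B + 20) (hb' : b' ≤ B + 20) :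
    DataStored B top A c x₀ T ε σ' := by
  have hi : ∀ a, B + 20 ≤ a → σ'.idx a = σ.idx a := fun a ha => hσ.idx a (by simp; omega)
  have hv : ∀ a, B + 20 ≤ a → σ'.val a = σ.val a := fun a ha => hσ.val a (by simp; omega)
  refine ⟨h.powers.frame hσ (by omega), ?_, ?_, ?_, ?_, ?_, ?_, ?_, ?_⟩
  · rw [hi _ (by omega), h.rows]
  · rw [hi _ (by omega), h.cols]
  · rw [hv _ (by omega)]; exact h.matrix
  · rw [hv _ (by omega)]; exact h.cost
  · rw [hv _ (by omega)]; exact h.pad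
  · rw [hv _ (by omega)]; exact h.start
  · rw [hv _ (by omega), h.time]
  · rw [hv _ (by omega), h.accuracy]

/-- Compute `Aᵀ (A W Aᵀ)⁻¹ A` in the value array `B + 5`, for the point in the value array
`B + 13`. -/
def responseCmd (p : Cmd) (B : ℕ) : Cmd :=
  .seq (mulStore p B (B + 22)
      (.mul (.load (B + 20) (cellExpr B (.const 0) (.const 0) (.var (B + 22))))
        (.div (.load (B + 13) (.var (B + 1))) (.load (B + 21) (.var (B + 1)))))
      (.load (B + 20) (.add (.mul (.var (B + 1)) (.var (B + 22))) (.var B)))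
      (B + 3) (cellExpr B (.const 0) (.const 0) (.var (B + 22)))
      (.add (.load 2 (cellExpr B (.const 0) (.const 0) (.var (B + 22))))
        (.load (B + 22) (cellExpr B (.const 0) (.const 0) (.var (B + 22))))))
    (.seq (inverseCmd p B)
      (.seq (mulBlocks p B (B + 22) (B + 3) (.const 0) (.const 0) (.var (B + 22))
          (B + 20) (.const 0) (.const 0) (.var (B + 22))
          (B + 4) (.const 0) (.const 0) (.var (B + 22)) 0 1)
        (mulStore p B (B + 22)
          (.load (B + 20) (.add (.mul (.var (B + 1)) (.var (B + 22))) (.var B)))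
          (.load (B + 4) (cellExpr B (.const 0) (.const 0) (.var (B + 22))))
          (B + 5) (cellExpr B (.const 0) (.const 0) (.var (B + 22)))
          (.load 2 (cellExpr B (.const 0) (.const 0) (.var (B + 22)))))))

theorem Runs.responseCmd {m n : ℕ} {p : Cmd} {f : ℕ → ℕ} {B top : ℕ} (hp : Multiplies p f)
    (hpB : p.bound ≤ B) (hB : 7 ≤ B) {A : Matrix (Fin m) (Fin n) ℝ} (hA : A.rank = m)
    {c x₀ y : Fin n → ℝ} {T ε : ℝ} (hc : ∀ j, 0 < c j) (hy : ∀ j, 0 < y j) {σ : State}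
    (hσ : DataStored B top A c x₀ T ε σ) (hm : m ≤ 2 ^ top) (hn : n ≤ 2 ^ top)
    (hyσ : ∀ j : Fin n, σ.val (B + 13) j = y j) :
    Runs (RealRAM.responseCmd p B) σ (inverseTime f top + 1600 * f (2 ^ top)) fun σ' =>
      Frame (Set.Iio (B + 8)) (Set.Iio (B + 6)) σ σ' ∧
      ∀ i j : Fin n, σ'.val (B + 5) (i * 2 ^ top + j) = response A (y / c) i j := by
  set N := 2 ^ top with hN
  have hN1 : 1 ≤ N := Nat.one_le_two_pow
  have hfN : 1 ≤ f N := (Nat.one_le_pow _ _ hN1).trans (hp.sq_le hN1)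
  have hw : ∀ j, 0 < (y / c) j := fun j => div_pos (hy j) (hc j)
  have hinj : ∀ i < N, ∀ j < N, ∀ i' < N, ∀ j' < N, i * N + j = i' * N + j' →
      i = i' ∧ j = j' := by
    intro i _ j hj i' _ j' hj' h
    exact block_pos_inj (stride := N) (r₀ := 0) (c₀ := 0) (n := N) (by omega) hj hj' (by simpa using h)
  have hcell : ∀ {τ τ' : State} {V : Set ℕ} {i j : ℕ}, Frame (Set.Iio (B + 2)) V τ τ' →
      τ.idx (B + 22) 0 = N → τ'.idx B 0 = i → τ'.idx (B + 1) 0 = j →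
      (cellExpr B (.const 0) (.const 0) (.var (B + 22))).eval τ' = i * N + j := by
    intro τ τ' V i j h h1 h2 h3
    rw [cellExpr_eval (r := .const 0) (c := .const 0) (w := .var (B + 22)) h trivial trivial
      ⟨by omega, trivial⟩ h2 h3]
    simp [IExpr.eval, h1]
  have hcell' : ∀ {τ τ' : State} {V : Set ℕ} {i j : ℕ}, Frame (Set.Iio (B + 2)) V τ τ' →
      τ.idx (B + 22) 0 = N → τ'.idx B 0 = i → τ'.idx (B + 1) 0 = j →
      (IExpr.add (.mul (.var (B + 1)) (.var (B + 22))) (.var B)).eval τ' = j * N + i := by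
    intro τ τ' V i j h h1 h2 h3
    simp [IExpr.eval, h2, h3, h.idx (B + 22) (by simp), h1]
  have hcc : (cellExpr B (.const 0) (.const 0) (.var (B + 22))).cost = 12 := rfl
  refine (Runs.seq' (T' := (inverseTime f top + 100) + (500 * f N + 500 * f N))
    (Runs.mulStore hp hpB hB (v := B + 22) (s := N) (by omega)
    hσ.powers.size hN1 (by omega) (padded A N * Matrix.diagonal (paddedVec (y / c) N))
    (padded A N).transpose (paddedLaplacian A (y / c) N) (fun i j => i * N + j) hinj ?_ ?_ ?_ ?_ ?_
    (fun i _ j _ τ hτ => hcell hτ hσ.powers.size) ?_) ?_).mono (by omega) (fun _ h => h)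
  · simp [RExpr.cost, IExpr.cost, hcc]
  · simp [RExpr.cost, IExpr.cost, hcc]
  · simp [RExpr.cost, IExpr.cost, hcc]
  · intro i j τ hτ hi hj
    simp only [RExpr.eval, hcell hτ hσ.powers.size hi hj]
    rw [hτ.val (B + 20) (by simp), hσ.matrix i j, Matrix.mul_diagonal]
    by_cases hjn : (j : ℕ) < n
    · rw [paddedVec, dif_pos hjn, hτ.val (B + 13) (by simp), hτ.val (B + 21) (by simp)]
      simp only [IExpr.eval, hj]
      rw [hyσ ⟨j, hjn⟩, hσ.cost ⟨j, hjn⟩]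
      rfl
    -- Beyond the column `n` the cells of the point and of the costs hold arbitrary values; the zero
    -- column of the padded matrix makes them irrelevant.
    · rw [padded_col A i (by omega)]
      simp
  · intro i j τ hτ hi hj
    simp only [RExpr.eval, hcell' hτ hσ.powers.size hi hj]
    rw [hτ.val (B + 20) (by simp), hσ.matrix j i]
    rfl
  · intro i j τ hτ hi hj h2 _
    simp only [RExpr.eval, hcell hτ hσ.powers.size hi hj, h2]
    rw [hτ.val (B + 22) (by simp), hσ.pad i j]
    rfl
  rintro σ₁ ⟨hF₁, hM₁, -⟩
  replace hF₁ : Frame (Set.Iio (B + 8)) (Set.Iio (B + 6)) σ σ₁ :=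
    hF₁.mono (by intro a; simp; omega) (by intro a; simp; omega)
  have hσ₁ := hσ.frame hF₁ (by omega) (by omega)
  have hblock : σ₁.block (B + 3) N 0 0 N = paddedLaplacian A (y / c) N := by
    ext i j
    simp only [State.block, zero_add]
    exact hM₁ i j
  refine Runs.seq' (Runs.inverseCmd hp hpB hB hσ₁.powers
    (by rw [← hN, hblock]; exact paddedLaplacian_posDef hA hw hm hn)) ?_
  rintro σ₂ ⟨hF₂, hM₂⟩
  rw [← hN, hblock] at hM₂
  replace hF₂ : Frame (Set.Iio (B + 8)) (Set.Iio (B + 6)) σ σ₂ :=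
    hF₁.trans (hF₂.mono (by intro a; simp) (by intro a; simp; omega))
  have hσ₂ := hσ.frame hF₂ (by omega) (by omega)
  refine Runs.seq' (Runs.mulBlocks hp hpB hB (v := B + 22) (s := N) (R₁ := 0) (C₁ := 0) (W₁ := N)
    (R₂ := 0) (C₂ := 0) (W₂ := N) (R := 0) (C := 0) (W := N) (by omega) hσ₂.powers.size hN1
    (by omega) (by omega) (by omega) (by omega)
    (by simp [IExpr.cost]) (by simp [IExpr.Above])
    (by simp [IExpr.eval, hσ₂.powers.size, hN])) ?_
  rintro σ₃ ⟨hF₃, hU₃, -⟩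
  replace hF₃ : Frame (Set.Iio (B + 8)) (Set.Iio (B + 6)) σ σ₃ :=
    hF₂.trans (hF₃.mono (by intro a; simp; omega) (by intro a; simp; omega))
  have hσ₃ := hσ.frame hF₃ (by omega) (by omega)
  have hA₂ : σ₂.block (B + 20) N 0 0 N = padded A N := by
    ext i j
    simp only [State.block, zero_add]
    exact hσ₂.matrix i j
  rw [hM₂, hA₂] at hU₃
  simp only [Rat.cast_zero, zero_smul, Rat.cast_one, one_smul, zero_add] at hU₃
  refine (Runs.mulStore hp hpB hB (v := B + 22) (s := N) (by omega)
    hσ₃.powers.size hN1 (by omega) (padded A N).transpose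
    ((paddedLaplacian A (y / c) N)⁻¹ * padded A N)
    ((padded A N).transpose * ((paddedLaplacian A (y / c) N)⁻¹ * padded A N))
    (fun i j => i * N + j) hinj ?_ ?_ ?_ ?_ ?_
    (fun i _ j _ τ hτ => hcell hτ hσ₃.powers.size) ?_).mono le_rfl ?_
  · simp [RExpr.cost, IExpr.cost, hcc]
  · simp [RExpr.cost, IExpr.cost, hcc]
  · simp [RExpr.cost, IExpr.cost, hcc]
  · intro i j τ hτ hi hj
    simp only [RExpr.eval, hcell' hτ hσ₃.powers.size hi hj]
    rw [hτ.val (B + 20) (by simp), hσ₃.matrix j i]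
    rfl
  · intro i j τ hτ hi hj
    simp only [RExpr.eval, hcell hτ hσ₃.powers.size hi hj]
    rw [hτ.val (B + 4) (by simp), ← hU₃]
    simp [State.block]
  · intro i j τ hτ hi hj h2 _
    simp only [RExpr.eval, hcell hτ hσ₃.powers.size hi hj, h2]
  · rintro τ ⟨hF, hR, -⟩
    refine ⟨hF₃.trans (hF.mono (by intro a; simp; omega) (by intro a; simp; omega)), fun i j => ?_⟩
    rw [← padded_response hA hw hm hn]
    exact hR (Fin.castLE hn i) (Fin.castLE hn j)

end RealRAM

/-! ### Measuring the two quantities that limit the step -/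

namespace RealRAM

open Physarum

/-- A loop that stores a value in a cell for each value of the loop variable. -/
theorem Runs.fillVal {v d : ℕ} {e pe : IExpr} {re : RExpr} {σ : State} {n : ℕ} (pos : ℕ → ℕ)
    (F : ℕ → ℝ) (hinj : ∀ i < n, ∀ j < n, pos i = pos j → i = j)
    (he : ∀ σ', Frame {v} {d} σ σ' → e.eval σ' = n)
    (hpe : ∀ j < n, ∀ σ', Frame {v} {d} σ σ' → σ'.idx v 0 = j → pe.eval σ' = pos j)
    (hre : ∀ j < n, ∀ σ', Frame {v} {d} σ σ' → σ'.idx v 0 = j →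
      σ'.val d (pos j) = σ.val d (pos j) →
      (∀ x, (∀ i < n, x ≠ pos i) → σ'.val d x = σ.val d x) → re.eval σ' = F j) :
    Runs (RealRAM.forLoop v e (.setVal d pe re)) σ
      (n * (pe.cost + re.cost + 1 + e.cost + 9) + e.cost + 9) fun σ' =>
      Frame {v} {d} σ σ' ∧ (∀ j < n, σ'.val d (pos j) = F j) ∧
        ∀ x, (∀ i < n, x ≠ pos i) → σ'.val d x = σ.val d x := by
  refine Runs.fill pos F hinj he fun j hj σ' hσ' hjσ hx => Runs.setVal le_rfl ?_
  rw [hpe j hj σ' hσ' hjσ, hre j hj σ' hσ' hjσ (hx _ fun i hi h => ?_)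
    fun x h => hx x fun i hi => h i (by omega)]
  have := hinj j hj i (by omega) h
  omega

/-- Nested loops that add up expressions in the cells `pos j` of the value array `d`. -/
theorem Runs.accumulateVal {v w d : ℕ} {e f pe : IExpr} {re : RExpr} {σ : State} {r n : ℕ}
    (hvw : v ≠ w) (pos : ℕ → ℕ) (F : ℕ → ℕ → ℝ)
    (hinj : ∀ i < n, ∀ j < n, pos i = pos j → i = j)
    (he : ∀ σ', Frame {v, w} {d} σ σ' → e.eval σ' = r)
    (hf : ∀ σ', Frame {v, w} {d} σ σ' → f.eval σ' = n)
    (hpe : ∀ j < n, ∀ σ', Frame {v, w} {d} σ σ' → σ'.idx w 0 = j → pe.eval σ' = pos j)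
    (hre : ∀ i < r, ∀ j < n, ∀ σ', Frame {v, w} {d} σ σ' → σ'.idx v 0 = i → σ'.idx w 0 = j →
      (∀ x, (∀ j < n, x ≠ pos j) → σ'.val d x = σ.val d x) → re.eval σ' = F i j) :
    Runs (RealRAM.forLoop v e (RealRAM.forLoop w f (.setVal d pe (.add (.load d pe) re)))) σ
      (r * ((n * (2 * pe.cost + re.cost + 3 + f.cost + 9) + f.cost + 9) + e.cost + 9) +
        e.cost + 9) fun σ' =>
      Frame {v, w} {d} σ σ' ∧
        (∀ j < n, σ'.val d (pos j) = σ.val d (pos j) + ∑ i ∈ Finset.range r, F i j) ∧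
        ∀ x, (∀ j < n, x ≠ pos j) → σ'.val d x = σ.val d x := by
  refine Runs.accumulate hvw pos F hinj he hf fun i hi j hj σ' hσ' hiσ hjσ hx =>
    Runs.setVal (by simp [RExpr.cost]; omega) ?_
  simp only [RExpr.eval, hpe j hj σ' hσ' hjσ, hre i hi j hj σ' hσ' hiσ hjσ hx]

/-- Store in the cell `0` of `d` the maximum of `1` and the absolute values of the first `e` cells
of `a`. -/
def supNormCmd (v a d : ℕ) (e : IExpr) : Cmd :=
  .seq (.setVal d (.const 0) (.const 1))
    (forLoop v e
      (.ite (.realLt (.load d (.const 0)) (.load a (.var v)))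
        (.setVal d (.const 0) (.load a (.var v)))
        (.ite (.realLt (.load d (.const 0)) (.sub (.const 0) (.load a (.var v))))
          (.setVal d (.const 0) (.sub (.const 0) (.load a (.var v))))
          .skip)))

theorem Runs.supNormCmd {v a d n : ℕ} {e : IExpr} {σ : State} (had : a ≠ d)
    (he : ∀ σ', Frame {v} {d} σ σ' → e.eval σ' = n) (q : Fin n → ℝ)
    (hq : ∀ j : Fin n, σ.val a j = q j) :
    Runs (supNormCmd v a d e) σ (n * (e.cost + 35) + e.cost + 12) fun σ' =>
      Frame {v} {d} σ σ' ∧ σ'.val d 0 = max 1 ‖q‖ := by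
  have key : Runs (RealRAM.supNormCmd v a d e) σ (3 + (n * (26 + e.cost + 9) + e.cost + 9))
      fun σ' => σ'.idx v 0 = n ∧ Frame {v} {d} σ σ' ∧ 1 ≤ σ'.val d 0 ∧
        (∀ j : Fin n, (j : ℕ) < n → |q j| ≤ σ'.val d 0) ∧
        (σ'.val d 0 = 1 ∨ ∃ j : Fin n, σ'.val d 0 = |q j|) := by
    refine Runs.seq (Runs.setVal (by simp [IExpr.cost, RExpr.cost]) ?_)
    refine Runs.forLoop (fun k σ' => σ'.idx v 0 = k ∧ Frame {v} {d} σ σ' ∧ 1 ≤ σ'.val d 0 ∧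
        (∀ j : Fin n, (j : ℕ) < k → |q j| ≤ σ'.val d 0) ∧
        (σ'.val d 0 = 1 ∨ ∃ j : Fin n, σ'.val d 0 = |q j|)) ?_ ?_ ?_
    · refine ⟨by simp, ((Frame.refl _ _ _).setVal (by simp) _ _).setIdx (by simp) _ _, ?_, by simp,
        Or.inl ?_⟩ <;> simp [IExpr.eval, RExpr.eval]
    · rintro k - σ' ⟨h1, h2, -⟩
      exact ⟨h1, he _ h2⟩
    · rintro k hk σ' ⟨h1, h2, h3, h4, h5⟩
      have ha : σ'.val a k = q ⟨k, hk⟩ := by rw [h2.val a (by simpa using had), ← hq ⟨k, hk⟩]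
      have hval : ∀ z : ℝ, σ'.val d 0 ≤ z → z = |q ⟨k, hk⟩| →
          (σ'.setVal d 0 z).idx v 0 = k ∧ ((σ'.setVal d 0 z).setIdx v 0 (k + 1)).idx v 0 = k + 1 ∧
          Frame {v} {d} σ ((σ'.setVal d 0 z).setIdx v 0 (k + 1)) ∧
          1 ≤ ((σ'.setVal d 0 z).setIdx v 0 (k + 1)).val d 0 ∧
          (∀ j : Fin n, (j : ℕ) < k + 1 → |q j| ≤
            ((σ'.setVal d 0 z).setIdx v 0 (k + 1)).val d 0) ∧
          (((σ'.setVal d 0 z).setIdx v 0 (k + 1)).val d 0 = 1 ∨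
            ∃ j : Fin n, ((σ'.setVal d 0 z).setIdx v 0 (k + 1)).val d 0 = |q j|) := by
        intro z hz hzq
        refine ⟨by simpa using h1, by simp, (h2.setVal (by simp) _ _).setIdx (by simp) _ _, ?_, ?_,
          Or.inr ⟨⟨k, hk⟩, by simpa using hzq⟩⟩
        · simp; linarith
        · intro j hj
          simp only [State.setIdx_val, State.setVal_val_self]
          rcases Nat.lt_succ_iff_lt_or_eq.1 hj with h | h
          · exact (h4 j h).trans hz
          · have : j = ⟨k, hk⟩ := Fin.ext h
            rw [this, hzq]
      refine (Runs.ite (T := 19) (fun h => ?_) (fun h => ?_)).mono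
        (by simp [Test.cost, RExpr.cost, IExpr.cost]) (fun _ h => h)
      · simp only [Test.Holds, RExpr.eval, IExpr.eval, h1, ha] at h
        refine Runs.setVal (by simp [RExpr.cost, IExpr.cost]) ?_
        simp only [RExpr.eval, IExpr.eval, h1, ha]
        exact hval _ h.le (abs_of_nonneg (by linarith)).symm
      · simp only [Test.Holds, RExpr.eval, IExpr.eval, h1, ha, not_lt] at h
        refine (Runs.ite (T := 10) (fun h' => ?_) (fun h' => ?_)).mono
          (by simp [Test.cost, RExpr.cost, IExpr.cost]) (fun _ h => h)
        · simp only [Test.Holds, RExpr.eval, IExpr.eval, h1, ha, Rat.cast_zero] at h'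
          refine Runs.setVal (by simp [RExpr.cost, IExpr.cost]) ?_
          simp only [RExpr.eval, IExpr.eval, h1, ha, Rat.cast_zero]
          refine hval _ h'.le ?_
          rw [abs_of_nonpos (by linarith)]; ring
        · simp only [Test.Holds, RExpr.eval, IExpr.eval, h1, ha, Rat.cast_zero, not_lt] at h'
          refine Runs.skip (by omega) ⟨h1, by simp, h2.setIdx (by simp) _ _, by simpa using h3, ?_,
            by simpa using h5⟩
          intro j hj
          simp only [State.setIdx_val]
          rcases Nat.lt_succ_iff_lt_or_eq.1 hj with h'' | h''
          · exact h4 j h''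
          · have : j = ⟨k, hk⟩ := Fin.ext h''
            rw [this, abs_le]
            constructor <;> linarith
  refine key.mono (by ring_nf; omega) ?_
  rintro σ' ⟨-, h2, h3, h4, h5⟩
  refine ⟨h2, le_antisymm ?_ (max_le h3 ?_)⟩
  · rcases h5 with h | ⟨j, h⟩
    · rw [h]; exact le_max_left _ _
    · rw [h]; exact (norm_le_pi_norm q j).trans (le_max_right _ _)
  · exact (pi_norm_le_iff_of_nonneg (by linarith)).2 fun j => h4 j j.2

/-- Compute `R y`, for the matrix `R` in the value array `B + 5` and the point `y` in the value
array `B + 13`, and the bounds that control the step size. -/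
def normsCmd (B : ℕ) : Cmd :=
  .seq (forLoop B (.var (B + 21)) (.setVal (B + 6) (.var B) (.const 0)))
    (.seq (forLoop B (.var (B + 21)) (forLoop (B + 1) (.var (B + 21))
        (.ite (.realLt (.load (B + 5) (.add (.mul (.var (B + 1)) (.var (B + 22))) (.var B)))
            (.const 0))
          (.setVal (B + 6) (.var (B + 1)) (.sub (.load (B + 6) (.var (B + 1)))
            (.mul (.load (B + 5) (.add (.mul (.var (B + 1)) (.var (B + 22))) (.var B)))
              (.div (.load (B + 13) (.var B)) (.load (B + 21) (.var B))))))
          (.setVal (B + 6) (.var (B + 1)) (.add (.load (B + 6) (.var (B + 1)))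
            (.mul (.load (B + 5) (.add (.mul (.var (B + 1)) (.var (B + 22))) (.var B)))
              (.div (.load (B + 13) (.var B)) (.load (B + 21) (.var B)))))))))
    (.seq (supNormCmd B (B + 6) (B + 8) (.var (B + 21)))
    (.seq (forLoop B (.var (B + 21)) (.setVal (B + 7) (.var B) (.const 0)))
    (.seq (forLoop B (.var (B + 21)) (forLoop (B + 1) (.var (B + 21))
        (.setVal (B + 7) (.var (B + 1)) (.add (.load (B + 7) (.var (B + 1)))
          (.mul (.load (B + 5) (.add (.mul (.var (B + 1)) (.var (B + 22))) (.var B)))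
            (.load (B + 13) (.var B)))))))
      (supNormCmd B (B + 7) (B + 9) (.var (B + 21)))))))

/-- The weights are positive, so `∑ |R j k| * w k` is the absolute row sum of the projection `R W`.
The one matrix `R` thus yields both bounds, and the projection itself is never stored. -/
theorem Runs.normsCmd {m n : ℕ} {B top : ℕ} {A : Matrix (Fin m) (Fin n) ℝ}
    {c x₀ y : Fin n → ℝ} {T ε : ℝ} (hn : 1 ≤ n) (hc : ∀ j, 0 < c j) (hy : ∀ j, 0 < y j)
    {σ : State} (hσ : DataStored B top A c x₀ T ε σ)
    (hR : ∀ i j : Fin n, σ.val (B + 5) (i * 2 ^ top + j) = response A (y / c) i j)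
    (hyσ : ∀ j : Fin n, σ.val (B + 13) j = y j) :
    Runs (RealRAM.normsCmd B) σ (500 * n ^ 2) fun σ' =>
      Frame (Set.Iio (B + 8)) (Set.Ico (B + 6) (B + 10)) σ σ' ∧
      (∀ j : Fin n, σ'.val (B + 7) j = (response A (y / c)).mulVec y j) ∧
      σ'.val (B + 8) 0 = amplification A c y ∧ σ'.val (B + 9) 0 = flowBound A c y := by
  have hvar : ∀ {τ τ' : State} {I V : Set ℕ}, Frame I V τ τ' → (B + 21) ∉ I →
      τ.idx (B + 21) 0 = n → (IExpr.var (B + 21)).eval τ' = n := fun h hI h1 => by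
    simp only [IExpr.eval]; rw [h.idx _ hI, h1]
  have hmono : ∀ {I V : Set ℕ} {τ τ' : State}, Frame I V τ τ' → I ⊆ Set.Iio (B + 8) →
      V ⊆ Set.Ico (B + 6) (B + 10) →
      Frame (Set.Iio (B + 8)) (Set.Ico (B + 6) (B + 10)) τ τ' := fun h h1 h2 => h.mono h1 h2
  have hB1 : ({B} : Set ℕ) ⊆ Set.Iio (B + 8) := by intro a; simp; omega
  have hB2 : ({B, B + 1} : Set ℕ) ⊆ Set.Iio (B + 8) := by intro a; simp; omega
  refine (Runs.seq' (T := n * 17 + 11) (T' := n * (n * 50 + 30) + 11 + (n * 37 + 14 +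
    (n * 17 + 11 + (n * (n * 50 + 30) + 11 + (n * 37 + 14))))) ((Runs.fillVal (fun j => j)
    (fun _ => 0) (fun _ _ _ _ h => h) (fun τ hτ => hvar hτ (by simp) hσ.cols)
    (fun j _ τ _ h => by simpa [IExpr.eval] using h) (by intros; simp [RExpr.eval])).mono
    (by simp [IExpr.cost, RExpr.cost]; omega) fun _ h => h) ?_).mono ?_ (fun _ h => h)
  swap
  · have : n ≤ n ^ 2 := by nlinarith
    have : 1 ≤ n ^ 2 := by nlinarith
    ring_nf; ring_nf at *; omega
  rintro σ₁ ⟨hF₁, h0₁, -⟩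
  have hn₁ : σ₁.idx (B + 21) 0 = n := by rw [hF₁.idx _ (by simp), hσ.cols]
  have hN₁ : σ₁.idx (B + 22) 0 = 2 ^ top := by rw [hF₁.idx _ (by simp), hσ.powers.size]
  let F₁ : ℕ → ℕ → ℝ := fun i j =>
    |σ.val (B + 5) (j * 2 ^ top + i)| * (σ.val (B + 13) i / σ.val (B + 21) i)
  refine Runs.seq' ((Runs.accumulate (d := B + 6) (T := 35) (r := n) (n := n) (by omega) (fun j => j) F₁
    (fun _ _ _ _ h => h) (fun τ hτ => hvar hτ (by simp) hn₁) (fun τ hτ => hvar hτ (by simp) hn₁)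
    ?_).mono (by simp [IExpr.cost]; ring_nf; omega) fun _ h => h) ?_
  · intro i hi j hj τ hτ hiτ hjτ _
    have hR' : τ.val (B + 5) (j * 2 ^ top + i) = σ.val (B + 5) (j * 2 ^ top + i) := by
      rw [hτ.val _ (by simp), hF₁.val _ (by simp)]
    have hy' : τ.val (B + 13) i = σ.val (B + 13) i := by
      rw [hτ.val _ (by simp), hF₁.val _ (by simp)]
    have hc' : τ.val (B + 21) i = σ.val (B + 21) i := by
      rw [hτ.val _ (by simp), hF₁.val _ (by simp)]
    have hN' : τ.idx (B + 22) 0 = 2 ^ top := by rw [hτ.idx _ (by simp), hN₁]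
    refine (Runs.ite (T := 24) (fun h => ?_) (fun h => ?_)).mono
        (by simp [Test.cost, RExpr.cost, IExpr.cost]) (fun _ h => h)
    · simp only [Test.Holds, RExpr.eval, IExpr.eval, hiτ, hjτ, hN', hR', Rat.cast_zero] at h
      refine Runs.setVal (by simp [RExpr.cost, IExpr.cost]) ?_
      simp only [RExpr.eval, IExpr.eval, hiτ, hjτ, hN', hR', hy', hc', F₁, abs_of_neg h]
      congr 1; ring
    · simp only [Test.Holds, RExpr.eval, IExpr.eval, hiτ, hjτ, hN', hR', Rat.cast_zero,
        not_lt] at h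
      refine Runs.setVal (by simp [RExpr.cost, IExpr.cost]) ?_
      simp only [RExpr.eval, IExpr.eval, hiτ, hjτ, hN', hR', hy', hc', F₁, abs_of_nonneg h]
  rintro σ₂ ⟨hF₂, hs₂, -⟩
  have hn₂ : σ₂.idx (B + 21) 0 = n := by rw [hF₂.idx _ (by simp), hn₁]
  have hrow : ∀ j : Fin n, σ₂.val (B + 6) j = ∑ k, |projection A (y / c) j k| := by
    intro j
    rw [hs₂ j j.2, h0₁ j j.2, zero_add, Finset.sum_range]
    refine Finset.sum_congr rfl fun k _ => ?_
    simp only [F₁, hR j k, hyσ, hσ.cost, projection, Matrix.mul_diagonal, Pi.div_apply, abs_mul]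
    rw [abs_of_pos (div_pos (hy k) (hc k))]
  refine Runs.seq' ((Runs.supNormCmd (by omega) (fun τ hτ => hvar hτ (by simp) hn₂) _ hrow).mono
    (by simp [IExpr.cost]) fun _ h => h) ?_
  rintro σ₃ ⟨hF₃, hα⟩
  have hn₃ : σ₃.idx (B + 21) 0 = n := by rw [hF₃.idx _ (by simp), hn₂]
  refine Runs.seq' ((Runs.fillVal (n := n) (fun j => j)
    (fun _ => 0) (fun _ _ _ _ h => h) (fun τ hτ => hvar hτ (by simp) hn₃)
    (fun j _ τ _ h => by simpa [IExpr.eval] using h) (by intros; simp [RExpr.eval])).mono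
    (by simp [IExpr.cost, RExpr.cost]; omega) fun _ h => h) ?_
  rintro σ₄ ⟨hF₄, h0₄, -⟩
  have hn₄ : σ₄.idx (B + 21) 0 = n := by rw [hF₄.idx _ (by simp), hn₃]
  have hF₄' : Frame (Set.Iio (B + 8)) (Set.Ico (B + 6) (B + 10)) σ σ₄ :=
    ((hmono hF₁ hB1 (by intro a; simp; omega)).trans
      (hmono hF₂ hB2 (by intro a; simp; omega))).trans
      ((hmono hF₃ hB1 (by intro a; simp; omega)).trans (hmono hF₄ hB1 (by intro a; simp; omega)))
  let F₂ : ℕ → ℕ → ℝ := fun i j => σ.val (B + 5) (j * 2 ^ top + i) * σ.val (B + 13) i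
  refine Runs.seq' ((Runs.accumulateVal (r := n) (n := n) (by omega) (fun j => j) F₂
    (fun _ _ _ _ h => h) (fun τ hτ => hvar hτ (by simp) hn₄) (fun τ hτ => hvar hτ (by simp) hn₄)
    (fun j _ τ _ h => by simpa [IExpr.eval] using h)
    ?_).mono (by simp [IExpr.cost, RExpr.cost]; ring_nf; omega) fun _ h => h) ?_
  · intro i hi j hj τ hτ hiτ hjτ _
    simp only [RExpr.eval, IExpr.eval, hiτ, hjτ, F₂]
    rw [hτ.val _ (by simp), hF₄'.val _ (by simp), hτ.val _ (by simp), hF₄'.val _ (by simp),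
      hτ.idx _ (by simp), hF₄'.idx _ (by simp), hσ.powers.size]
  rintro σ₅ ⟨hF₅, hs₅, -⟩
  have hn₅ : σ₅.idx (B + 21) 0 = n := by rw [hF₅.idx _ (by simp), hn₄]
  have hflow : ∀ j : Fin n, σ₅.val (B + 7) j = (response A (y / c)).mulVec y j := by
    intro j
    rw [hs₅ j j.2, h0₄ j j.2, zero_add, Finset.sum_range]
    refine Finset.sum_congr rfl fun k _ => ?_
    simp only [F₂, hR j k, hyσ]
  refine (Runs.supNormCmd (by omega) (fun τ hτ => hvar hτ (by simp) hn₅) _ hflow).mono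
    (by simp [IExpr.cost]) ?_
  rintro σ₆ ⟨hF₆, hβ⟩
  refine ⟨hF₄'.trans ((hmono hF₅ hB2 (by intro a; simp; omega)).trans
    (hmono hF₆ hB1 (by intro a; simp; omega))), fun j => ?_, ?_, hβ⟩
  · rw [hF₆.val _ (by simp), hflow j]
  · rw [hF₆.val _ (by simp), hF₅.val _ (by simp), hF₄.val _ (by simp), hα]
    rfl

/-- `R`, `R y` and the bounds that control the step size at the point `y` are in the arrays of
the solver. -/
structure MeasuredAt {m n : ℕ} (B top : ℕ) (A : Matrix (Fin m) (Fin n) ℝ) (c y : Fin n → ℝ)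
    (σ : State) : Prop where
  response : ∀ i j : Fin n, σ.val (B + 5) (i * 2 ^ top + j) = response A (y / c) i j
  flow : ∀ j : Fin n, σ.val (B + 7) j = (Physarum.response A (y / c)).mulVec y j
  amplification : σ.val (B + 8) 0 = amplification A c y
  flowBound : σ.val (B + 9) 0 = flowBound A c y

theorem Runs.measureCmd {m n : ℕ} {p : Cmd} {f : ℕ → ℕ} {B top : ℕ} (hp : Multiplies p f)
    (hpB : p.bound ≤ B) (hB : 7 ≤ B) {A : Matrix (Fin m) (Fin n) ℝ} (hA : A.rank = m)
    {c x₀ y : Fin n → ℝ} {T ε : ℝ} (hn1 : 1 ≤ n) (hc : ∀ j, 0 < c j) (hy : ∀ j, 0 < y j)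
    {σ : State} (hσ : DataStored B top A c x₀ T ε σ) (hm : m ≤ 2 ^ top) (hn : n ≤ 2 ^ top)
    (hyσ : ∀ j : Fin n, σ.val (B + 13) j = y j) :
    Runs (.seq (RealRAM.responseCmd p B) (RealRAM.normsCmd B)) σ
      (inverseTime f top + 2100 * f (2 ^ top)) fun σ' =>
      Frame (Set.Iio (B + 8)) (Set.Iio (B + 10)) σ σ' ∧ MeasuredAt B top A c y σ' := by
  have hf : n ^ 2 ≤ f (2 ^ top) :=
    (Nat.pow_le_pow_left hn 2).trans (hp.sq_le Nat.one_le_two_pow)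
  refine (Runs.seq' (Runs.responseCmd hp hpB hB hA hc hy hσ hm hn hyσ) (T' := 500 * n ^ 2)
    ?_).mono (by omega) (fun _ h => h)
  rintro σ₁ ⟨hF₁, hR⟩
  refine (Runs.normsCmd hn1 hc hy (hσ.frame hF₁ (by omega) (by omega)) hR
    fun j => ?_).mono le_rfl ?_
  · rw [hF₁.val _ (by simp), hyσ]
  · rintro σ₂ ⟨hF₂, h1, h2, h3⟩
    refine ⟨(hF₁.mono le_rfl (by intro a; simp; omega)).trans
      (hF₂.mono le_rfl (by intro a; simp)), fun i j => ?_, h1, h2, h3⟩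
    rw [hF₂.val _ (by simp), hR]

end RealRAM

/-! ### The Taylor recurrence in memory -/

namespace RealRAM

open Physarum

theorem row_pos_ne {n i i' j j' : ℕ} (hj : j < n) (hj' : j' < n) (h : i ≠ i') :
    i * n + j ≠ i' * n + j' := fun he =>
  h (block_pos_inj (stride := n) (r₀ := 0) (c₀ := 0) (n := n) (by omega) hj hj'
    (by simpa using he)).1

/-- Compute the coefficient `B + 8` of the power series for `Q` and the next one for the
solution. -/
def taylorStep (B : ℕ) : Cmd :=
  .seq (forLoop B (.var (B + 21)) (.setVal (B + 12) (.var B) (.const 0)))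
    (.seq (forLoop B (.var (B + 8)) (forLoop (B + 1) (.var (B + 21))
        (.setVal (B + 12) (.var (B + 1)) (.add (.load (B + 12) (.var (B + 1)))
          (.mul (.load (B + 11)
              (.add (.mul (.add (.var B) (.const 1)) (.var (B + 21))) (.var (B + 1))))
            (.div (.load (B + 10) (.add (.mul (.sub (.sub (.var (B + 8)) (.const 1)) (.var B))
              (.var (B + 21))) (.var (B + 1)))) (.load (B + 21) (.var (B + 1)))))))))
    (.seq (forLoop B (.var (B + 21)) (.setVal (B + 10)
        (.add (.mul (.var (B + 8)) (.var (B + 21))) (.var B))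
        (.mul (.ofIdx (.sub (.const 1) (.var (B + 8)))) (.load (B + 7) (.var B)))))
    (.seq (forLoop B (.var (B + 21)) (forLoop (B + 1) (.var (B + 21))
        (.setVal (B + 10) (.add (.mul (.var (B + 8)) (.var (B + 21))) (.var (B + 1)))
          (.add (.load (B + 10) (.add (.mul (.var (B + 8)) (.var (B + 21))) (.var (B + 1))))
            (.sub (.const 0)
              (.mul (.load (B + 5) (.add (.mul (.var (B + 1)) (.var (B + 22))) (.var B)))
                (.load (B + 12) (.var B))))))))
      (forLoop B (.var (B + 21)) (.setVal (B + 11)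
        (.add (.mul (.add (.var (B + 8)) (.const 1)) (.var (B + 21))) (.var B))
        (.div (.mul (.load (B + 14) (.const 0)) (.sub (.add (.load (B + 12) (.var B))
            (.mul (.div (.load (B + 13) (.var B)) (.load (B + 21) (.var B)))
              (.load (B + 10) (.add (.mul (.var (B + 8)) (.var (B + 21))) (.var B)))))
            (.load (B + 11) (.add (.mul (.var (B + 8)) (.var (B + 21))) (.var B)))))
          (.add (.ofIdx (.var (B + 8))) (.const 1))))))))

/-- The array `B + 11` holds `y * ξ k` rather than `ξ k`. The convolution then comes out, after
division by `c`, with the weights already attached, so that applying `R` to it is applying the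
projection. The degree `k` costs `O(n k)` for the convolution and `O(n²)` for the matrix. -/
theorem Runs.taylorStep {m n : ℕ} {B top : ℕ} {A : Matrix (Fin m) (Fin n) ℝ}
    {c x₀ y : Fin n → ℝ} {T ε h : ℝ} (hn : 1 ≤ n) {σ₀ : State}
    (hσ₀ : DataStored B top A c x₀ T ε σ₀) (hm : MeasuredAt B top A c y σ₀)
    (hy : ∀ j : Fin n, σ₀.val (B + 13) j = y j) (hh : σ₀.val (B + 14) 0 = h)
    {ξ q : ℕ → Fin n → ℝ} (hξ : IsTaylor (Matrix.mulVecLin (projection A (y / c)))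
      (fun j => 1 / c j) ((response A (y / c)).mulVec y) h ξ q)
    {σ : State} (hσ : Frame (Set.Iio (B + 9)) (Set.Ico (B + 10) (B + 13)) σ₀ σ) {k : ℕ}
    (hk : σ.idx (B + 8) 0 = k)
    (hX : ∀ i ≤ k, ∀ j : Fin n, σ.val (B + 11) (i * n + j) = y j * ξ i j)
    (hQ : ∀ i < k, ∀ j : Fin n, σ.val (B + 10) (i * n + j) = q i j) :
    Runs (taylorStep B) σ (350 * n * (n + k)) fun σ' =>
      Frame (Set.Iio (B + 9)) (Set.Ico (B + 10) (B + 13)) σ₀ σ' ∧ σ'.idx (B + 8) 0 = k ∧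
      (∀ i ≤ k + 1, ∀ j : Fin n, σ'.val (B + 11) (i * n + j) = y j * ξ i j) ∧
      ∀ i < k + 1, ∀ j : Fin n, σ'.val (B + 10) (i * n + j) = q i j := by
  have hidx : ∀ {τ τ' : State} {V : Set ℕ} {a : ℕ}, Frame {B, B + 1} V τ τ' → B + 2 ≤ a →
      τ'.idx a = τ.idx a := fun h ha => h.idx _ (by simp; omega)
  have hcard : n ≤ n * n := by nlinarith
  have hcol : σ.idx (B + 21) 0 = n := by rw [hσ.idx _ (by simp), hσ₀.cols]
  have hN : σ.idx (B + 22) 0 = 2 ^ top := by rw [hσ.idx _ (by simp), hσ₀.powers.size]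
  have hI1 : ∀ {V : Set ℕ} {τ τ' : State}, Frame {B} V τ τ' → Frame {B, B + 1} V τ τ' :=
    fun h => h.mono (by simp) le_rfl
  have hvar : ∀ {τ τ' : State} {V : Set ℕ} {a k : ℕ}, Frame {B, B + 1} V τ τ' → B + 2 ≤ a →
      τ.idx a 0 = k → (IExpr.var a).eval τ' = k := fun h ha h1 => by
    simp only [IExpr.eval]; rw [hidx h ha, h1]
  refine (Runs.seq' (T := n * 17 + 11) (T' := k * (n * 55 + 30) + 11 + (n * 40 + 11 +
    (n * (n * 60 + 30) + 11 + (n * 70 + 11)))) ((Runs.fillVal (n := n) (fun j => j)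
    (fun _ => 0) (fun _ _ _ _ h => h) (fun τ hτ => hvar (hI1 hτ) (by omega) hcol)
    (fun j _ τ _ h => by simpa [IExpr.eval] using h) (by intros; simp [RExpr.eval])).mono
    (by simp [IExpr.cost, RExpr.cost]; omega) fun _ h => h) ?_).mono (by nlinarith) (fun _ h => h)
  rintro σ₁ ⟨hF₁, h0₁, -⟩
  replace hF₁ := hI1 hF₁
  have hk₁ : σ₁.idx (B + 8) 0 = k := by rw [hidx hF₁ (by omega), hk]
  have hcol₁ : σ₁.idx (B + 21) 0 = n := by rw [hidx hF₁ (by omega), hcol]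
  let F₁ : ℕ → ℕ → ℝ := fun i j => σ.val (B + 11) ((i + 1) * n + j) *
    (σ.val (B + 10) ((k - 1 - i) * n + j) / σ.val (B + 21) j)
  refine Runs.seq' ((Runs.accumulateVal (n := n) (r := k) (by omega) (fun j => j) F₁
    (fun _ _ _ _ h => h) (fun τ hτ => hvar hτ (by omega) hk₁)
    (fun τ hτ => hvar hτ (by omega) hcol₁)
    (fun j _ τ _ h => by simpa [IExpr.eval] using h) ?_).mono
    (by simp [IExpr.cost, RExpr.cost]; exact Nat.mul_le_mul_left _ (by omega)) fun _ h => h) ?_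
  · intro i hi j hj τ hτ hiτ hjτ _
    simp only [RExpr.eval, IExpr.eval, hiτ, hjτ, F₁]
    rw [hidx hτ (by omega), hidx hτ (by omega), hcol₁, hk₁, hτ.val _ (by simp),
      hF₁.val _ (by simp), hτ.val _ (by simp), hF₁.val _ (by simp), hτ.val _ (by simp),
      hF₁.val _ (by simp)]
  rintro σ₂ ⟨hF₂, hS₂, -⟩
  have hS : ∀ j : Fin n, σ₂.val (B + 12) j = (y / c) j * convolution ξ q k j := by
    intro j
    rw [hS₂ j j.2, h0₁ j j.2, zero_add, convolution, Finset.sum_apply, Finset.mul_sum]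
    refine Finset.sum_congr rfl fun i hi => ?_
    rw [Finset.mem_range] at hi
    simp only [F₁]
    rw [hX (i + 1) (by omega), hQ (k - 1 - i) (by omega), hσ.val _ (by simp), hσ₀.cost]
    simp only [Pi.div_apply, Pi.mul_apply]
    ring
  have hk₂ : σ₂.idx (B + 8) 0 = k := by rw [hidx hF₂ (by omega), hk₁]
  have hcol₂ : σ₂.idx (B + 21) 0 = n := by rw [hidx hF₂ (by omega), hcol₁]
  have hq₂ : ∀ j : Fin n, σ₂.val (B + 7) j = (response A (y / c)).mulVec y j := by
    intro j
    rw [hF₂.val _ (by simp), hF₁.val _ (by simp), hσ.val _ (by simp), hm.flow]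
  -- The truncated difference `1 - k` is `1` for `k = 0` and `0` otherwise, so the inhomogeneous
  -- term enters in degree `0` only, without a branch.
  refine Runs.seq' ((Runs.fillVal (n := n) (fun j => k * n + j)
    (fun j => ((1 - k : ℕ) : ℝ) * σ₂.val (B + 7) j) (fun _ _ _ _ h => by simpa using h)
    (fun τ hτ => hvar (hI1 hτ) (by omega) hcol₂)
    (fun j _ τ hτ h => ?_) ?_).mono
    (by simp [IExpr.cost, RExpr.cost]; omega) fun _ h => h) ?_
  · simp only [IExpr.eval, h]
    rw [hidx (hI1 hτ) (by omega), hidx (hI1 hτ) (by omega), hk₂, hcol₂]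
  · intro j hj τ hτ h _ _
    simp only [RExpr.eval, IExpr.eval, h]
    rw [hidx (hI1 hτ) (by omega), hk₂, hτ.val _ (by simp)]
  rintro σ₃ ⟨hF₃, hQ₃, hQx₃⟩
  replace hF₃ := hI1 hF₃
  have hk₃ : σ₃.idx (B + 8) 0 = k := by rw [hidx hF₃ (by omega), hk₂]
  have hcol₃ : σ₃.idx (B + 21) 0 = n := by rw [hidx hF₃ (by omega), hcol₂]
  have hN₃ : σ₃.idx (B + 22) 0 = 2 ^ top := by
    rw [hidx hF₃ (by omega), hidx hF₂ (by omega), hidx hF₁ (by omega), hN]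
  have hR₃ : ∀ i j : Fin n, σ₃.val (B + 5) (i * 2 ^ top + j) = response A (y / c) i j := by
    intro i j
    rw [hF₃.val _ (by simp), hF₂.val _ (by simp), hF₁.val _ (by simp), hσ.val _ (by simp),
      hm.response]
  have hS₃ : ∀ j : Fin n, σ₃.val (B + 12) j = (y / c) j * convolution ξ q k j := by
    intro j; rw [hF₃.val _ (by simp), hS]
  refine Runs.seq' ((Runs.accumulateVal (n := n) (r := n) (by omega) (fun j => k * n + j)
    (fun i j => -(σ₃.val (B + 5) (j * 2 ^ top + i) * σ₃.val (B + 12) i))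
    (fun _ _ _ _ h => by simpa using h) (fun τ hτ => hvar hτ (by omega) hcol₃)
    (fun τ hτ => hvar hτ (by omega) hcol₃)
    (fun j _ τ hτ h => ?_) ?_).mono
    (by simp [IExpr.cost, RExpr.cost]; exact Nat.mul_le_mul_left _ (by omega)) fun _ h => h) ?_
  · simp only [IExpr.eval, h]
    rw [hidx hτ (by omega), hidx hτ (by omega), hk₃, hcol₃]
  · intro i hi j hj τ hτ hiτ hjτ _
    simp only [RExpr.eval, IExpr.eval, hiτ, hjτ, Rat.cast_zero, zero_sub]
    rw [hidx hτ (by omega), hN₃, hτ.val _ (by simp), hτ.val _ (by simp)]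
  rintro σ₄ ⟨hF₄, hQ₄, hQx₄⟩
  have hk₄ : σ₄.idx (B + 8) 0 = k := by rw [hidx hF₄ (by omega), hk₃]
  have hcol₄ : σ₄.idx (B + 21) 0 = n := by rw [hidx hF₄ (by omega), hcol₃]
  have hqk : ∀ j : Fin n, σ₄.val (B + 10) (k * n + j) = q k j := by
    intro j
    rw [hQ₄ j j.2, hQ₃ j j.2, hq₂, hξ.q_eq k, Matrix.mulVecLin_apply, projection_mulVec,
      Pi.sub_apply, Finset.sum_range, sub_eq_add_neg, Finset.sum_neg_distrib]
    congr 1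
    · rcases Nat.eq_zero_or_pos k with rfl | h
      · simp
      · rw [Nat.sub_eq_zero_of_le h, if_neg (by omega)]; simp
    · refine congrArg _ (Finset.sum_congr rfl fun i _ => ?_)
      rw [hR₃, hS₃]
      rfl
  have hval₄ : ∀ a, (a < B + 10 ∨ B + 13 ≤ a) → σ₄.val a = σ₀.val a := by
    intro a ha
    rw [hF₄.val _ (by simp; omega), hF₃.val _ (by simp; omega), hF₂.val _ (by simp; omega),
      hF₁.val _ (by simp; omega), hσ.val _ (by simp; omega)]
  have hX₄ : σ₄.val (B + 11) = σ.val (B + 11) := by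
    rw [hF₄.val _ (by simp), hF₃.val _ (by simp), hF₂.val _ (by simp),
      hF₁.val _ (by simp)]
  have hS₄ : ∀ j : Fin n, σ₄.val (B + 12) j = (y / c) j * convolution ξ q k j := by
    intro j; rw [hF₄.val _ (by simp), hS₃]
  let F₅ : ℕ → ℝ := fun j => σ₄.val (B + 14) 0 * (σ₄.val (B + 12) j +
    σ₄.val (B + 13) j / σ₄.val (B + 21) j * σ₄.val (B + 10) (k * n + j) -
    σ₄.val (B + 11) (k * n + j)) / (k + 1)
  refine (Runs.fillVal (n := n) (fun j => (k + 1) * n + j) F₅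
    (fun _ _ _ _ h => by simpa using h) (fun τ hτ => hvar (hI1 hτ) (by omega) hcol₄)
    (fun j _ τ hτ h => ?_) ?_).mono (by simp [IExpr.cost, RExpr.cost]; gcongr; omega) ?_
  · simp only [IExpr.eval, h]
    rw [hidx (hI1 hτ) (by omega), hidx (hI1 hτ) (by omega), hk₄, hcol₄]
  · intro j hj τ hτ h _ hx
    simp only [RExpr.eval, IExpr.eval, h, F₅]
    rw [hidx (hI1 hτ) (by omega), hidx (hI1 hτ) (by omega), hk₄, hcol₄, hτ.val (B + 14) (by simp),
      hτ.val (B + 12) (by simp), hτ.val (B + 13) (by simp), hτ.val (B + 21) (by simp),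
      hτ.val (B + 10) (by simp), hx _ fun i hi => row_pos_ne hj hi (by omega)]
    norm_num
  rintro σ₅ ⟨hF₅, hX₅, hXx₅⟩
  replace hF₅ := hI1 hF₅
  have hF : Frame {B, B + 1} (Set.Ico (B + 10) (B + 13)) σ σ₅ :=
    ((hF₁.mono le_rfl (by intro a; simp; omega)).trans
      (hF₂.mono le_rfl (by intro a; simp; omega))).trans
      ((hF₃.mono le_rfl (by intro a; simp; omega)).trans
        ((hF₄.mono le_rfl (by intro a; simp; omega)).trans
        (hF₅.mono le_rfl (by intro a; simp; omega))))
  refine ⟨hσ.trans (hF.mono (by intro a; simp; omega) le_rfl), ?_, ?_, ?_⟩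
  · rw [hidx hF (by omega), hk]
  · intro i hi j
    rcases Nat.lt_or_ge k i with h | h
    · obtain rfl : i = k + 1 := by omega
      rw [hX₅ j j.2]
      simp only [F₅]
      have hs := congrFun (hξ.x_succ k) j
      rw [hqk, hS₄, hval₄ _ (by omega), hh, hval₄ _ (by omega), hy, hval₄ _ (by omega), hσ₀.cost,
        hX₄, hX k le_rfl, div_eq_iff (by positivity)]
      simp only [Pi.smul_apply, Pi.mul_apply, Pi.add_apply, Pi.sub_apply, smul_eq_mul] at hs
      rw [mul_assoc, mul_comm (ξ (k + 1) j), hs, Pi.div_apply]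
      ring
    · rw [hXx₅ _ fun j' hj' => row_pos_ne j.2 hj' (by omega), hX₄, hX i h]
  · intro i hi j
    rw [hF₅.val _ (by simp)]
    rcases Nat.lt_or_ge i k with h | h
    · rw [hQx₄ _ fun j' hj' => row_pos_ne j.2 hj' (by omega),
        hQx₃ _ fun j' hj' => row_pos_ne j.2 hj' (by omega), hF₂.val _ (by simp),
        hF₁.val _ (by simp), hQ i h]
    · obtain rfl : i = k := by omega
      exact hqk j

/-- One step of the solver: replace the point `y` in the array `B + 13` by the value of the
truncated power series. -/
def taylorCmd (B : ℕ) : Cmd :=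
  .seq (forLoop B (.var (B + 21)) (.setVal (B + 11) (.var B) (.load (B + 13) (.var B))))
    (.seq (forLoop (B + 8) (.var (B + 13)) (taylorStep B))
      (forLoop B (.var (B + 13)) (forLoop (B + 1) (.var (B + 21))
        (.setVal (B + 13) (.var (B + 1)) (.add (.load (B + 13) (.var (B + 1)))
          (.load (B + 11)
            (.add (.mul (.add (.var B) (.const 1)) (.var (B + 21))) (.var (B + 1)))))))))

/-- The term of degree `0` is `y` itself, so the terms of degrees `1` to `K` are added to the point
in place. -/
theorem Runs.taylorCmd {m n : ℕ} {B top : ℕ} {A : Matrix (Fin m) (Fin n) ℝ}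
    {c x₀ y : Fin n → ℝ} {T ε h : ℝ} (hn : 1 ≤ n) {σ : State}
    (hσ : DataStored B top A c x₀ T ε σ) (hm : MeasuredAt B top A c y σ)
    (hy : ∀ j : Fin n, σ.val (B + 13) j = y j) (hh : σ.val (B + 14) 0 = h)
    {ξ q : ℕ → Fin n → ℝ} (hξ : IsTaylor (Matrix.mulVecLin (projection A (y / c)))
      (fun j => 1 / c j) ((response A (y / c)).mulVec y) h ξ q) {K : ℕ}
    (hK : σ.idx (B + 13) 0 = K) :
    Runs (taylorCmd B) σ (450 * n ^ 2 * (K + 1) ^ 2) fun σ' =>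
      Frame (Set.Iio (B + 9)) (Set.Ico (B + 10) (B + 14)) σ σ' ∧
      ∀ j : Fin n, σ'.val (B + 13) j = (y * ∑ k ∈ Finset.range (K + 1), ξ k) j := by
  have hvar : ∀ {τ τ' : State} {V : Set ℕ} {a k : ℕ}, Frame (Set.Iio (B + 9)) V τ τ' → B + 9 ≤ a →
      τ.idx a 0 = k → (IExpr.var a).eval τ' = k := fun h ha h1 => by
    simp only [IExpr.eval]; rw [h.idx _ (by simp; omega), h1]
  have hI : ∀ {V : Set ℕ} {τ τ' : State}, Frame {B} V τ τ' → Frame (Set.Iio (B + 9)) V τ τ' :=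
    fun h => h.mono (by intro a; simp; omega) le_rfl
  have hI2 : ∀ {V : Set ℕ} {τ τ' : State}, Frame {B, B + 1} V τ τ' →
      Frame (Set.Iio (B + 9)) V τ τ' := fun h => h.mono (by intro a; simp; omega) le_rfl
  refine (Runs.seq' (T := n * 20 + 11) (T' := K * (350 * n * (n + K) + 11) + 11 +
    (K * (n * 40 + 30) + 11)) ((Runs.fillVal (n := n) (fun j => j)
    (fun j => σ.val (B + 13) j) (fun _ _ _ _ h => h) (fun τ hτ => hvar (hI hτ) (by omega) hσ.cols)
    (fun j _ τ _ h => by simpa [IExpr.eval] using h) ?_).mono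
    (by simp [IExpr.cost, RExpr.cost]; omega) fun _ h => h) ?_).mono ?_ (fun _ h => h)
  · intro j hj τ hτ hjτ _ _
    simp only [RExpr.eval, IExpr.eval, hjτ]
    rw [hτ.val _ (by simp)]
  swap
  · obtain ⟨n, rfl⟩ := Nat.exists_eq_add_of_le' hn
    ring_nf
    nlinarith [Nat.zero_le (n * K), Nat.zero_le (n * K ^ 2), Nat.zero_le (n ^ 2 * K),
      Nat.zero_le (n ^ 2 * K ^ 2)]
  rintro σ₁ ⟨hF₁, hX₁, -⟩
  have hF₁' : Frame (Set.Iio (B + 9)) (Set.Ico (B + 10) (B + 13)) σ σ₁ :=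
    (hI hF₁).mono le_rfl (by intro a; simp; omega)
  refine Runs.seq' ((Runs.forLoop (n := K) (T := 350 * n * (n + K)) (fun k τ =>
    Frame (Set.Iio (B + 9)) (Set.Ico (B + 10) (B + 13)) σ τ ∧ τ.idx (B + 8) 0 = k ∧
    (∀ i ≤ k, ∀ j : Fin n, τ.val (B + 11) (i * n + j) = y j * ξ i j) ∧
    ∀ i < k, ∀ j : Fin n, τ.val (B + 10) (i * n + j) = q i j) ?_ ?_ ?_).mono
      (by simp [IExpr.cost]) fun _ h => h) ?_
  · refine ⟨hF₁'.setIdx (by simp) _ _, by simp, fun i hi j => ?_, by simp⟩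
    obtain rfl : i = 0 := by omega
    rw [State.setIdx_val, zero_mul, zero_add, hX₁ j j.2, hy, hξ.x_zero]
    simp
  · rintro k - τ ⟨h1, h2, -⟩
    exact ⟨h2, hvar h1 (by omega) hK⟩
  · rintro k hk τ ⟨h1, h2, h3, h4⟩
    refine (Runs.taylorStep hn hσ hm hy hh hξ h1 h2 h3 h4).mono (by gcongr) ?_
    rintro τ' ⟨h5, h6, h7, h8⟩
    exact ⟨h6, h5.setIdx (by simp) _ _, by simp, by simpa using h7, by simpa using h8⟩
  rintro σ₂ ⟨hF₂, -, hX₂, -⟩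
  have hcol₂ : σ₂.idx (B + 21) 0 = n := by rw [hF₂.idx _ (by simp), hσ.cols]
  have hK₂ : σ₂.idx (B + 13) 0 = K := by rw [hF₂.idx _ (by simp), hK]
  refine (Runs.accumulateVal (n := n) (r := K) (by omega) (fun j => j)
    (fun i j => σ₂.val (B + 11) ((i + 1) * n + j))
    (fun _ _ _ _ h => h) (fun τ hτ => hvar (hI2 hτ) (by omega) hK₂)
    (fun τ hτ => hvar (hI2 hτ) (by omega) hcol₂)
    (fun j _ τ _ h => by simpa [IExpr.eval] using h) ?_).mono
    (by simp [IExpr.cost, RExpr.cost]; exact Nat.mul_le_mul_left _ (by omega)) ?_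
  · intro i hi j hj τ hτ hiτ hjτ _
    simp only [RExpr.eval, IExpr.eval, hiτ, hjτ]
    rw [(hI2 hτ).idx _ (by simp), hcol₂, hτ.val _ (by simp)]
  · rintro σ₃ ⟨hF₃, hy₃, -⟩
    refine ⟨(hF₂.mono le_rfl (by intro a; simp; omega)).trans
      ((hI2 hF₃).mono le_rfl (by intro a; simp; omega)), fun j => ?_⟩
    rw [hy₃ j j.2, hF₂.val _ (by simp), hy, Pi.mul_apply, Finset.sum_apply,
      Finset.sum_range_succ', hξ.x_zero, Pi.one_apply, mul_add, mul_one, add_comm, Finset.mul_sum]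
    refine congrArg (· + _) (Finset.sum_congr rfl fun i hi => ?_)
    rw [Finset.mem_range] at hi
    exact hX₂ (i + 1) (by omega) j

end RealRAM

namespace RealRAM

open Physarum

/-! ### Reading the input -/

/-- Copy the dimensions from the index arrays `0` and `1`, and compute the least power of two that
is at least the number of columns. -/
def sizesCmd (B : ℕ) : Cmd :=
  .seq (.setIdx (B + 20) (.const 0) (.var 0))
    (.seq (.setIdx (B + 21) (.const 0) (.var 1))
    (.seq (.setIdx (B + 22) (.const 0) (.const 1))
    (.seq (.setIdx (B + 24) (.const 0) (.const 0))
    (.seq (.setIdx (B + 23) (.const 0) (.const 1))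
      (.loop (.idxLt (.var (B + 22)) (.var (B + 21)))
        (.seq (.setIdx (B + 24) (.const 0) (.add (.var (B + 24)) (.const 1)))
        (.seq (.setIdx (B + 22) (.const 0) (.mul (.const 2) (.var (B + 22))))
          (.setIdx (B + 23) (.var (B + 24)) (.var (B + 22))))))))))

/-- A crude count suffices: each doubling raises the power by at least one, so at most `n` turns
occur. The number `d` in the induction bounds the turns that remain. -/
theorem Runs.sizesCmd {B m n : ℕ} (hB : 2 ≤ B) (hn : 1 ≤ n) {σ : State} (h0 : σ.idx 0 0 = m)
    (h1 : σ.idx 1 0 = n) :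
    Runs (sizesCmd B) σ (100 * n) fun σ' => ∃ top,
      Frame (Set.Ico (B + 20) (B + 25)) ∅ σ σ' ∧ PowersStored B top σ' ∧
      σ'.idx (B + 20) 0 = m ∧ σ'.idx (B + 21) 0 = n ∧ n ≤ 2 ^ top ∧ 2 ^ top ≤ 2 * n := by
  have key : ∀ d t (τ : State), n ≤ 2 ^ t + d →
      (Frame (Set.Ico (B + 20) (B + 25)) ∅ σ τ ∧ PowersStored B t τ ∧
        τ.idx (B + 20) 0 = m ∧ τ.idx (B + 21) 0 = n ∧ 2 ^ t ≤ 2 * n) →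
      Runs (.loop (.idxLt (.var (B + 22)) (.var (B + 21)))
        (.seq (.setIdx (B + 24) (.const 0) (.add (.var (B + 24)) (.const 1)))
        (.seq (.setIdx (B + 22) (.const 0) (.mul (.const 2) (.var (B + 22))))
          (.setIdx (B + 23) (.var (B + 24)) (.var (B + 22)))))) τ (d * 22 + 5) fun σ' => ∃ top,
      Frame (Set.Ico (B + 20) (B + 25)) ∅ σ σ' ∧ PowersStored B top σ' ∧
      σ'.idx (B + 20) 0 = m ∧ σ'.idx (B + 21) 0 = n ∧ n ≤ 2 ^ top ∧ 2 ^ top ≤ 2 * n := by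
    intro d
    induction d with
    | zero =>
      rintro t τ hd ⟨h2, h3, h4, h5, h6⟩
      refine (Runs.loop_done ?_ ⟨t, h2, h3, h4, h5, hd, h6⟩).mono
        (by simp [Test.cost, IExpr.cost]) fun _ h => h
      simp only [Test.Holds, IExpr.eval, h3.size, h5]
      omega
    | succ d ih =>
      rintro t τ hd ⟨h2, h3, h4, h5, h6⟩
      by_cases h : n ≤ 2 ^ t
      · refine (Runs.loop_done ?_ ⟨t, h2, h3, h4, h5, h, h6⟩).mono
          (by simp [Test.cost, IExpr.cost]) fun _ h => h
        simp only [Test.Holds, IExpr.eval, h3.size, h5]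
        omega
      refine (Runs.loop_step (T := 6 + (6 + 5)) (T' := d * 22 + 5) ?_ (Runs.seq (Runs.setIdx
        (by simp [IExpr.cost]) (Runs.seq (Runs.setIdx (by simp [IExpr.cost]) (Runs.setIdx
          (by simp [IExpr.cost]) (ih (t + 1) _ ?_ ?_))))))).mono
        (by simp [Test.cost, IExpr.cost]; omega) fun _ h => h
      · simp only [Test.Holds, IExpr.eval, h3.size, h5]
        omega
      · have : 1 ≤ 2 ^ t := Nat.one_le_two_pow
        rw [pow_succ]; omega
      · refine ⟨((h2.setIdx (by simp) _ _).setIdx (by simp) _ _).setIdx (by simp) _ _,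
          ⟨?_, ?_, ?_⟩, ?_, ?_, ?_⟩
        · simp [State.setIdx_idx, IExpr.eval, h3.size, pow_succ, mul_comm]
        · intro j hj
          simp only [State.setIdx_idx, IExpr.eval, h3.size, h3.top]
          rcases Nat.le_succ_iff.1 hj with h | h
          · simp [h3.pow j h]; omega
          · subst h; simp [pow_succ, mul_comm]
        · simp [State.setIdx_idx, IExpr.eval, h3.top]
        · simp [State.setIdx_idx, h4]
        · simp [State.setIdx_idx, h5]
        · rw [pow_succ]; omega
  refine (Runs.seq (T := 4) (Runs.setIdx (by simp [IExpr.cost]) (Runs.seq (T := 4) (Runs.setIdx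
    (by simp [IExpr.cost]) (Runs.seq (T := 3) (Runs.setIdx (by simp [IExpr.cost]) (Runs.seq (T := 3)
    (Runs.setIdx (by simp [IExpr.cost]) (Runs.seq (T := 3) (Runs.setIdx (by simp [IExpr.cost])
    (key n 0 _ (by omega) ?_))))))))))).mono (by omega) fun _ h => h
  refine ⟨(((((Frame.refl _ _ _).setIdx (by simp) _ _).setIdx (by simp) _ _).setIdx
    (by simp) _ _).setIdx (by simp) _ _).setIdx (by simp) _ _, ⟨?_, ?_, ?_⟩, ?_, ?_, by omega⟩
  · simp [State.setIdx_idx, IExpr.eval]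
  · intro j hj
    obtain rfl : j = 0 := by omega
    simp [State.setIdx_idx, IExpr.eval]
  · simp [State.setIdx_idx, IExpr.eval]
  · simp [State.setIdx_idx, IExpr.eval, h0]
  · rw [State.setIdx_idx_of_ne _ _ _ (by omega), State.setIdx_idx_of_ne _ _ _ (by omega),
      State.setIdx_idx_of_ne _ _ _ (by omega)]
    simp only [IExpr.eval, State.setIdx_idx_self]
    rw [State.setIdx_idx_of_ne _ _ _ (by omega), h1]

/-- Copy the input to the arrays of the solver. -/
def readCmd (B : ℕ) : Cmd :=
  .seq (sizesCmd B)
    (.seq (forLoop B (.var (B + 21)) (.setVal (B + 21) (.var B) (.load 2 (.var B))))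
    (.seq (forLoop B (.var (B + 21)) (.setVal (B + 23) (.var B) (.load 3 (.var B))))
    (.seq (.setVal (B + 24) (.const 0) (.load 4 (.const 0)))
    (.seq (.setVal (B + 25) (.const 0) (.load 5 (.const 0)))
    (.seq (forLoop B (.var (B + 22)) (forLoop (B + 1) (.var (B + 22))
        (.setVal (B + 20) (.add (.mul (.var B) (.var (B + 22))) (.var (B + 1)))
          (.mul (.ofIdx (.sub (.sub (.const 1) (.sub (.add (.var B) (.const 1)) (.var (B + 20))))
              (.sub (.add (.var (B + 1)) (.const 1)) (.var (B + 21)))))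
            (.load 0 (.add (.mul (.var B) (.var (B + 21))) (.var (B + 1))))))))
      (forLoop B (.var (B + 22)) (forLoop (B + 1) (.var (B + 22))
        (.setVal (B + 22) (.add (.mul (.var B) (.var (B + 22))) (.var (B + 1)))
          (.ofIdx (.sub (.sub (.sub (.const 1) (.sub (.var (B + 20)) (.var B)))
            (.sub (.var B) (.var (B + 1)))) (.sub (.var (B + 1)) (.var B))))))))))))

/-- Nested loops that store a value in each cell of a square block. -/
theorem Runs.fillVal₂ {v w d : ℕ} {e pe : IExpr} {re : RExpr} {σ : State} {N : ℕ} (hvw : v ≠ w)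
    (F : ℕ → ℕ → ℝ) (he : ∀ σ', Frame {v, w} {d} σ σ' → e.eval σ' = N)
    (hpe : ∀ i < N, ∀ j < N, ∀ σ', Frame {v, w} {d} σ σ' → σ'.idx v 0 = i → σ'.idx w 0 = j →
      pe.eval σ' = i * N + j)
    (hre : ∀ i < N, ∀ j < N, ∀ σ', Frame {v, w} {d} σ σ' → σ'.idx v 0 = i → σ'.idx w 0 = j →
      re.eval σ' = F i j) :
    Runs (RealRAM.forLoop v e (RealRAM.forLoop w e (.setVal d pe re))) σ
      (N * ((N * (pe.cost + re.cost + 1 + e.cost + 9) + e.cost + 9) + e.cost + 9) + e.cost + 9)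
      fun σ' => Frame {v, w} {d} σ σ' ∧ ∀ i < N, ∀ j < N, σ'.val d (i * N + j) = F i j := by
  refine (Runs.fill₂ (T := pe.cost + re.cost + 1) hvw (fun i j => i * N + j) F
    (fun i _ j hj i' _ j' hj' h => block_pos_inj (stride := N) (r₀ := 0) (c₀ := 0) (n := N)
      (by omega) hj hj' (by simpa using h)) he he
    fun i hi j hj τ hτ hiτ hjτ _ _ => Runs.setVal le_rfl ?_).mono le_rfl
    fun _ h => ⟨h.1, h.2.1⟩
  rw [hpe i hi j hj τ hτ hiτ hjτ, hre i hi j hj τ hτ hiτ hjτ]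

theorem Runs.readCmd {m n : ℕ} {B : ℕ} (hB : 7 ≤ B) (hn : 1 ≤ n) {A : Matrix (Fin m) (Fin n) ℤ}
    {b : Fin m → ℤ} {c : Fin n → ℤ} {x₀ : Fin n → ℝ} {T ε : ℝ} {σ : State}
    (hσ : HoldsInput σ A b c x₀ T ε) :
    Runs (readCmd B) σ (1000 * n ^ 2) fun σ' => ∃ top, n ≤ 2 ^ top ∧ 2 ^ top ≤ 2 * n ∧
      DataStored B top (realMatrix A) (fun j => (c j : ℝ)) x₀ T ε σ' := by
  obtain ⟨hm0, hn0, hA, -, hc, hx, hT, hε⟩ := hσ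
  refine (Runs.seq' (Runs.sizesCmd (by omega) hn hm0 hn0) (T' := n * 20 + 11 + (n * 20 + 11 + (4 +
    (4 + (2 * n * (2 * n * 60 + 30) + 11 + (2 * n * (2 * n * 60 + 30) + 11))))))
    ?_).mono (by nlinarith) fun _ h => h
  rintro σ₁ ⟨top, hF₁, hpow, hm, hn', htop, htop'⟩
  set N := 2 ^ top with hN
  have hvar : ∀ {τ : State} {V : Set ℕ} {a k : ℕ}, Frame {B, B + 1} V σ₁ τ → B + 2 ≤ a →
      σ₁.idx a 0 = k → (IExpr.var a).eval τ = k := fun h ha h1 => by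
    simp only [IExpr.eval]; rw [h.idx _ (by simp; omega), h1]
  have hI : ∀ {V : Set ℕ} {τ τ' : State}, Frame {B} V τ τ' → Frame {B, B + 1} V τ τ' :=
    fun h => h.mono (by simp) le_rfl
  have hNn : ∀ k, N * (N * k + 30) + 11 ≤ 2 * n * (2 * n * k + 30) + 11 := fun k => by gcongr
  refine Runs.seq' ((Runs.fillVal (n := n) (fun j => j) (fun j => σ.val 2 j)
    (fun _ _ _ _ h => h) (fun τ hτ => hvar (hI hτ) (by omega) hn')
    (fun j _ τ _ h => by simpa [IExpr.eval] using h) ?_).mono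
    (by simp [IExpr.cost, RExpr.cost]; omega) fun _ h => h) ?_
  · intro j hj τ hτ hjτ _ _
    simp only [RExpr.eval, IExpr.eval, hjτ]
    rw [hτ.val _ (by simp), hF₁.val _ (by simp)]
  rintro σ₂ ⟨hF₂, hc₂, -⟩
  replace hF₂ := (hI hF₂).mono le_rfl (show {B + 21} ⊆ Set.Ico (B + 20) (B + 26) by
    intro a; simp; omega)
  refine Runs.seq' ((Runs.fillVal (n := n) (fun j => j) (fun j => σ.val 3 j)
    (fun _ _ _ _ h => h) (fun τ hτ => hvar (hF₂.trans ((hI hτ).mono le_rfl (by simp)))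
      (by omega) hn')
    (fun j _ τ _ h => by simpa [IExpr.eval] using h) ?_).mono
    (by simp [IExpr.cost, RExpr.cost]; omega) fun _ h => h) ?_
  · intro j hj τ hτ hjτ _ _
    simp only [RExpr.eval, IExpr.eval, hjτ]
    rw [hτ.val _ (by simp), hF₂.val _ (by simp), hF₁.val _ (by simp)]
  rintro σ₃ ⟨hF₃, hx₃, -⟩
  replace hc₃ : ∀ j < n, σ₃.val (B + 21) j = σ.val 2 j := fun j hj => by
    rw [hF₃.val _ (by simp), hc₂ j hj]
  replace hF₃ := hF₂.trans ((hI hF₃).mono le_rfl (by intro a; simp; omega))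
  refine Runs.seq (Runs.setVal (by simp [IExpr.cost, RExpr.cost]) (Runs.seq (Runs.setVal
    (by simp [IExpr.cost, RExpr.cost]) ?_)))
  simp only [IExpr.eval, RExpr.eval]
  rw [State.setVal_val_of_ne _ _ _ (show 5 ≠ B + 24 by omega), hF₃.val 4 (by simp),
    hF₁.val _ (by simp), hF₃.val 5 (by simp), hF₁.val _ (by simp), hT, hε]
  set σ₄ := (σ₃.setVal (B + 24) 0 T).setVal (B + 25) 0 ε with hσ₄
  have hF₄ : Frame {B, B + 1} (Set.Ico (B + 20) (B + 26)) σ₁ σ₄ :=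
    (hF₃.setVal (by simp) _ _).setVal (by simp) _ _
  have hT₄ : σ₄.val (B + 24) 0 = T := by
    rw [hσ₄, State.setVal_val_of_ne _ _ _ (by omega), State.setVal_val_self]
  have hε₄ : σ₄.val (B + 25) 0 = ε := by rw [hσ₄, State.setVal_val_self]
  have hc₄ : ∀ j < n, σ₄.val (B + 21) j = σ.val 2 j := fun j hj => by
    rw [hσ₄, State.setVal_val_of_ne _ _ _ (by omega), State.setVal_val_of_ne _ _ _ (by omega),
      hc₃ j hj]
  have hx₄ : ∀ j < n, σ₄.val (B + 23) j = σ.val 3 j := fun j hj => by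
    rw [hσ₄, State.setVal_val_of_ne _ _ _ (by omega), State.setVal_val_of_ne _ _ _ (by omega),
      hx₃ j hj]
  have hA₄ : σ₄.val 0 = σ.val 0 := by rw [hF₄.val _ (by simp), hF₁.val _ (by simp)]
  -- By truncated subtraction the first factor is the indicator of `i < m` and `j < n`; it masks the
  -- unknown memory outside the input.
  let F₅ : ℕ → ℕ → ℝ := fun i j =>
    ((1 - (i + 1 - m) - (j + 1 - n) : ℕ) : ℝ) * σ.val 0 (i * n + j)
  refine Runs.seq' ((Runs.fillVal₂ (by omega) F₅ (N := N)
    (fun τ hτ => hvar (hF₄.trans (hτ.mono le_rfl (by simp))) (by omega) hpow.size)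
    (fun i hi j hj τ hτ hiτ hjτ => ?_) (fun i hi j hj τ hτ hiτ hjτ => ?_)).mono
    ((le_trans (by simp [IExpr.cost, RExpr.cost]; exact Nat.mul_le_mul_left _ (by omega))
      (hNn 60))) fun _ h => h) ?_
  · have := hvar (hF₄.trans (hτ.mono le_rfl (by simp))) (by omega) hpow.size
    simp only [IExpr.eval] at this ⊢
    rw [this, hiτ, hjτ]
  · have h1 := hvar (hF₄.trans (hτ.mono le_rfl (by simp))) (by omega) hm
    have h2 := hvar (hF₄.trans (hτ.mono le_rfl (by simp))) (by omega) hn'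
    simp only [IExpr.eval, RExpr.eval] at h1 h2 ⊢
    rw [h1, h2, hiτ, hjτ, hτ.val 0 (by simp), hA₄]
  rintro σ₅ ⟨hF₅, hA₅⟩
  have hval₅ : ∀ a, B + 21 ≤ a → σ₅.val a = σ₄.val a := fun a ha => hF₅.val a (by simp; omega)
  replace hF₅ := hF₄.trans (hF₅.mono le_rfl (show {B + 20} ⊆ Set.Ico (B + 20) (B + 26) by
    simp))
  -- The indicator of `m ≤ i` and `i = j`, again by truncated subtraction.
  let F₆ : ℕ → ℕ → ℝ := fun i j => ((1 - (m - i) - (i - j) - (j - i) : ℕ) : ℝ)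
  refine (Runs.fillVal₂ (by omega) F₆ (N := N)
    (fun τ hτ => hvar (hF₅.trans (hτ.mono le_rfl (by simp))) (by omega) hpow.size)
    (fun i hi j hj τ hτ hiτ hjτ => ?_) (fun i hi j hj τ hτ hiτ hjτ => ?_)).mono
    ((le_trans (by simp [IExpr.cost, RExpr.cost]; exact Nat.mul_le_mul_left _ (by omega))
      (hNn 60))) ?_
  · have := hvar (hF₅.trans (hτ.mono le_rfl (by simp))) (by omega) hpow.size
    simp only [IExpr.eval] at this ⊢
    rw [this, hiτ, hjτ]
  · have h1 := hvar (hF₅.trans (hτ.mono le_rfl (by simp))) (by omega) hm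
    simp only [IExpr.eval, RExpr.eval] at h1 ⊢
    rw [h1, hiτ, hjτ]
  rintro σ₆ ⟨hF₆, hP₆⟩
  have hval₆ : ∀ a, B + 21 ≤ a → a ≠ B + 22 → σ₆.val a = σ₄.val a := fun a ha ha' => by
    rw [hF₆.val a (by simp; omega), hval₅ a ha]
  have hidx₆ : ∀ a, B + 2 ≤ a → σ₆.idx a = σ₁.idx a := fun a ha => by
    rw [hF₆.idx a (by simp; omega), hF₅.idx a (by simp; omega)]
  refine ⟨top, htop, htop', ⟨⟨?_, ?_, ?_⟩, ?_, ?_, ?_, ?_, ?_, ?_, ?_, ?_⟩⟩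
  · rw [hidx₆ _ (by omega), hpow.size]
  · rw [hidx₆ _ (by omega)]; exact hpow.pow
  · rw [hidx₆ _ (by omega), hpow.top]
  · rw [hidx₆ _ (by omega), hm]
  · rw [hidx₆ _ (by omega), hn']
  · intro i j
    rw [hF₆.val _ (by simp), hA₅ i i.2 j j.2]
    simp only [F₅, padded]
    split_ifs with h
    · rw [show 1 - ((i : ℕ) + 1 - m) - ((j : ℕ) + 1 - n) = 1 by omega, ← hA]
      simp
    · rw [show 1 - ((i : ℕ) + 1 - m) - ((j : ℕ) + 1 - n) = 0 by omega]
      simp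
  · intro j
    rw [hval₆ _ (by omega) (by omega), hc₄ j j.2, hc]
  · intro i j
    rw [hP₆ i i.2 j j.2]
    simp only [F₆, padUnit, Fin.ext_iff]
    split_ifs with h
    · rw [show 1 - (m - (i : ℕ)) - ((i : ℕ) - j) - ((j : ℕ) - i) = 1 by omega]
      simp
    · rw [show 1 - (m - (i : ℕ)) - ((i : ℕ) - j) - ((j : ℕ) - i) = 0 by omega]
      simp
  · intro j
    rw [hval₆ _ (by omega) (by omega), hx₄ j j.2, hx]
  · rw [hval₆ _ (by omega) (by omega), hT₄]
  · rw [hval₆ _ (by omega) (by omega), hε₄]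

end RealRAM

/-! ### Following the trajectory with a fixed number of steps -/

namespace RealRAM

open Physarum

theorem Runs.setIdx_eval {σ : State} {a : ℕ} {i e : IExpr} {T j k : ℕ} {Q : State → Prop}
    (hT : i.cost + e.cost + 1 ≤ T) (hi : i.eval σ = j) (he : e.eval σ = k)
    (h : Q (σ.setIdx a j k)) : Runs (.setIdx a i e) σ T Q :=
  Runs.setIdx hT (by rwa [hi, he])

theorem Runs.setVal_eval {σ : State} {a : ℕ} {i : IExpr} {e : RExpr} {T j : ℕ} {z : ℝ}
    {Q : State → Prop} (hT : i.cost + e.cost + 1 ≤ T) (hi : i.eval σ = j) (he : e.eval σ = z)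
    (h : Q (σ.setVal a j z)) : Runs (.setVal a i e) σ T Q :=
  Runs.setVal hT (by rwa [hi, he])

/-- Copy a vector from the value array `s` to the value array `d`. -/
def copyCmd (B s d : ℕ) : Cmd :=
  forLoop B (.var (B + 21)) (.setVal d (.var B) (.load s (.var B)))

theorem Runs.copyCmd {B s d n : ℕ} (hsd : s ≠ d) {σ : State} (hn : σ.idx (B + 21) 0 = n) :
    Runs (copyCmd B s d) σ (n * 17 + 11) fun σ' =>
      Frame {B} {d} σ σ' ∧ ∀ j < n, σ'.val d j = σ.val s j := by
  refine (Runs.fillVal (n := n) (fun j => j) (fun j => σ.val s j) (fun _ _ _ _ h => h)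
    (fun τ hτ => ?_) (fun j _ τ _ h => by simpa [IExpr.eval] using h)
    fun j _ τ hτ hj _ _ => ?_).mono (by simp [IExpr.cost, RExpr.cost])
    fun _ h => ⟨h.1, h.2.1⟩
  · simp only [IExpr.eval]
    rw [hτ.idx _ (by simp), hn]
  · simp only [RExpr.eval, IExpr.eval, hj]
    rw [hτ.val _ (by simpa using hsd)]

/-- Advance by one step of length `B + 14`, or raise the flag `B + 10` if the step is too long. -/
def advanceCmd (p : Cmd) (B : ℕ) : Cmd :=
  .seq (.seq (responseCmd p B) (normsCmd B))
    (.ite (.realLt (.const 1) (.mul (.mul (.mul (.const 100) (.load (B + 14) (.const 0)))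
        (.load (B + 8) (.const 0))) (.load (B + 9) (.const 0))))
      (.seq (.setIdx (B + 10) (.const 0) (.const 1)) (.setIdx (B + 9) (.const 0) (.var (B + 12))))
      (.seq (taylorCmd B) (.setIdx (B + 9) (.const 0) (.add (.var (B + 9)) (.const 1)))))

/-- The outcome of an attempt with `G` steps: the array `B + 13` holds an approximation of the point
`z`, or the number of steps is too small. -/
def Outcome {m n : ℕ} (B : ℕ) (A : Matrix (Fin m) (Fin n) ℤ) (b : Fin m → ℤ) (c : Fin n → ℤ)
    (T α₀ : ℝ) (κ G : ℕ) (z : Fin n → ℝ) (σ : State) : Prop :=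
  (σ.idx (B + 10) 0 = 0 ∧ ∃ y, Tracks (realMatrix A) (fun i => (b i : ℝ)) (fun j => (c j : ℝ)) z α₀
    (2 * G + κ) G y ∧ ∀ j : Fin n, σ.val (B + 13) j = y j) ∨
  (σ.idx (B + 10) 0 = 1 ∧ (G : ℝ) < 100 * (T * (n * (maxSubdet A : ℝ) ^ 2 * norm1 c)))

/-- The step length is tested against the measured bounds, never against `D`. If the test fails, the
counter is set to `G` so that the loop ends with the flag raised. -/
theorem Runs.advanceLoop {m n : ℕ} {p : Cmd} {f : ℕ → ℕ} {B top : ℕ} (hp : Multiplies p f)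
    (hpB : p.bound ≤ B) (hB : 7 ≤ B) {A : Matrix (Fin m) (Fin n) ℤ}
    (hA : (realMatrix A).rank = m) (hn : 1 ≤ n) (hm : m ≤ 2 ^ top) (hn' : n ≤ 2 ^ top)
    {b : Fin m → ℤ} {c : Fin n → ℤ} (hc : ∀ j, 0 < c j) {x₀ : Fin n → ℝ} {T ε : ℝ} (hT : 0 ≤ T)
    {x : ℝ → Fin n → ℝ} (hx : IsSolution A b c x₀ T x)
    (hb : (realMatrix A).mulVec x₀ = fun i => (b i : ℝ)) {α₀ : ℝ} {G κ : ℕ} (hG : 1 ≤ G)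
    (hκ : 4 * α₀ ≤ 2 ^ κ) {σ : State}
    (hσ : DataStored B top (realMatrix A) (fun j => (c j : ℝ)) x₀ T ε σ)
    (hGσ : σ.idx (B + 12) 0 = G) (hKσ : σ.idx (B + 13) 0 = 2 * G + κ)
    (hhσ : σ.val (B + 14) 0 = T / G) (d : ℕ) : ∀ i, i + d = G → ∀ τ : State,
      Frame (Set.Iio (B + 11)) (Set.Iio (B + 14)) σ τ → τ.idx (B + 9) 0 = i →
      τ.idx (B + 10) 0 = 0 → ∀ y, Tracks (realMatrix A) (fun i => (b i : ℝ))
        (fun j => (c j : ℝ)) (x (i * (T / G))) α₀ (2 * G + κ) i y →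
      (∀ j : Fin n, τ.val (B + 13) j = y j) →
      Runs (.loop (.idxLt (.var (B + 9)) (.var (B + 12))) (advanceCmd p B)) τ
        (d * (inverseTime f top + 2100 * f (2 ^ top) + 450 * n ^ 2 * (2 * G + κ + 1) ^ 2 + 24) + 5)
        fun σ' => Frame (Set.Iio (B + 11)) (Set.Iio (B + 14)) σ σ' ∧
          Outcome B A b c T α₀ κ G (x T) σ' := by
  have hG0 : (0 : ℝ) < G := by exact_mod_cast hG
  have hc' : ∀ j, (0 : ℝ) < c j := fun j => by exact_mod_cast hc j
  have hdone : ∀ τ : State, Frame (Set.Iio (B + 11)) (Set.Iio (B + 14)) σ τ →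
      τ.idx (B + 9) 0 = G → Outcome B A b c T α₀ κ G (x T) τ →
      Runs (.loop (.idxLt (.var (B + 9)) (.var (B + 12))) (advanceCmd p B)) τ 5
        fun σ' => Frame (Set.Iio (B + 11)) (Set.Iio (B + 14)) σ σ' ∧
          Outcome B A b c T α₀ κ G (x T) σ' := by
    intro τ hτ hi ho
    refine (Runs.loop_done ?_ ⟨hτ, ho⟩).mono (by simp [Test.cost, IExpr.cost]) fun _ h => h
    simp only [Test.Holds, IExpr.eval, hi]
    rw [hτ.idx _ (by simp), hGσ]
    omega
  induction d with
  | zero =>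
    intro i hi τ hτ hiτ hfτ y hy hyτ
    obtain rfl : i = G := by omega
    rw [zero_mul, zero_add]
    refine hdone τ hτ hiτ (Or.inl ⟨hfτ, y, ?_, hyτ⟩)
    rwa [mul_div_cancel₀ _ hG0.ne'] at hy
  | succ d ih =>
    intro i hi τ hτ hiτ hfτ y hy hyτ
    have hstep : ((i : ℝ) + 1) * (T / G) ≤ T := by
      rw [← mul_div_assoc, div_le_iff₀ hG0, mul_comm]
      have : ((i + 1 : ℕ) : ℝ) ≤ G := by exact_mod_cast (by omega : i + 1 ≤ G)
      push_cast at this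
      gcongr
    refine (Runs.loop_step (T := inverseTime f top + 2100 * f (2 ^ top) + (12 +
      (450 * n ^ 2 * (2 * G + κ + 1) ^ 2 + 7)))
      (T' := d * (inverseTime f top + 2100 * f (2 ^ top) + 450 * n ^ 2 * (2 * G + κ + 1) ^ 2 + 24)
        + 5) ?_ (Runs.seq' (Runs.measureCmd hp hpB hB hA hn hc' hy.pos
      (hσ.frame hτ (by omega) (by omega)) hm hn' hyτ) ?_)).mono ?_ fun _ h => h
    · simp only [Test.Holds, IExpr.eval, hiτ]
      rw [hτ.idx _ (by simp), hGσ]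
      omega
    swap
    · simp only [Test.cost, IExpr.cost, add_mul]; omega
    rintro τ₁ ⟨hF₁, hM⟩
    have hτ₁ : Frame (Set.Iio (B + 11)) (Set.Iio (B + 14)) σ τ₁ :=
      hτ.trans (hF₁.mono (by intro a; simp; omega) (by intro a; simp; omega))
    have hσ₁ := hσ.frame hτ₁ (by omega) (by omega)
    have hh₁ : τ₁.val (B + 14) 0 = T / G := by rw [hτ₁.val _ (by simp), hhσ]
    have hG₁ : τ₁.idx (B + 12) 0 = G := by rw [hτ₁.idx _ (by simp), hGσ]
    refine (Runs.ite (T := 450 * n ^ 2 * (2 * G + κ + 1) ^ 2 + 7) (fun h => ?_) fun h => ?_).mono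
      (by simp [Test.cost, RExpr.cost, IExpr.cost]) fun _ h => h
    · simp only [Test.Holds, RExpr.eval, IExpr.eval, hh₁, hM.amplification, hM.flowBound] at h
      refine (Runs.seq (T := 3) (T' := 4) (Runs.setIdx (by simp [IExpr.cost])
        (Runs.setIdx (by simp [IExpr.cost]) ?_))).mono (by omega) fun _ h => h
      have hframe : ∀ k l, Frame (Set.Iio (B + 11)) (Set.Iio (B + 14)) σ
          ((τ₁.setIdx (B + 10) 0 k).setIdx (B + 9) 0 l) := fun k l =>
        (hτ₁.setIdx (by simp) _ _).setIdx (by simp) _ _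
      refine (hdone _ (hframe _ _) ?_ (Or.inr ⟨?_, ?_⟩)).mono (by omega) fun _ h => h
      · simp [State.setIdx_idx, IExpr.eval, hG₁]
      · simp [State.setIdx_idx, IExpr.eval]
      · have h1 := amplification_le hA hn hc' hy.pos
        have h2 := flowBound_le hA hn hc hy.pos
        have h3 : (1 : ℝ) ≤ flowBound (realMatrix A) (fun j => (c j : ℝ)) y := le_max_left _ _
        -- A failed test, combined with the a priori bounds for the two measured quantities, shows
        -- that `G` was too small.
        have h4 : 1 < 100 * (T / G) * (n * maxSubdet A) * (maxSubdet A * norm1 c) := by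
          push_cast at h
          refine h.trans_le ?_
          gcongr
        have h5 : 100 * (T / G) * (n * maxSubdet A) * (maxSubdet A * norm1 c) =
            100 * (T * (n * (maxSubdet A : ℝ) ^ 2 * norm1 c)) / G := by ring
        rwa [h5, lt_div_iff₀ hG0, one_mul] at h4
    · simp only [Test.Holds, RExpr.eval, IExpr.eval, hh₁, hM.amplification, hM.flowBound,
        not_lt] at h
      push_cast at h
      obtain ⟨ξ, q, hξ⟩ := exists_isTaylor (Matrix.mulVecLin (projection (realMatrix A)
        (y / fun j => (c j : ℝ)))) (fun j => 1 / (c j : ℝ))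
        ((response (realMatrix A) (y / fun j => (c j : ℝ))).mulVec y) (T / G)
      refine (Runs.seq' (T' := 6) (Runs.taylorCmd hn hσ₁ hM (fun j => ?_) hh₁ hξ
        (K := 2 * G + κ) ?_) ?_).mono (by omega) fun _ h => h
      · rw [hF₁.val _ (by simp), hyτ]
      · rw [hτ₁.idx _ (by simp), hKσ]
      rintro τ₂ ⟨hF₂, hy₂⟩
      have hτ₂ : Frame (Set.Iio (B + 11)) (Set.Iio (B + 14)) σ τ₂ :=
        hτ₁.trans (hF₂.mono (by intro a; simp; omega) (by intro a; simp))
      refine Runs.setIdx (by simp [IExpr.cost]) ?_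
      have hi₂ : τ₂.idx (B + 9) 0 = i := by
        rw [hF₂.idx _ (by simp), hF₁.idx _ (by simp), hiτ]
      simp only [IExpr.eval, hi₂]
      refine ih (i + 1) (by omega) _ (hτ₂.setIdx (by simp) _ _) (by simp) ?_
        (y * ∑ k ∈ Finset.range (2 * G + κ + 1), ξ k) ?_ (by simpa using hy₂)
      · rw [State.setIdx_idx_of_ne _ _ _ (by omega), hF₂.idx _ (by simp), hF₁.idx _ (by simp), hfτ]
      · have := hy.step hA hc hx hb (by omega) hκ (by positivity) (by positivity)
          (by linarith [hstep]) h hξ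
        rw [show ((i + 1 : ℕ) : ℝ) * (T / G) = i * (T / G) + T / G by push_cast; ring]
        exact this

/-- Follow the trajectory in `B + 12` steps, and double `B + 12`. -/
def attemptCmd (p : Cmd) (B : ℕ) : Cmd :=
  .seq (.setIdx (B + 10) (.const 0) (.const 0))
    (.seq (.setIdx (B + 9) (.const 0) (.const 0))
    (.seq (.setIdx (B + 13) (.const 0) (.add (.mul (.const 2) (.var (B + 12))) (.var (B + 14))))
    (.seq (.setVal (B + 14) (.const 0)
      (.div (.load (B + 24) (.const 0)) (.ofIdx (.var (B + 12)))))
    (.seq (copyCmd B (B + 23) (B + 13))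
    (.seq (.loop (.idxLt (.var (B + 9)) (.var (B + 12))) (advanceCmd p B))
      (.setIdx (B + 12) (.const 0) (.mul (.const 2) (.var (B + 12)))))))))

theorem Runs.attemptCmd {m n : ℕ} {p : Cmd} {f : ℕ → ℕ} {B top : ℕ} (hp : Multiplies p f)
    (hpB : p.bound ≤ B) (hB : 7 ≤ B) {A : Matrix (Fin m) (Fin n) ℤ}
    (hA : (realMatrix A).rank = m) (hn : 1 ≤ n) (hm : m ≤ 2 ^ top) (hn' : n ≤ 2 ^ top)
    {b : Fin m → ℤ} {c : Fin n → ℤ} (hc : ∀ j, 0 < c j) {x₀ : Fin n → ℝ} (hx₀ : ∀ j, 0 < x₀ j)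
    {T ε : ℝ} (hT : 0 ≤ T) {x : ℝ → Fin n → ℝ} (hx : IsSolution A b c x₀ T x)
    (hb : (realMatrix A).mulVec x₀ = fun i => (b i : ℝ)) {G κ : ℕ} (hG : 1 ≤ G)
    (hκ : 4 * amplification (realMatrix A) (fun j => (c j : ℝ)) x₀ ≤ 2 ^ κ) {σ : State}
    (hσ : DataStored B top (realMatrix A) (fun j => (c j : ℝ)) x₀ T ε σ)
    (hGσ : σ.idx (B + 12) 0 = G) (hκσ : σ.idx (B + 14) 0 = κ) :
    Runs (attemptCmd p B) σ (G * (inverseTime f top + 2100 * f (2 ^ top) +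
        450 * n ^ 2 * (2 * G + κ + 1) ^ 2 + 100 * n)) fun σ' =>
      DataStored B top (realMatrix A) (fun j => (c j : ℝ)) x₀ T ε σ' ∧
      σ'.idx (B + 12) 0 = 2 * G ∧ σ'.idx (B + 14) 0 = κ ∧
      Outcome B A b c T (amplification (realMatrix A) (fun j => (c j : ℝ)) x₀) κ G (x T) σ' := by
  set u := inverseTime f top + 2100 * f (2 ^ top) + 450 * n ^ 2 * (2 * G + κ + 1) ^ 2 with hu
  refine (Runs.seq (T := 3) (Runs.setIdx_eval (j := 0) (k := 0) (by simp [IExpr.cost]) rfl rfl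
    (Runs.seq (T := 3) (Runs.setIdx_eval (j := 0) (k := 0) (by simp [IExpr.cost]) rfl rfl
    (Runs.seq (T := 9) (Runs.setIdx_eval (j := 0) (k := 2 * G + κ) (by simp [IExpr.cost]) rfl
      (by simp [IExpr.eval, State.setIdx_idx, hGσ, hκσ])
    (Runs.seq (T := 8) (T' := n * 17 + 11 + (G * (u + 24) + 5 + 6)) (Runs.setVal_eval (j := 0) (z := T / G)
      (by simp [IExpr.cost, RExpr.cost]) rfl
      (by simp [IExpr.eval, RExpr.eval, State.setIdx_idx, hGσ, hσ.time]) ?_)))))))).mono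
      (by nlinarith) fun _ h => h
  set σ₁ := (((σ.setIdx (B + 10) 0 0).setIdx (B + 9) 0 0).setIdx (B + 13) 0 (2 * G + κ)).setVal
    (B + 14) 0 (T / G) with hσ₁
  have hF₁ : Frame (Set.Iio (B + 14)) (Set.Iio (B + 15)) σ σ₁ :=
    ((((Frame.refl _ _ _).setIdx (by simp) _ _).setIdx (by simp) _ _).setIdx (by simp) _ _).setVal
      (by simp) _ _
  have hG₁ : σ₁.idx (B + 12) 0 = G := by simp [hσ₁, State.setIdx_idx, hGσ]
  have hi₁ : σ₁.idx (B + 9) 0 = 0 := by simp [hσ₁, State.setIdx_idx]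
  have hf₁ : σ₁.idx (B + 10) 0 = 0 := by simp [hσ₁, State.setIdx_idx]
  have hK₁ : σ₁.idx (B + 13) 0 = 2 * G + κ := by simp [hσ₁, State.setIdx_idx]
  have hh₁ : σ₁.val (B + 14) 0 = T / G := by simp [hσ₁]
  have hD₁ := hσ.frame hF₁ (by omega) (by omega)
  refine Runs.seq' (Runs.copyCmd (by omega) hD₁.cols) ?_
  rintro σ₂ ⟨hF₂, hy₂⟩
  have hF₂' : Frame (Set.Iio (B + 14)) (Set.Iio (B + 15)) σ σ₂ :=
    hF₁.trans (hF₂.mono (by intro a; simp; omega) (by intro a; simp; omega))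
  have hD₂ := hσ.frame hF₂' (by omega) (by omega)
  refine Runs.seq' (Runs.advanceLoop hp hpB hB hA hn hm hn' hc hT hx hb hG hκ hD₂ (G := G)
    (by rw [hF₂.idx _ (by simp), hG₁]) (by rw [hF₂.idx _ (by simp), hK₁])
    (by rw [hF₂.val _ (by simp), hh₁]) G 0 (by omega) σ₂ (Frame.refl _ _ _)
    (by rw [hF₂.idx _ (by simp), hi₁]) (by rw [hF₂.idx _ (by simp), hf₁]) x₀ ?_ ?_) ?_
  · rw [Nat.cast_zero, zero_mul, hx.1]
    exact Tracks.initial hx₀ hb _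
  · intro j
    rw [hy₂ j j.2, hD₁.start]
  rintro σ₃ ⟨hF₃, ho⟩
  refine Runs.setIdx (by simp [IExpr.cost]) ?_
  have hF₃' : Frame (Set.Iio (B + 14)) (Set.Iio (B + 15)) σ σ₃ :=
    hF₂'.trans (hF₃.mono (by intro a; simp; omega) (by intro a; simp; omega))
  simp only [IExpr.eval]
  rw [hF₃.idx _ (by simp), hF₂.idx _ (by simp), hG₁]
  have hF₄ := hF₃'.setIdx (a := B + 12) (by simp) 0 (2 * G)
  refine ⟨hσ.frame hF₄ (by omega) (by omega), by simp, ?_, ?_⟩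
  · rw [hF₄.idx _ (by simp), hκσ]
  · rcases ho with ⟨h1, y, h2, h3⟩ | ⟨h1, h2⟩
    · exact Or.inl ⟨by rwa [State.setIdx_idx_of_ne _ _ _ (by omega)], y, h2, h3⟩
    · exact Or.inr ⟨by rwa [State.setIdx_idx_of_ne _ _ _ (by omega)], h2⟩

end RealRAM

/-! ### Precision, doubling and the complete program -/

namespace RealRAM

open Physarum

/-- Count in the index array `B + 14` how often `B + 15` has to be doubled to reach the value
`4 * α`, where `α` is in `B + 8`. -/
def precisionLoop (B : ℕ) : Cmd :=
  .loop (.realLt (.load (B + 15) (.const 0)) (.mul (.const 4) (.load (B + 8) (.const 0))))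
    (.seq (.setVal (B + 15) (.const 0)
        (.add (.load (B + 15) (.const 0)) (.load (B + 15) (.const 0))))
      (.setIdx (B + 14) (.const 0) (.add (.var (B + 14)) (.const 1))))

/-- Without logarithms or rounding, `κ` is found by doubling `ε` until it reaches `4 α`. Minimality
of `κ` gives the upper bound, which makes `κ` logarithmic in `α / ε`. -/
theorem Runs.precisionLoop {B : ℕ} {α ε : ℝ} (hα : 1 ≤ α) (hε : 0 < ε) (hε1 : ε < 1) {σ : State}
    (hασ : σ.val (B + 8) 0 = α) (hεσ : σ.val (B + 15) 0 = ε) (hκσ : σ.idx (B + 14) 0 = 0) :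
    ∃ κ : ℕ, 4 * α ≤ ε * 2 ^ κ ∧ ε * 2 ^ κ ≤ 8 * α ∧
      Runs (precisionLoop B) σ (κ * 20 + 7) fun σ' =>
        Frame {B + 14} {B + 15} σ σ' ∧ σ'.idx (B + 14) 0 = κ := by
  have hex : ∃ κ : ℕ, 4 * α ≤ ε * 2 ^ κ := by
    obtain ⟨κ, h⟩ := pow_unbounded_of_one_lt (4 * α / ε) (one_lt_two (α := ℝ))
    rw [div_lt_iff₀ hε] at h
    exact ⟨κ, by linarith⟩
  classical
  set κ := Nat.find hex with hκ
  have hmin : ∀ k < κ, ε * 2 ^ k < 4 * α := fun k hk => not_le.1 (Nat.find_min hex hk)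
  refine ⟨κ, Nat.find_spec hex, ?_, ?_⟩
  · rcases Nat.eq_zero_or_pos κ with h | h
    · rw [h, pow_zero, mul_one]; linarith
    · have := hmin (κ - 1) (by omega)
      have e : (2 : ℝ) ^ κ = 2 ^ (κ - 1) * 2 := by rw [← pow_succ, Nat.sub_add_cancel h]
      rw [e]; linarith
  have key : ∀ d k, k + d = κ → ∀ τ : State, Frame {B + 14} {B + 15} σ τ →
      τ.idx (B + 14) 0 = k → τ.val (B + 15) 0 = ε * 2 ^ k →
      Runs (RealRAM.precisionLoop B) τ (d * 20 + 7) fun σ' =>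
        Frame {B + 14} {B + 15} σ σ' ∧ σ'.idx (B + 14) 0 = κ := by
    intro d
    induction d with
    | zero =>
      intro k hk τ hτ hkτ heτ
      obtain rfl : k = κ := by omega
      refine (Runs.loop_done ?_ ⟨hτ, hkτ⟩).mono (by simp [Test.cost, RExpr.cost, IExpr.cost])
        fun _ h => h
      simp only [Test.Holds, RExpr.eval, IExpr.eval, heτ, not_lt]
      rw [hτ.val _ (by simp), hασ]
      push_cast
      exact Nat.find_spec hex
    | succ d ih =>
      intro k hk τ hτ hkτ heτ
      refine (Runs.loop_step (T := 13) (T' := d * 20 + 7) ?_ (Runs.seq (T := 7) (T' := 6)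
        (Runs.setVal_eval (j := 0) (z := ε * 2 ^ (k + 1)) (by simp [RExpr.cost, IExpr.cost]) rfl
          (by simp only [RExpr.eval, IExpr.eval, heτ]; ring)
        (Runs.setIdx_eval (j := 0) (k := k + 1) (by simp [IExpr.cost]) rfl
          (by simp [IExpr.eval, hkτ])
        (ih (k + 1) (by omega) _ ((hτ.setVal (by simp) _ _).setIdx (by simp) _ _) (by simp)
          (by simp)))))).mono (by simp [Test.cost, RExpr.cost, IExpr.cost]; omega) fun _ h => h
      simp only [Test.Holds, RExpr.eval, IExpr.eval, heτ]
      rw [hτ.val _ (by simp), hασ]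
      push_cast
      exact hmin k (by omega)
  exact key κ 0 (by omega) σ (Frame.refl _ _ _) hκσ (by simpa using hεσ)

/-- The number `Γ` occurs only in the analysis. A run that fails with `G` steps has `2 G ≤ Γ`, so
`G` never exceeds `Γ`, and a run with `Γ` steps cannot fail. -/
theorem Runs.attemptLoop {m n : ℕ} {p : Cmd} {f : ℕ → ℕ} {B top : ℕ} (hp : Multiplies p f)
    (hpB : p.bound ≤ B) (hB : 7 ≤ B) {A : Matrix (Fin m) (Fin n) ℤ}
    (hA : (realMatrix A).rank = m) (hn : 1 ≤ n) (hm : m ≤ 2 ^ top) (hn' : n ≤ 2 ^ top)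
    {b : Fin m → ℤ} {c : Fin n → ℤ} (hc : ∀ j, 0 < c j) {x₀ : Fin n → ℝ} (hx₀ : ∀ j, 0 < x₀ j)
    {T ε : ℝ} (hT : 0 ≤ T) {x : ℝ → Fin n → ℝ} (hx : IsSolution A b c x₀ T x)
    (hb : (realMatrix A).mulVec x₀ = fun i => (b i : ℝ)) {κ Γ : ℕ}
    (hκ : 4 * amplification (realMatrix A) (fun j => (c j : ℝ)) x₀ ≤ 2 ^ κ)
    (hΓ : ∀ G : ℕ, (G : ℝ) < 100 * (T * (n * (maxSubdet A : ℝ) ^ 2 * norm1 c)) → 2 * G ≤ Γ)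
    (d : ℕ) : ∀ G, G + d = Γ → 1 ≤ G → ∀ σ : State,
      DataStored B top (realMatrix A) (fun j => (c j : ℝ)) x₀ T ε σ →
      σ.idx (B + 12) 0 = G → σ.idx (B + 14) 0 = κ → σ.idx (B + 10) 0 = 1 →
      Runs (.loop (.idxLt (.const 0) (.var (B + 10))) (RealRAM.attemptCmd p B)) σ
        ((2 * Γ - G) * (inverseTime f top + 2100 * f (2 ^ top) +
          450 * n ^ 2 * (2 * Γ + κ + 1) ^ 2 + 100 * n + 4) + 4) fun σ' =>
        DataStored B top (realMatrix A) (fun j => (c j : ℝ)) x₀ T ε σ' ∧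
        ∃ G y, Tracks (realMatrix A) (fun i => (b i : ℝ)) (fun j => (c j : ℝ)) (x T)
          (amplification (realMatrix A) (fun j => (c j : ℝ)) x₀) (2 * G + κ) G y ∧
          ∀ j : Fin n, σ'.val (B + 13) j = y j := by
  set u := inverseTime f top + 2100 * f (2 ^ top) + 450 * n ^ 2 * (2 * Γ + κ + 1) ^ 2 + 100 * n
    with hu
  induction d using Nat.strong_induction_on with
  | _ d ih =>
    intro G hd hG σ hσ hGσ hκσ hfσ
    have hGΓ : G ≤ Γ := by omega
    have hle : G * (inverseTime f top + 2100 * f (2 ^ top) +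
        450 * n ^ 2 * (2 * G + κ + 1) ^ 2 + 100 * n) ≤ G * u := by rw [hu]; gcongr
    -- The geometric sum in telescoped form: the run with `G` steps takes its share, and the budget
    -- for starting with `2 G` remains.
    have e : (2 * Γ - G) * (u + 4) = G * (u + 4) + (2 * Γ - 2 * G) * (u + 4) := by
      rw [← add_mul]; congr 1; omega
    have e' : G * u + 4 ≤ G * (u + 4) := by nlinarith
    refine (Runs.loop_step (T := G * u) (T' := (2 * Γ - 2 * G) * (u + 4) + 4) ?_
      ((Runs.attemptCmd hp hpB hB hA hn hm hn' hc hx₀ hT hx hb hG hκ hσ hGσ hκσ).mono hle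
        ?_)).mono (by simp only [Test.cost, IExpr.cost]; omega) fun _ h => h
    · simp [Test.Holds, IExpr.eval, hfσ]
    rintro τ ⟨hτ, hGτ, hκτ, ⟨hf, y, hy, hyτ⟩ | ⟨hf, hlt⟩⟩
    · refine (Runs.loop_done ?_ ⟨hτ, G, y, hy, hyτ⟩).mono (by simp [Test.cost, IExpr.cost])
        fun _ h => h
      simp [Test.Holds, IExpr.eval, hf]
    · have := hΓ G hlt
      exact ih (Γ - 2 * G) (by omega) (2 * G) (by omega) (by omega) τ hτ hGτ hκτ hf

/-- The program that solves the Physarum dynamics numerically. -/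
def solveCmd (p : Cmd) (B : ℕ) : Cmd :=
  .seq (readCmd B)
    (.seq (copyCmd B (B + 23) (B + 13))
    (.seq (.seq (responseCmd p B) (normsCmd B))
    (.seq (.setIdx (B + 14) (.const 0) (.const 0))
    (.seq (.setVal (B + 15) (.const 0) (.load (B + 25) (.const 0)))
    (.seq (precisionLoop B)
    (.seq (.setIdx (B + 12) (.const 0) (.const 1))
    (.seq (.setIdx (B + 10) (.const 0) (.const 1))
    (.seq (.loop (.idxLt (.const 0) (.var (B + 10))) (attemptCmd p B))
      (copyCmd B (B + 13) 6)))))))))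

theorem Runs.solveCmd {m n : ℕ} {p : Cmd} {f : ℕ → ℕ} {B : ℕ} (hp : Multiplies p f)
    (hpB : p.bound ≤ B) (hB : 7 ≤ B) {A : Matrix (Fin m) (Fin n) ℤ}
    (hA : (realMatrix A).rank = m) (hn : 1 ≤ n)
    {b : Fin m → ℤ} {c : Fin n → ℤ} (hc : ∀ j, 0 < c j) {x₀ : Fin n → ℝ} (hx₀ : ∀ j, 0 < x₀ j)
    {T ε : ℝ} (hT : 0 ≤ T) (hε : 0 < ε) (hε1 : ε < 1) {x : ℝ → Fin n → ℝ}
    (hx : IsSolution A b c x₀ T x)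
    (hb : (realMatrix A).mulVec x₀ = fun i => (b i : ℝ)) {Γ : ℕ} (hΓ1 : 1 ≤ Γ)
    (hΓ : ∀ G : ℕ, (G : ℝ) < 100 * (T * (n * (maxSubdet A : ℝ) ^ 2 * norm1 c)) → 2 * G ≤ Γ)
    {σ : State} (hσ : HoldsInput σ A b c x₀ T ε) :
    ∃ top κ : ℕ, 2 ^ top ≤ 2 * n ∧ ε * 2 ^ κ ≤ 8 * (n * maxSubdet A) ∧
      Runs (solveCmd p B) σ (2 * Γ * (inverseTime f top + 2100 * f (2 ^ top) +
        450 * n ^ 2 * (2 * Γ + κ + 1) ^ 2 + 100 * n + 4) + inverseTime f top +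
        2100 * f (2 ^ top) + κ * 20 + 1100 * n ^ 2) fun σ' =>
        ∀ j, (1 - ε) * x T j ≤ σ'.val 6 j ∧ σ'.val 6 j ≤ (1 + ε) * x T j := by
  have hc' : ∀ j, (0 : ℝ) < c j := fun j => by exact_mod_cast hc j
  have hmn : m ≤ n := by
    rw [← hA]; simpa using (realMatrix A).rank_le_card_width
  have hα₀ : 1 ≤ amplification (realMatrix A) (fun j => (c j : ℝ)) x₀ := le_max_left _ _
  obtain ⟨σ₁, t₁, he₁, ht₁, top, hn', htop, hD₁⟩ := Runs.readCmd hB hn hσ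
  have hm : m ≤ 2 ^ top := hmn.trans hn'
  obtain ⟨σ₂, t₂, he₂, ht₂, hF₂, hy₂⟩ := Runs.copyCmd (s := B + 23) (d := B + 13) (by omega) hD₁.cols
  have hD₂ := hD₁.frame (hF₂.mono (show {B} ⊆ Set.Iio (B + 20) by intro a; simp; omega)
    (show {B + 13} ⊆ Set.Iio (B + 20) by intro a; simp; omega)) le_rfl le_rfl
  obtain ⟨σ₃, t₃, he₃, ht₃, hF₃, hM₃⟩ := Runs.measureCmd hp hpB hB hA hn hc' hx₀ hD₂ hm hn'
    fun j => by rw [hy₂ j j.2, hD₁.start]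
  have hD₃ := hD₂.frame hF₃ (by omega) (by omega)
  have hF₄ : Frame (Set.Iio (B + 20)) (Set.Iio (B + 20)) σ₃
      ((σ₃.setIdx (B + 14) 0 0).setVal (B + 15) 0 ε) :=
    ((Frame.refl _ _ _).setIdx (by simp) _ _).setVal (by simp) _ _
  have hD₄ := hD₃.frame hF₄ le_rfl le_rfl
  obtain ⟨κ, hκ, hκ', hrun⟩ := Runs.precisionLoop (B := B)
    (σ := (σ₃.setIdx (B + 14) 0 0).setVal (B + 15) 0 ε) hα₀ hε hε1
    (by rw [State.setVal_val_of_ne _ _ _ (by omega), State.setIdx_val, hM₃.amplification])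
    (by simp) (by simp)
  obtain ⟨σ₅, t₅, he₅, ht₅, hF₅, hκ₅⟩ := hrun
  have hF₆ : Frame (Set.Iio (B + 20)) (Set.Iio (B + 20)) σ₅
      ((σ₅.setIdx (B + 12) 0 1).setIdx (B + 10) 0 1) :=
    ((Frame.refl _ _ _).setIdx (by simp) _ _).setIdx (by simp) _ _
  have hD₆ := hD₄.frame ((hF₅.mono (show {B + 14} ⊆ Set.Iio (B + 20) by intro a; simp; omega)
    (show {B + 15} ⊆ Set.Iio (B + 20) by intro a; simp; omega)).trans hF₆) le_rfl le_rfl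
  -- The accuracy condition with `ε < 1` implies the condition that keeps every step in the region
  -- of validity.
  have hκ2 : 4 * amplification (realMatrix A) (fun j => (c j : ℝ)) x₀ ≤ 2 ^ κ := by
    nlinarith [pow_pos (zero_lt_two (α := ℝ)) κ]
  obtain ⟨σ₇, t₇, he₇, ht₇, hD₇, G, y, hy, hyσ₇⟩ := Runs.attemptLoop hp hpB hB hA hn hm hn' hc
    hx₀ hT hx hb hκ2 hΓ (Γ - 1) 1 (by omega) le_rfl _ hD₆
    (by simp [State.setIdx_idx]) (by simp [State.setIdx_idx, hκ₅]) (by simp)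
  obtain ⟨σ₈, t₈, he₈, ht₈, hF₈, hy₈⟩ := Runs.copyCmd (s := B + 13) (d := 6) (by omega) hD₇.cols
  have he₃' : Exec (.setIdx (B + 14) (.const 0) (.const 0)) σ₃ (σ₃.setIdx (B + 14) 0 0) 3 :=
    .setIdx _ _ _ _
  have he₄ := Exec.setVal (σ₃.setIdx (B + 14) 0 0) (B + 15) (.const 0)
    (.load (B + 25) (.const 0))
  simp only [IExpr.eval, RExpr.eval, State.setIdx_val, hD₃.accuracy] at he₄
  have he₅' : Exec (.setIdx (B + 12) (.const 0) (.const 1)) σ₅ (σ₅.setIdx (B + 12) 0 1) 3 :=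
    .setIdx _ _ _ _
  have he₆ : Exec (.setIdx (B + 10) (.const 0) (.const 1)) (σ₅.setIdx (B + 12) 0 1)
    ((σ₅.setIdx (B + 12) 0 1).setIdx (B + 10) 0 1) 3 := .setIdx _ _ _ _
  refine ⟨top, κ, htop, ?_, σ₈, _, .seq he₁ (.seq he₂ (.seq he₃ (.seq he₃' (.seq he₄ (.seq he₅
    (.seq he₅' (.seq he₆ (.seq he₇ he₈)))))))), ?_, fun j => ?_⟩
  · have := amplification_le hA hn hc' hx₀
    linarith
  · simp only [IExpr.cost, RExpr.cost]
    have h1 : (2 * Γ - 1) * (inverseTime f top + 2100 * f (2 ^ top) +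
        450 * n ^ 2 * (2 * Γ + κ + 1) ^ 2 + 100 * n + 4) ≤ 2 * Γ * (inverseTime f top +
        2100 * f (2 ^ top) + 450 * n ^ 2 * (2 * Γ + κ + 1) ^ 2 + 100 * n + 4) := by
      gcongr; omega
    have h2 : n ≤ n ^ 2 := by nlinarith
    omega
  · rw [hy₈ j j.2, hyσ₇]
    exact hy.bounds hα₀ hε hε1 hκ j

end RealRAM

/-! ### Estimate of the running time -/

namespace RealRAM

open Physarum

/-- Doubling the size multiplies `N ^ ω` by `2 ^ ω ≥ 2`, which pays for the two halves; each level
adds at most `5000 C N ^ ω`. The resulting factor `k` is logarithmic in the size and is absorbed by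
the logarithm in the final bound. -/
theorem inverseTime_le {ω C : ℝ} (hω : 1 ≤ ω) (hC : 1 ≤ C) (k : ℕ) :
    (inverseTime (fun n => ⌊C * (n : ℝ) ^ ω⌋₊) k : ℝ) ≤
      (100 + 5000 * C * k) * ((2 ^ k : ℕ) : ℝ) ^ ω := by
  induction k with
  | zero => simp [inverseTime]
  | succ k ih =>
    set z := ((2 ^ k : ℕ) : ℝ) ^ ω with hz
    have hz0 : 0 ≤ z := by positivity
    have h1 : (⌊C * ((2 ^ k : ℕ) : ℝ) ^ ω⌋₊ : ℝ) ≤ C * z := Nat.floor_le (by positivity)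
    have h2 : ((2 ^ (k + 1) : ℕ) : ℝ) ^ ω = 2 ^ ω * z := by
      rw [hz, ← Real.mul_rpow (by norm_num) (by positivity)]
      congr 1; push_cast; ring
    have h3 : (2 : ℝ) ≤ 2 ^ ω := by
      calc (2 : ℝ) = 2 ^ (1 : ℝ) := (Real.rpow_one 2).symm
        _ ≤ 2 ^ ω := Real.rpow_le_rpow_of_exponent_le one_le_two hω
    rw [h2, inverseTime]
    push_cast at h1 ⊢
    have h4 : 2 * ((100 + 5000 * C * (k + 1)) * z) ≤ (100 + 5000 * C * (k + 1)) * (2 ^ ω * z) := by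
      have : 0 ≤ (100 + 5000 * C * ((k : ℝ) + 1)) * z := by positivity
      nlinarith
    have h5 : 0 ≤ C * z := by positivity
    nlinarith

/-- Every term is compared with `Y = E Z (S L)²`. Since `2 S L ≥ 1`, lower powers are dominated, and
the number of steps contributes the last factor `S`. -/
theorem total_time_le {Z S L E M n Γ κ : ℝ} (hS : 1 ≤ S) (hL : 0.69 ≤ L) (hE : 1 ≤ E) (hn : 1 ≤ n)
    (hnZ : n ^ 2 ≤ Z) (hM : M ≤ 13000 * (E * Z) * L) (hΓ0 : 0 ≤ Γ) (hΓ : Γ ≤ 201 * S)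
    (hκ0 : 0 ≤ κ) (hκ : κ ≤ 5 * L) :
    2 * Γ * (M + 450 * n ^ 2 * (2 * Γ + κ + 1) ^ 2 + 100 * n + 4) + M + κ * 20 + 1100 * n ^ 2 ≤
      2 * 10 ^ 11 * E * (Z * S ^ 3 * L ^ 2) := by
  set P := S * L with hP
  have hLP : L ≤ P := by nlinarith
  have hSP : S ≤ 2 * P := by nlinarith
  have hP1 : 1 ≤ 2 * P := by linarith
  have hP0 : 0 ≤ P := by linarith
  have hPP : P ≤ 2 * P ^ 2 := by nlinarith
  have hZ : 1 ≤ Z := by nlinarith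
  have hnZ' : n ≤ Z := by nlinarith
  have hEZ : Z ≤ E * Z := by nlinarith
  have hQ : 1 ≤ 4 * P ^ 2 := by nlinarith
  have h1 : 2 * Γ + κ + 1 ≤ 820 * P := by linarith
  have h2 : (2 * Γ + κ + 1) ^ 2 ≤ 672400 * P ^ 2 := by
    calc (2 * Γ + κ + 1) ^ 2 ≤ (820 * P) ^ 2 := by gcongr
      _ = 672400 * P ^ 2 := by ring
  set Y := E * Z * P ^ 2 with hY
  have hZY : Z * P ^ 2 ≤ Y := mul_le_mul_of_nonneg_right hEZ (by positivity)
  have h3 : n ^ 2 * (2 * Γ + κ + 1) ^ 2 ≤ 672400 * Y := by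
    calc n ^ 2 * (2 * Γ + κ + 1) ^ 2 ≤ Z * (672400 * P ^ 2) :=
          mul_le_mul hnZ h2 (sq_nonneg _) (by linarith)
      _ = 672400 * (Z * P ^ 2) := by ring
      _ ≤ _ := by linarith
  have h4 : Z ≤ 4 * Y := by
    calc Z ≤ Z * (4 * P ^ 2) := le_mul_of_one_le_right (by linarith) hQ
      _ ≤ 4 * Y := by linarith
  have h5 : M ≤ 26000 * Y := by
    calc M ≤ 13000 * (E * Z) * L := hM
      _ ≤ 13000 * (E * Z) * (2 * P ^ 2) :=
        mul_le_mul_of_nonneg_left (hLP.trans hPP) (by linarith)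
      _ = _ := by rw [hY]; ring
  have h6 : κ ≤ 10 * Y := by
    calc κ ≤ 10 * P ^ 2 := by linarith
      _ ≤ 10 * (Z * P ^ 2) := by nlinarith
      _ ≤ _ := by linarith
  have hY0 : 0 ≤ Y := by positivity
  have h7 : M + 450 * n ^ 2 * (2 * Γ + κ + 1) ^ 2 + 100 * n + 4 ≤ 310000000 * Y := by
    nlinarith
  have h8 : 2 * Γ * (M + 450 * n ^ 2 * (2 * Γ + κ + 1) ^ 2 + 100 * n + 4) ≤
      2 * (201 * S) * (310000000 * Y) :=
    (mul_le_mul_of_nonneg_left h7 (by linarith)).trans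
      (mul_le_mul_of_nonneg_right (by linarith) (by linarith))
  have h9 : Y ≤ S * Y := le_mul_of_one_le_left hY0 hS
  have h10 : E * (Z * S ^ 3 * L ^ 2) = S * Y := by rw [hY, hP]; ring
  rw [mul_assoc (2 * 10 ^ 11 : ℝ), h10]
  nlinarith

theorem solve_time_le {ω C D c₁ T ε I F : ℝ} {n top κ : ℕ} (hω : 2 ≤ ω) (hC : 1 ≤ C) (hn : 1 ≤ n)
    (hD : 1 ≤ D) (hc₁ : 1 ≤ c₁) (hε : 0 < ε) (hε1 : ε < 1)
    (htop : 2 ^ top ≤ 2 * n) (hκ : ε * 2 ^ κ ≤ 8 * (n * D))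
    (hI : I ≤ (100 + 5000 * C * top) * ((2 ^ top : ℕ) : ℝ) ^ ω)
    (hF : F ≤ C * ((2 ^ top : ℕ) : ℝ) ^ ω) :
    2 * (⌈200 * max (T * (n * D ^ 2 * c₁)) 1⌉₊ : ℝ) * (I + 2100 * F + 450 * (n : ℝ) ^ 2 *
        (2 * (⌈200 * max (T * (n * D ^ 2 * c₁)) 1⌉₊ : ℝ) + κ + 1) ^ 2 + 100 * n + 4) +
        (I + 2100 * F) + κ * 20 + 1100 * (n : ℝ) ^ 2 ≤
      2 * 10 ^ 11 * (2 ^ ω * C) * ((n : ℝ) ^ (ω + 3) * D ^ 6 * c₁ ^ 3 *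
        (max T (1 / (n * D ^ 2 * c₁))) ^ 3 * Real.log (2 * n * D * c₁ / ε) ^ 2) := by
  have hn1 : (1 : ℝ) ≤ n := by exact_mod_cast hn
  have hn0 : (0 : ℝ) < n := by linarith
  obtain ⟨v, hv⟩ : ∃ v, v = (n : ℝ) * D ^ 2 * c₁ := ⟨_, rfl⟩
  have hv0 : 0 < v := by rw [hv]; positivity
  obtain ⟨S, hS⟩ : ∃ S, S = max (T * v) 1 := ⟨_, rfl⟩
  obtain ⟨a, ha⟩ : ∃ a, a = 2 * n * D * c₁ / ε := ⟨_, rfl⟩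
  obtain ⟨L, hL⟩ : ∃ L, L = Real.log a := ⟨_, rfl⟩
  have hS1 : 1 ≤ S := hS ▸ le_max_right _ _
  have hmax : max T (1 / v) = S / v := by
    rw [hS, ← max_div_div_right hv0.le, mul_div_cancel_right₀ _ hv0.ne']
  -- The factors `n³ D⁶ c₁³` are `v³`, which cancels the denominator of `max T (1 / v) = S / v`.
  have hbound : (n : ℝ) ^ (ω + 3) * D ^ 6 * c₁ ^ 3 * max T (1 / v) ^ 3 * L ^ 2 =
      (n : ℝ) ^ ω * S ^ 3 * L ^ 2 := by
    have e : (n : ℝ) ^ (ω + 3) = (n : ℝ) ^ ω * n ^ 3 := by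
      rw [Real.rpow_add hn0]; norm_cast
    rw [hmax, e, div_pow, hv]
    field_simp
  rw [← hv, ← ha, ← hL, ← hS, hbound]
  have haε : a * ε = 2 * n * D * c₁ := by rw [ha, div_mul_cancel₀ _ hε.ne']
  have h2a : 2 * (n : ℝ) ≤ a := by
    rw [ha, le_div_iff₀ hε]
    calc 2 * (n : ℝ) * ε ≤ 2 * n * 1 := by gcongr
      _ = 2 * (n : ℝ) * 1 * 1 := by ring
      _ ≤ 2 * n * D * c₁ := by gcongr
  have hlog2 := Real.log_two_gt_d9
  have hL2 : Real.log 2 ≤ L := hL ▸ Real.log_le_log (by norm_num) (by linarith)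
  have hL0 : 0 ≤ L := by linarith
  have htopL : (top : ℝ) * Real.log 2 ≤ L := by
    rw [hL, ← Real.log_pow]
    refine Real.log_le_log (by positivity) (le_trans ?_ h2a)
    exact_mod_cast htop
  -- Here `2 ^ κ ≤ 8 n D / ε ≤ 4 a`, and `a ≥ 2` turns this into `2 ^ κ ≤ a³`.
  have hκL : (κ : ℝ) * Real.log 2 ≤ 3 * L := by
    have e : 3 * L = Real.log (a ^ 3) := by rw [Real.log_pow, hL]; norm_num
    rw [e, ← Real.log_pow]
    refine Real.log_le_log (by positivity) ?_
    have h1 : (2 : ℝ) ^ κ ≤ 4 * a := by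
      have h2 : 8 * (n * D) * 1 ≤ 8 * (n * D) * c₁ := by gcongr
      have h3 : ε * 2 ^ κ ≤ ε * (4 * a) := by linarith
      exact le_of_mul_le_mul_left h3 hε
    have h3 : 4 ≤ a ^ 2 := by nlinarith
    calc (2 : ℝ) ^ κ ≤ 4 * a := h1
      _ ≤ a ^ 2 * a := mul_le_mul_of_nonneg_right h3 (by linarith)
      _ = a ^ 3 := by ring
  have hnω : (n : ℝ) ^ 2 ≤ (n : ℝ) ^ ω := by
    rw [← Real.rpow_natCast]
    exact Real.rpow_le_rpow_of_exponent_le hn1 (by exact_mod_cast hω)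
  have hE1 : 1 ≤ (2 : ℝ) ^ ω * C := by
    have := Real.one_le_rpow (one_le_two (α := ℝ)) (by linarith : 0 ≤ ω)
    nlinarith
  have hN : ((2 ^ top : ℕ) : ℝ) ^ ω ≤ 2 ^ ω * (n : ℝ) ^ ω := by
    rw [← Real.mul_rpow (by norm_num) (by positivity)]
    refine Real.rpow_le_rpow (by positivity) ?_ (by linarith)
    exact_mod_cast htop
  have hM : I + 2100 * F ≤ 13000 * (2 ^ ω * C * (n : ℝ) ^ ω) * L := by
    have h3 : (top : ℝ) ≤ 1.5 * L := by nlinarith [(Nat.cast_nonneg top : (0 : ℝ) ≤ top)]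
    have h4 : C * (5000 * top + 2200) ≤ C * (13000 * L) :=
      mul_le_mul_of_nonneg_left (by linarith) (by linarith)
    have h5 : 100 + 5000 * C * top + 2100 * C ≤ 13000 * C * L := by linarith
    calc _ ≤ (100 + 5000 * C * top + 2100 * C) * ((2 ^ top : ℕ) : ℝ) ^ ω := by linarith
      _ ≤ (13000 * C * L) * (2 ^ ω * (n : ℝ) ^ ω) :=
        mul_le_mul h5 hN (by positivity) (by positivity)
      _ = _ := by ring
  have hΓ : (⌈200 * S⌉₊ : ℝ) ≤ 201 * S := by
    have := Nat.ceil_lt_add_one (by positivity : 0 ≤ 200 * S)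
    linarith
  exact total_time_le hS1 (by linarith) hE1 hn1 hnω hM (Nat.cast_nonneg _) hΓ (Nat.cast_nonneg κ)
    (by nlinarith [(Nat.cast_nonneg κ : (0 : ℝ) ≤ κ)])

end RealRAM

theorem mainTheorem11 (ω : ℝ) (hω : RealRAM.MatrixMultiplicationTime ω) :
    ∃ (p : RealRAM.Cmd) (C : ℝ),
      ∀ (m n : ℕ) (A : Matrix (Fin m) (Fin n) ℤ) (b : Fin m → ℤ) (c : Fin n → ℤ)
        (x₀ : Fin n → ℝ) (T ε : ℝ) (x : ℝ → Fin n → ℝ),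
        1 ≤ n →
        (Physarum.realMatrix A).rank = m →
        (∀ j, 0 < c j) →
        (∀ j, 0 < x₀ j) →
        (Physarum.realMatrix A).mulVec x₀ = (fun i => (b i : ℝ)) →
        0 ≤ T → 0 < ε → ε < 1 →
        Physarum.IsSolution A b c x₀ T x →
        ∀ σ : RealRAM.State, Physarum.HoldsInput σ A b c x₀ T ε →
          ∃ (σ' : RealRAM.State) (t : ℕ), RealRAM.Exec p σ σ' t ∧
            (t : ℝ) ≤ C * ((n : ℝ) ^ (ω + 3) * (Physarum.maxSubdet A : ℝ) ^ 6 *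
              Physarum.norm1 c ^ 3 *
              (max T (1 / (n * (Physarum.maxSubdet A : ℝ) ^ 2 * Physarum.norm1 c))) ^ 3 *
              Real.log (2 * n * Physarum.maxSubdet A * Physarum.norm1 c / ε) ^ 2) ∧
            ∀ i : Fin n, (1 - ε) * x T i ≤ σ'.val 6 i ∧ σ'.val 6 i ≤ (1 + ε) * x T i := by
  obtain ⟨p, C, hC, hp⟩ := hω.multiplies
  have hω2 := hp.two_le hC
  -- The solver's own arrays start above the input and output arrays `0` to `6` and above everything
  -- that the multiplication program writes.
  refine ⟨RealRAM.solveCmd p (max 7 p.bound), 2 * 10 ^ 11 * (2 ^ ω * C), ?_⟩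
  intro m n A b c x₀ T ε x hn hA hc hx₀ hb hT hε hε1 hx σ hσ
  have hD1 : (1 : ℝ) ≤ Physarum.maxSubdet A := by exact_mod_cast Physarum.one_le_maxSubdet A
  -- The factor `200` is twice the `100` of the step condition, so that doubling a failed number of
  -- steps stays below `Γ`; the maximum with `1` makes `Γ` positive also for small `T`.
  obtain ⟨Γ, hΓ⟩ : ∃ Γ, Γ = ⌈200 * max (T * (n * (Physarum.maxSubdet A : ℝ) ^ 2 *
    Physarum.norm1 c)) 1⌉₊ := ⟨_, rfl⟩
  have hΓ' := Nat.le_ceil (200 * max (T * (n * (Physarum.maxSubdet A : ℝ) ^ 2 *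
    Physarum.norm1 c)) 1)
  rw [← hΓ] at hΓ'
  have hΓ1 := (mul_le_mul_of_nonneg_left (le_max_right (T * (n * (Physarum.maxSubdet A : ℝ) ^ 2 *
    Physarum.norm1 c)) 1) (by norm_num : (0 : ℝ) ≤ 200)).trans hΓ'
  have hΓ2 := (mul_le_mul_of_nonneg_left (le_max_left (T * (n * (Physarum.maxSubdet A : ℝ) ^ 2 *
    Physarum.norm1 c)) 1) (by norm_num : (0 : ℝ) ≤ 200)).trans hΓ'
  have hΓ3 : 1 ≤ Γ := by
    have : (1 : ℝ) ≤ Γ := by linarith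
    exact_mod_cast this
  obtain ⟨top, κ, htop, hκ, σ', t, he, ht, hy⟩ := RealRAM.Runs.solveCmd hp
    (le_max_right 7 p.bound) (le_max_left _ _) hA hn hc hx₀ hT hε hε1 hx hb hΓ3 (fun G hG => by
      have : ((2 * G : ℕ) : ℝ) ≤ Γ := by push_cast; linarith
      exact_mod_cast this) hσ
  refine ⟨σ', t, he, ?_, hy⟩
  have hfinal := RealRAM.solve_time_le (T := T) hω2 hC hn hD1 (Physarum.one_le_norm1 hn hc) hε hε1
    htop hκ (RealRAM.inverseTime_le (by linarith) hC top) (Nat.floor_le (by positivity))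
  rw [← hΓ] at hfinal
  refine le_trans ?_ hfinal
  have ht' : (t : ℝ) ≤ _ := Nat.cast_le.2 ht
  push_cast at ht' ⊢
  linarith
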